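/- A \emph{flow} $\mathbb{R}\curvearrowright(Z,\eta)$ is a nonsingular action of $\mathbb{R}$ on a standard measure space, i.e. a continuous homomorphism from $\mathbb{R}$ to the group of nonsingular automorphisms of $(Z,\eta)$, identified modulo almost everywhere equality. It is identified with the action $(t\cdot F)(z)=F((-t)\cdot z)$ on $L^\infty(Z,\eta)$, and an isomorphism between actions of $\mathbb{R}$ on abelian von Neumann algebras is an $\mathbb{R}$-equivariant $*$-isomorphism. The \emph{joint flow} of finitely many flows $\mathbb{R}\curvearrowright(Z_i,\eta_i)$, $1\le i\le L$, is the action of $\mathbb{R}$ in the first variable on the algebra $L^\infty(Z_1\times\cdots\times Z_L)^H$ of elements that are invariant under the coordinatewise action of $H=\{t\in\mathbb{R}^L : t_1+\cdots+t_L=0\}$. A flow is \emph{infinitely divisible} if for every integer $L\ge 1$ it is isomorphic with the joint flow of $L$ copies of some flow $\mathbb{R}\curvearrowright(Z_1,\eta_1)$. Let $(\mu_n)_{n\ge1}$ be a sequence of Borel probability measures on $\mathbb{R}$. Put $\Omega_n=\prod_{k>n}(\mathbb{R},\mu_k)$ and $\Omega=\Omega_0$, equip $\mathbb{R}$ with the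 Lebesgue measure class, and let $\pi_n:\mathbb{R}\times\Omega\to\mathbb{R}\times\Omega_n$, $\pi_n(t,\omega)=(t+\omega_1+\cdots+\omega_n,\omega_{n+1},\omega_{n+2},\ldots)$. The \emph{tail boundary flow} of $(\mu_n)$ is the action of $\mathbb{R}$ by translation in the first variable on $A=\bigcap_{n\ge0}\{G\circ\pi_n : G\in L^\infty(\mathbb{R}\times\Omega_n)\}\subset L^\infty(\mathbb{R}\times\Omega)$. For a finite positive Borel measure $\rho$ on $\mathbb{R}$, the \emph{compound Poisson distribution} is $\mathcal{E}(\rho)=e^{-\rho(\mathbb{R})}\sum_{k\ge0}\frac{1}{k!}\rho^{*k}$, with $\rho^{*0}=\delta_0$. A \emph{Poisson flow} is an ergodic flow that is isomorphic with the tail boundary flow of a sequence $(\mathcal{E}(\rho_n))_{n\ge1}$ of compound Poisson distributions. \textbf{Proposition.} (1) Every Poisson flow is infinitely divisible. (2) If $(\mu_n)_{n\ge1}$ is a sequence of infinitely divisible probability distributions on $\mathbb{R}$ (i.e. for all $n,k\ge1$ there is a probability measure $\nu$ on $\mathbb{R}$ with $\nu^{*k}=\mu_n$), then every flow isomorphic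 with the tail boundary flow of $(\mu_n)_{n\ge1}$ is a Poisson flow. -/

import Mathlib

open MeasureTheory MeasureTheory.Measure Filter Topology
open scoped ENNReal

universe u v

namespace BoundaryFlow

noncomputable section

/-! ### The algebra of (classes of) complex measurable functions and the algebra `L^∞` -/

section Algebra

variable {X : Type u} [MeasurableSpace X] {m : Measure X}

instance instCommRingAEEqFun : CommRing (X →ₘ[m] ℂ) :=
  { (inferInstance : AddCommGroup (X →ₘ[m] ℂ)), (inferInstance : CommMonoid (X →ₘ[m] ℂ)) with
    left_distrib := fun a b c => by
      induction a using AEEqFun.induction_on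
      induction b using AEEqFun.induction_on
      induction c using AEEqFun.induction_on
      simp only [AEEqFun.mk_add_mk, AEEqFun.mk_mul_mk, mul_add]
    right_distrib := fun a b c => by
      induction a using AEEqFun.induction_on
      induction b using AEEqFun.induction_on
      induction c using AEEqFun.induction_on
      simp only [AEEqFun.mk_add_mk, AEEqFun.mk_mul_mk, add_mul]
    zero_mul := fun a => by
      induction a using AEEqFun.induction_on
      simp only [AEEqFun.zero_def, AEEqFun.mk_mul_mk]
      congr 1
      funext x
      simp
    mul_zero := fun a => by
      induction a using AEEqFun.induction_on
      simp only [AEEqFun.zero_def, AEEqFun.mk_mul_mk]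
      congr 1
      funext x
      simp }

instance instAlgebraAEEqFun : Algebra ℂ (X →ₘ[m] ℂ) :=
  Algebra.ofModule
    (fun r a b => by
      induction a using AEEqFun.induction_on with | _ f hf
      induction b using AEEqFun.induction_on with | _ g hg
      exact congrArg (fun h => Quotient.mk'' h) (Subtype.ext (smul_mul_assoc r f g)))
    (fun r a b => by
      induction a using AEEqFun.induction_on with | _ f hf
      induction b using AEEqFun.induction_on with | _ g hg
      exact congrArg (fun h => Quotient.mk'' h) (Subtype.ext (mul_smul_comm r f g)))

instance instStarRingAEEqFun : StarRing (X →ₘ[m] ℂ) where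
  star_involutive := star_involutive
  star_mul a b := by
    refine AEEqFun.ext ?_
    filter_upwards [AEEqFun.coeFn_star (a * b), AEEqFun.coeFn_mul a b,
      AEEqFun.coeFn_mul (star b) (star a), AEEqFun.coeFn_star a, AEEqFun.coeFn_star b]
      with x h1 h2 h3 h4 h5
    rw [h1, h3]
    simp [h2, h4, h5, mul_comm]
  star_add a b := by
    refine AEEqFun.ext ?_
    filter_upwards [AEEqFun.coeFn_star (a + b), AEEqFun.coeFn_add a b,
      AEEqFun.coeFn_add (star a) (star b), AEEqFun.coeFn_star a, AEEqFun.coeFn_star b]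
      with x h1 h2 h3 h4 h5
    rw [h1, h3]
    simp [h2, h4, h5]

instance instStarModuleAEEqFun : StarModule ℂ (X →ₘ[m] ℂ) where
  star_smul r a := by
    refine AEEqFun.ext ?_
    filter_upwards [AEEqFun.coeFn_star (r • a), AEEqFun.coeFn_smul r a,
      AEEqFun.coeFn_smul (star r) (star a), AEEqFun.coeFn_star a] with x h1 h2 h3 h4
    rw [h1, h3]
    simp [h2, h4]

theorem coeFn_algebraMap (r : ℂ) :
    (algebraMap ℂ (X →ₘ[m] ℂ) r : X → ℂ) =ᵐ[m] fun _ => r := by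
  rw [Algebra.algebraMap_eq_smul_one]
  filter_upwards [AEEqFun.coeFn_smul r (1 : X →ₘ[m] ℂ), AEEqFun.coeFn_one (α := X) (μ := m) (β := ℂ)]
    with x h1 h2
  rw [h1]
  simp [h2]

variable (m) in
/-- `L^∞(X, m)`: classes of essentially bounded measurable functions. -/
def Linfty : StarSubalgebra ℂ (X →ₘ[m] ℂ) where
  carrier := {F | ∃ C : ℝ, ∀ᵐ x ∂m, ‖F x‖ ≤ C}
  mul_mem' := by
    rintro a b ⟨C, hC⟩ ⟨D, hD⟩
    refine ⟨C * D, ?_⟩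
    filter_upwards [hC, hD, AEEqFun.coeFn_mul a b] with x h1 h2 h3
    rw [h3, Pi.mul_apply, norm_mul]
    exact mul_le_mul h1 h2 (norm_nonneg _) ((norm_nonneg _).trans h1)
  add_mem' := by
    rintro a b ⟨C, hC⟩ ⟨D, hD⟩
    refine ⟨C + D, ?_⟩
    filter_upwards [hC, hD, AEEqFun.coeFn_add a b] with x h1 h2 h3
    rw [h3, Pi.add_apply]
    exact (norm_add_le _ _).trans (add_le_add h1 h2)
  algebraMap_mem' r := by
    refine ⟨‖r‖, ?_⟩
    filter_upwards [coeFn_algebraMap (m := m) r] with x h1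
    rw [h1]
  star_mem' := by
    rintro a ⟨C, hC⟩
    refine ⟨C, ?_⟩
    filter_upwards [hC, AEEqFun.coeFn_star a] with x h1 h2
    rw [h2, Pi.star_apply, norm_star]
    exact h1

theorem mem_Linfty {F : X →ₘ[m] ℂ} : F ∈ Linfty m ↔ ∃ C : ℝ, ∀ᵐ x ∂m, ‖F x‖ ≤ C := Iff.rfl

variable {Y : Type v} [MeasurableSpace Y] {m' : Measure Y}

/-- The `*`-homomorphism `F ↦ F ∘ T` for a map `T` with `T_* m ≪ m'`. -/
def pullback (T : X → Y) (hT : QuasiMeasurePreserving T m m') :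
    (Y →ₘ[m'] ℂ) →⋆ₐ[ℂ] (X →ₘ[m] ℂ) where
  toFun F := F.compQuasiMeasurePreserving T hT
  map_one' := rfl
  map_mul' a b := by
    induction a using AEEqFun.induction_on
    induction b using AEEqFun.induction_on
    rfl
  map_zero' := rfl
  map_add' a b := by
    induction a using AEEqFun.induction_on
    induction b using AEEqFun.induction_on
    rfl
  commutes' r := by
    simp only [Algebra.algebraMap_eq_smul_one]
    rfl
  map_star' a := by
    induction a using AEEqFun.induction_on
    rfl

theorem coeFn_pullback (T : X → Y) (hT : QuasiMeasurePreserving T m m') (F : Y →ₘ[m'] ℂ) :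
    (pullback T hT F : X → ℂ) =ᵐ[m] F ∘ T :=
  AEEqFun.coeFn_compQuasiMeasurePreserving F hT

theorem pullback_mem_Linfty (T : X → Y) (hT : QuasiMeasurePreserving T m m') {F : Y →ₘ[m'] ℂ}
    (hF : F ∈ Linfty m') : pullback T hT F ∈ Linfty m := by
  obtain ⟨C, hC⟩ := hF
  refine ⟨C, ?_⟩
  filter_upwards [coeFn_pullback T hT F, hT.ae hC] with x h1 h2
  rw [h1]
  exact h2

theorem pullback_pullback {W : Type*} [MeasurableSpace W] {m'' : Measure W}
    (T : X → Y) (hT : QuasiMeasurePreserving T m m')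
    (S : Y → W) (hS : QuasiMeasurePreserving S m' m'')
    (F : W →ₘ[m''] ℂ) :
    pullback T hT (pullback S hS F) = pullback (S ∘ T) (hS.comp hT) F :=
  (AEEqFun.compQuasiMeasurePreserving_comp F hS hT).symm

theorem pullback_congr {T T' : X → Y} (hT : QuasiMeasurePreserving T m m')
    (hT' : QuasiMeasurePreserving T' m m') (h : T = T') (F : Y →ₘ[m'] ℂ) :
    pullback T hT F = pullback T' hT' F := by
  subst h
  rfl

end Algebra

/-- Two actions of `ℝ` on `*`-algebras are isomorphic: there is an equivariant `*`-isomorphism.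
(A `*`-isomorphism between abelian von Neumann algebras is automatically normal.) -/
def ActionsIsomorphic {A : Type*} {B : Type*} [Semiring A] [Algebra ℂ A] [Star A]
    [Semiring B] [Algebra ℂ B] [Star B] (a : ℝ → A → A) (b : ℝ → B → B) : Prop :=
  ∃ φ : A ≃⋆ₐ[ℂ] B, ∀ (s : ℝ) (F : A), φ (a s F) = b s (φ F)

/-! ### Flows -/

/-- A flow: a nonsingular action of `ℝ` on a standard measure space `(Z, η)`, that is, a continuous
homomorphism from `ℝ` to the group `Aut(Z, η)` of nonsingular automorphisms modulo almost
everywhere equality. Each `act t` is nonsingular and invertible modulo null sets because `act t` and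
`act (-t)` are both quasi measure preserving and inverse to each other almost everywhere.
The topology of `Aut(Z, η)` is that of pointwise norm convergence on the finite measures `ν ≪ η`
(the predual of `L^∞(Z, η)`). -/
structure NSFlow where
  Space : Type u
  [measurableSpace : MeasurableSpace Space]
  [standardBorelSpace : StandardBorelSpace Space]
  meas : Measure Space
  [sigmaFinite : SigmaFinite meas]
  act : ℝ → Space → Space
  quasiMeasurePreserving : ∀ t, QuasiMeasurePreserving (act t) meas meas
  act_zero : act 0 =ᵐ[meas] id
  act_add : ∀ s t, act (s + t) =ᵐ[meas] act s ∘ act t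
  continuous_act : ∀ ν : Measure Space, IsFiniteMeasure ν → ν ≪ meas → ∀ s : ℝ, ∀ ε > 0,
    ∀ᶠ t in 𝓝 s, ∀ E : Set Space, MeasurableSet E →
      |ν.real (act t ⁻¹' E) - ν.real (act s ⁻¹' E)| ≤ ε

attribute [instance] NSFlow.measurableSpace NSFlow.standardBorelSpace NSFlow.sigmaFinite

/-- The action `(s · F)(z) = F((-s) · z)` of `ℝ` on `L^∞(Z, η)` given by a flow. -/
def NSFlow.LinftyAct (α : NSFlow.{u}) (s : ℝ) (F : Linfty α.meas) : Linfty α.meas :=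
  ⟨pullback (α.act (-s)) (α.quasiMeasurePreserving (-s)) F,
    pullback_mem_Linfty _ _ F.2⟩

/-- Ergodicity: every invariant Borel set is null or conull. -/
def NSFlow.IsErgodic (α : NSFlow.{u}) : Prop :=
  ∀ E : Set α.Space, MeasurableSet E → (∀ t, α.act t ⁻¹' E =ᵐ[α.meas] E) →
    α.meas E = 0 ∨ α.meas Eᶜ = 0

/-! ### Joint flows and infinite divisibility of flows -/

theorem quasiMeasurePreserving_pi : ∀ {n : ℕ} {Z : Fin n → Type u} [∀ i, MeasurableSpace (Z i)]
    (η : ∀ i, Measure (Z i)) [∀ i, SigmaFinite (η i)] (f : ∀ i, Z i → Z i)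
    (_ : ∀ i, QuasiMeasurePreserving (f i) (η i) (η i)),
    QuasiMeasurePreserving (fun (z : ∀ i, Z i) i => f i (z i)) (Measure.pi η) (Measure.pi η) := by
  intro n
  induction n with
  | zero =>
    intro Z _ η _ f _
    have : (fun (z : ∀ i, Z i) i => f i (z i)) = id := Subsingleton.elim _ _
    rw [this]
    exact QuasiMeasurePreserving.id _
  | succ n ih =>
    intro Z _ η _ f hf
    have e := measurePreserving_piFinSuccAbove η 0
    have h := MeasureTheory.QuasiMeasurePreserving.prodMap (hf 0) (ih (fun j => η (Fin.succAbove 0 j)) (fun j => f (Fin.succAbove 0 j))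
      (fun j => hf _))
    have h2 := ((e.symm _).quasiMeasurePreserving.comp h).comp e.quasiMeasurePreserving
    convert h2 using 1
    funext z i
    refine Fin.cases ?_ (fun j => ?_) i
    · rfl
    · rfl

section Joint

variable {n : ℕ} (α : Fin n → NSFlow.{u})

/-- The action of `t ∈ ℝⁿ` on `Z₁ × ⋯ × Zₙ`, coordinate by coordinate. -/
def prodAct (t : Fin n → ℝ) (z : ∀ i, (α i).Space) : ∀ i, (α i).Space :=
  fun i => (α i).act (t i) (z i)

theorem quasiMeasurePreserving_prodAct (t : Fin n → ℝ) :
    QuasiMeasurePreserving (prodAct α t) (Measure.pi fun i => (α i).meas)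
      (Measure.pi fun i => (α i).meas) :=
  quasiMeasurePreserving_pi _ (fun i => (α i).act (t i)) fun i =>
    (α i).quasiMeasurePreserving (t i)

theorem prodAct_add (s t : Fin n → ℝ) :
    prodAct α (s + t) =ᵐ[Measure.pi fun i => (α i).meas] prodAct α s ∘ prodAct α t := by
  have h : ∀ᵐ z ∂(Measure.pi fun i => (α i).meas), ∀ i,
      (α i).act (s i + t i) (z i) = (α i).act (s i) ((α i).act (t i) (z i)) :=
    ae_all_iff.2 fun i => (quasiMeasurePreserving_eval (μ := fun i => (α i).meas) i).ae
      ((α i).act_add (s i) (t i))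
  filter_upwards [h] with z hz
  funext i
  exact hz i

/-- The `*`-automorphism of the algebra of measurable functions on `Z₁ × ⋯ × Zₙ` given by
`t ∈ ℝⁿ`. -/
def prodLift (t : Fin n → ℝ) :
    ((∀ i, (α i).Space) →ₘ[Measure.pi fun i => (α i).meas] ℂ) →⋆ₐ[ℂ]
      ((∀ i, (α i).Space) →ₘ[Measure.pi fun i => (α i).meas] ℂ) :=
  pullback (prodAct α (-t)) (quasiMeasurePreserving_prodAct α (-t))

theorem prodLift_prodLift (s t : Fin n → ℝ)
    (F : (∀ i, (α i).Space) →ₘ[Measure.pi fun i => (α i).meas] ℂ) :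
    prodLift α s (prodLift α t F) = prodLift α (s + t) F := by
  unfold prodLift
  rw [pullback_pullback]
  refine AEEqFun.compQuasiMeasurePreserving_congr F
    ((quasiMeasurePreserving_prodAct α (-t)).comp (quasiMeasurePreserving_prodAct α (-s)))
    (quasiMeasurePreserving_prodAct α (-(s + t))).measurable ?_
  have h := prodAct_add α (-t) (-s)
  rw [show -t + -s = -(s + t) by abel] at h
  exact h.symm

/-- The algebra `L^∞(Z₁ × ⋯ × Zₙ)^H` of the functions that are invariant under the action of
`H = {t ∈ ℝⁿ | t₁ + ⋯ + tₙ = 0}`; for `n = 2` these are the functions that are invariant under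
`t · (x, y) = (t · x, (-t) · y)`. -/
def jointAlgebra :
    StarSubalgebra ℂ ((∀ i, (α i).Space) →ₘ[Measure.pi fun i => (α i).meas] ℂ) where
  carrier := {F | F ∈ Linfty (Measure.pi fun i => (α i).meas) ∧
    ∀ t : Fin n → ℝ, ∑ i, t i = 0 → prodLift α t F = F}
  mul_mem' := fun ha hb => ⟨mul_mem ha.1 hb.1, fun t ht => by
    rw [map_mul, ha.2 t ht, hb.2 t ht]⟩
  add_mem' := fun ha hb => ⟨add_mem ha.1 hb.1, fun t ht => by
    rw [map_add, ha.2 t ht, hb.2 t ht]⟩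
  algebraMap_mem' := fun r => ⟨algebraMap_mem _ r, fun t _ => (prodLift α t).toAlgHom.commutes r⟩
  star_mem' := fun ha => ⟨star_mem ha.1, fun t ht => by rw [map_star, ha.2 t ht]⟩

/-- The joint flow: the action of `ℝ` on `jointAlgebra α` in the variable `i` (all choices of `i`
give the same action). -/
def jointAct (i : Fin n) (s : ℝ) (F : jointAlgebra α) : jointAlgebra α :=
  ⟨prodLift α (Pi.single i s) F, pullback_mem_Linfty _ _ F.2.1, fun t ht => by
    rw [prodLift_prodLift, add_comm, ← prodLift_prodLift, F.2.2 t ht]⟩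

end Joint

/-- `α` is isomorphic with the joint flow of the flows `β 0, …, β (n - 1)`, where `n ≥ 1`. -/
def IsJointFlow (α : NSFlow.{u}) {n : ℕ} (hn : 1 ≤ n) (β : Fin n → NSFlow.{v}) : Prop :=
  ActionsIsomorphic α.LinftyAct (jointAct β ⟨0, hn⟩)

/-- A flow is infinitely divisible if for every `L ≥ 1` it is isomorphic with the joint flow of `L`
copies of a single flow. (Every standard Borel space has a copy in `Type`.) -/
def NSFlow.IsInfinitelyDivisible (α : NSFlow.{u}) : Prop :=
  ∀ (L : ℕ) (hL : 1 ≤ L), ∃ β : NSFlow.{0}, IsJointFlow α hL (fun _ : Fin L => β)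

/-! ### Tail boundary flows -/

section Tail

/-- The measure on `ℝ × Ωₙ`, `Ωₙ = ∏_{k > n} (ℝ, μ_k)`; the factors are indexed from `0`, so that
the first factor of `Ωₙ` carries `μ n`. Lebesgue measure on the first factor `ℝ` may
be used in place of an equivalent probability measure: `L^∞` depends on the measure class only. -/
def pathMeasure (μ : ℕ → Measure ℝ) (n : ℕ) : Measure (ℝ × (ℕ → ℝ)) :=
  (volume : Measure ℝ).prod (infinitePi fun k => μ (n + k))

/-- `πₙ(t, ω) = (t + ω_0 + ⋯ + ω_{n-1}, (ω_n, ω_{n+1}, …))`. -/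
def pathMap (n : ℕ) (p : ℝ × (ℕ → ℝ)) : ℝ × (ℕ → ℝ) :=
  (p.1 + ∑ i ∈ Finset.range n, p.2 i, fun k => p.2 (n + k))

variable (μ : ℕ → Measure ℝ) [∀ n, IsProbabilityMeasure (μ n)]

theorem measurePreserving_shift (n : ℕ) :
    MeasurePreserving (fun (ω : ℕ → ℝ) k => ω (n + k)) (infinitePi fun k => μ (0 + k))
      (infinitePi fun k => μ (n + k)) := by
  refine ⟨by fun_prop, ?_⟩
  refine eq_infinitePi _ fun s t ht => ?_
  rw [Measure.map_apply (by fun_prop) (.pi s.countable_toSet fun _ _ => ht _)]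
  have : (fun (ω : ℕ → ℝ) k => ω (n + k)) ⁻¹' ((s : Set ℕ).pi t) =
      ((s.map (addLeftEmbedding n) : Finset ℕ) : Set ℕ).pi (fun j => t (j - n)) := by
    ext x
    simp
  rw [this, infinitePi_pi _ (fun i _ => ht _)]
  simp

theorem quasiMeasurePreserving_pathMap (n : ℕ) :
    QuasiMeasurePreserving (pathMap n) (pathMeasure μ 0) (pathMeasure μ n) := by
  have h1 : Measurable (pathMap n) := by
    unfold pathMap
    fun_prop
  have hskew : MeasurePreserving
      (fun p : (ℕ → ℝ) × ℝ => ((fun k => p.1 (n + k)), p.2 + ∑ i ∈ Finset.range n, p.1 i))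
      ((infinitePi fun k => μ (0 + k)).prod volume) ((infinitePi fun k => μ (n + k)).prod volume) :=
    (measurePreserving_shift μ n).skew_product
      (g := fun ω t => t + ∑ i ∈ Finset.range n, ω i) (by fun_prop)
      (ae_of_all _ fun ω => (measurePreserving_add_right volume _).map_eq)
  have h := (Measure.measurePreserving_swap.comp hskew).comp
    (Measure.measurePreserving_swap (μ := (volume : Measure ℝ))
      (ν := infinitePi fun k => μ (0 + k)))
  exact h.quasiMeasurePreserving

theorem quasiMeasurePreserving_translate (n : ℕ) (s : ℝ) :
    QuasiMeasurePreserving (fun p : ℝ × (ℕ → ℝ) => (p.1 + s, p.2)) (pathMeasure μ n)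
      (pathMeasure μ n) :=
  ((measurePreserving_add_right volume s).prod
    (MeasurePreserving.id (infinitePi fun k => μ (n + k)))).quasiMeasurePreserving

/-- The tail boundary `A = ⋂ₙ Aₙ`, `Aₙ = (πₙ)_* L^∞(ℝ × Ωₙ) = {G ∘ πₙ | G ∈ L^∞(ℝ × Ωₙ)}`, inside
`L^∞(ℝ × Ω)`. -/
def tailBoundary : StarSubalgebra ℂ ((ℝ × (ℕ → ℝ)) →ₘ[pathMeasure μ 0] ℂ) :=
  ⨅ n : ℕ, (Linfty (pathMeasure μ n)).map
    (pullback (pathMap n) (quasiMeasurePreserving_pathMap μ n))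

/-- The tail boundary flow: the translation action `(s · F)(t, ω) = F(t - s, ω)` on the tail
boundary. -/
def tailBoundaryAct (s : ℝ) (F : tailBoundary μ) : tailBoundary μ :=
  ⟨pullback (fun p => (p.1 + (-s), p.2)) (quasiMeasurePreserving_translate μ 0 (-s)) F, by
    have hF := F.2
    simp only [tailBoundary, StarSubalgebra.mem_iInf, StarSubalgebra.mem_map] at hF ⊢
    intro n
    obtain ⟨G, hG, hGF⟩ := hF n
    refine ⟨pullback (fun p => (p.1 + (-s), p.2)) (quasiMeasurePreserving_translate μ n (-s)) G,
      pullback_mem_Linfty _ _ hG, ?_⟩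
    rw [← hGF, pullback_pullback, pullback_pullback]
    refine pullback_congr _ _ ?_ _
    funext p
    simp [pathMap, add_right_comm]⟩

end Tail

/-- `α` is (isomorphic with) the tail boundary flow of the sequence `μ`. -/
def IsTailBoundaryFlow (α : NSFlow.{u}) (μ : ℕ → Measure ℝ) [∀ n, IsProbabilityMeasure (μ n)] :
    Prop :=
  ActionsIsomorphic α.LinftyAct (tailBoundaryAct μ)

/-! ### Compound Poisson distributions, Poisson flows, infinitely divisible distributions -/

/-- The convolution power `ρ^{*k}`, with `ρ^{*0} = δ₀`. -/
def convPow (ρ : Measure ℝ) : ℕ → Measure ℝ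
  | 0 => dirac 0
  | k + 1 => (convPow ρ k).conv ρ

/-- The compound Poisson distribution `exp(-ρ(ℝ)) ∑ₖ ρ^{*k} / k!` of a finite measure `ρ`. -/
def compoundPoisson (ρ : Measure ℝ) : Measure ℝ :=
  ENNReal.ofReal (Real.exp (-ρ.real Set.univ)) •
    Measure.sum fun k : ℕ => ENNReal.ofReal ((k.factorial : ℝ)⁻¹) • convPow ρ k

theorem convPow_univ (ρ : Measure ℝ) [IsFiniteMeasure ρ] (k : ℕ) :
    SFinite (convPow ρ k) ∧ convPow ρ k Set.univ = ρ Set.univ ^ k := by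
  induction k with
  | zero => exact ⟨by unfold convPow; infer_instance, by simp [convPow]⟩
  | succ k ih =>
    have := ih.1
    refine ⟨by unfold convPow; infer_instance, ?_⟩
    rw [convPow, Measure.conv, Measure.map_apply (by fun_prop) .univ, Set.preimage_univ,
      ← Set.univ_prod_univ, Measure.prod_prod, ih.2, pow_succ]

instance isProbabilityMeasure_compoundPoisson (ρ : Measure ℝ) [IsFiniteMeasure ρ] :
    IsProbabilityMeasure (compoundPoisson ρ) := by
  constructor
  have hsum := NormedSpace.expSeries_div_hasSum_exp (ρ.real Set.univ)
  rw [← Real.exp_eq_exp_ℝ] at hsum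
  have h1 : ∀ k : ℕ, ENNReal.ofReal ((k.factorial : ℝ)⁻¹) * ρ Set.univ ^ k =
      ENNReal.ofReal (ρ.real Set.univ ^ k / k.factorial) := fun k => by
    rw [div_eq_inv_mul, ENNReal.ofReal_mul (by positivity),
      ENNReal.ofReal_pow measureReal_nonneg, ofReal_measureReal]
  simp only [compoundPoisson, Measure.smul_apply, Measure.sum_apply _ MeasurableSet.univ,
    smul_eq_mul, (convPow_univ ρ _).2, h1]
  rw [← ENNReal.ofReal_tsum_of_nonneg (fun k => by positivity) hsum.summable, hsum.tsum_eq,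
    ← ENNReal.ofReal_mul (Real.exp_pos _).le, ← Real.exp_add]
  simp

/-- A Poisson flow: an ergodic flow that is the tail boundary flow of a sequence of compound
Poisson distributions. -/
def NSFlow.IsPoisson (α : NSFlow.{u}) : Prop :=
  α.IsErgodic ∧ ∃ (ρ : ℕ → Measure ℝ) (_ : ∀ n, IsFiniteMeasure (ρ n)),
    IsTailBoundaryFlow α fun n => compoundPoisson (ρ n)

/-- Infinitely divisible distributions on `ℝ`: for every `k ≥ 1`, `μ` is the `k`-th convolution
power of a probability measure. -/
def IsInfinitelyDivisibleDistribution (μ : Measure ℝ) : Prop :=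
  ∀ k : ℕ, 1 ≤ k → ∃ ν : Measure ℝ, IsProbabilityMeasure ν ∧ convPow ν k = μ

end

end BoundaryFlow

namespace BoundaryFlow

noncomputable section

/-! ### Isomorphisms of actions -/

/-! Elements of a tail boundary are the boundary values of bounded harmonic sequences, `H n = μ n *
H (n + 1)` almost everywhere. Along a random path `H n` is a bounded martingale, hence converges
(`IsHarmonic.exists_boundary`). Conversely, conditioning a tail function on the first `n` steps
gives a function of the position at time `n` (`exists_isHarmonic`). The Poisson formula makes the
two sides determine each other and each other's positivity.

For (2), let `ν` be a `k`-th convolution root of an infinitely divisible `μ`, with characteristic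
function `z`. Then `z ^ k` and `exp (k * (z - 1))` differ by at most `k * |1 - z|²`, which is
`O(1/k)`, so compound Poisson laws of `k • ν` converge weakly to `μ`. Each `μ n` is thus replaced by
a compound Poisson law at bounded Lipschitz distance at most `2⁻ⁿ`. Weak closeness says nothing
about merely bounded functions, but the integrals of harmonic functions over intervals of fixed
length are bounded and Lipschitz. Summable errors therefore turn a harmonic sequence for one walk
into a harmonic sequence for the other, with asymptotically equal interval integrals
(`IsHarmonic.exists_intervalClose`). The resulting correspondence of boundary values is linear,
unital and preserves positivity in both directions. Such a correspondence between commutative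
algebras is automatically multiplicative, by the Kadison-Schwarz inequality applied both ways
(`PositiveCorrespondence.star_mul_self`). Ergodicity holds because an invariant boundary value has
translation invariant, hence constant, harmonic functions.

For (1), the compound Poisson law of `ρ` is the `L`-th convolution power of that of `ρ / L`. Realize
the tail boundary for the laws of `ρ n / L` by a point flow `β` with a factor map `q` from path
space (`exists_isBoundaryRealization`). Adding `L` independent paths carries the measure class for
`ρ n / L` to the one for `ρ n`. Both the tail boundary of the sum and the joint algebra of `L`
copies of `β` embed in the functions of `L` paths, and the claim is that the images agree. A tail
function of the sum is a tail function of all paths together, hence a function of their `q`-values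
(`IsBoundaryRealization.exists_comp_pi`). Conversely, if a function of the `q`-values is invariant
under zero-sum translations, then its conditional expectations are functions of the sum of the
positions, and the limit is a boundary function of the sum of the paths
(`exists_eq_boundaryLimit_sum`). -/

theorem ActionsIsomorphic.trans {A B C : Type*} [Semiring A] [Algebra ℂ A] [Star A]
    [Semiring B] [Algebra ℂ B] [Star B] [Semiring C] [Algebra ℂ C] [Star C]
    {a : ℝ → A → A} {b : ℝ → B → B} {c : ℝ → C → C}
    (h₁ : ActionsIsomorphic a b) (h₂ : ActionsIsomorphic b c) : ActionsIsomorphic a c := by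
  obtain ⟨φ, hφ⟩ := h₁
  obtain ⟨ψ, hψ⟩ := h₂
  exact ⟨φ.trans ψ, fun s F => by simp [hφ, hψ]⟩

/-- A multiplicative, star preserving linear correspondence between two algebras that is the graph
of a bijection is a star isomorphism; it is equivariant if the correspondence is invariant. -/
theorem actionsIsomorphic_of_correspondence {A B : Type*} [Ring A] [Algebra ℂ A] [Star A]
    [Ring B] [Algebra ℂ B] [Star B] {a : ℝ → A → A} {b : ℝ → B → B} (Q : A → B → Prop)
    (add : ∀ {F G F' G'}, Q F F' → Q G G' → Q (F + G) (F' + G'))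
    (smul : ∀ (c : ℂ) {F F'}, Q F F' → Q (c • F) (c • F'))
    (mul : ∀ {F G F' G'}, Q F F' → Q G G' → Q (F * G) (F' * G'))
    (star : ∀ {F F'}, Q F F' → Q (star F) (star F'))
    (left_total : ∀ F, ∃ F', Q F F') (right_total : ∀ F', ∃ F, Q F F')
    (left_zero : ∀ {F}, Q F 0 → F = 0) (right_zero : ∀ {F'}, Q 0 F' → F' = 0)
    (act : ∀ s {F F'}, Q F F' → Q (a s F) (b s F')) : ActionsIsomorphic a b := by
  have sub : ∀ {F G F' G'}, Q F F' → Q G G' → Q (F - G) (F' - G') := fun h₁ h₂ => by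
    have := add h₁ (smul (-1) h₂)
    rwa [neg_one_smul, neg_one_smul, ← sub_eq_add_neg, ← sub_eq_add_neg] at this
  have uniq : ∀ {F F' G'}, Q F F' → Q F G' → F' = G' := fun h₁ h₂ => by
    have := sub h₁ h₂
    rw [sub_self] at this
    exact sub_eq_zero.1 (right_zero this)
  have uniq' : ∀ {F G F'}, Q F F' → Q G F' → F = G := fun h₁ h₂ => by
    have := sub h₁ h₂
    rw [sub_self] at this
    exact sub_eq_zero.1 (left_zero this)
  choose f hf using left_total
  choose g hg using right_total
  refine ⟨{ toFun := f, invFun := g, left_inv := fun F => uniq' (hg _) (hf _),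
            right_inv := fun F => uniq (hf _) (hg _),
            map_mul' := fun F G => uniq (hf _) (mul (hf _) (hf _)),
            map_add' := fun F G => uniq (hf _) (add (hf _) (hf _)),
            map_star' := fun F => uniq (hf _) (star (hf _)),
            map_smul' := fun c F => uniq (hf _) (smul c (hf _)) }, fun s F => ?_⟩
  exact uniq (hf _) (act s (hf F))

/-- Two expanded squares suffice: `F + G` gives `F* G + G* F`, and `-I` times the contribution of `F
+ I • G` gives `F* G - G* F`. Preservation of squares thus implies preservation of products. -/
theorem polarization_identity {R : Type*} [CommRing R] [Algebra ℂ R] [StarRing R]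
    [StarModule ℂ R] (F G : R) :
    (1 / 2 : ℂ) • (star (F + G) * (F + G) - star F * F - star G * G +
      -Complex.I • (star (F + Complex.I • G) * (F + Complex.I • G) - star F * F -
        star G * G)) = star F * G := by
  simp only [star_add, star_smul, add_mul, mul_add, smul_mul_assoc, mul_smul_comm,
    Complex.star_def, Complex.conj_I]
  match_scalars <;> grind [Complex.I_mul_I]

/-! ### Order isomorphisms between algebras of bounded functions are multiplicative. -/

section Positive

variable {X : Type u} [MeasurableSpace X] {m : Measure X}
  {Y : Type v} [MeasurableSpace Y] {m' : Measure Y}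

/-- Almost everywhere real and nonnegative. -/
def AENonneg (F : X →ₘ[m] ℂ) : Prop := ∀ᵐ x ∂m, 0 ≤ (F x).re ∧ (F x).im = 0

theorem AENonneg.star_mul_self (F : X →ₘ[m] ℂ) : AENonneg (star F * F) := by
  filter_upwards [AEEqFun.coeFn_mul (star F) F, AEEqFun.coeFn_star F] with x h₁ h₂
  rw [h₁, Pi.mul_apply, h₂, Pi.star_apply, Complex.star_def, ← Complex.normSq_eq_conj_mul_self]
  exact ⟨Complex.normSq_nonneg _, Complex.ofReal_im _⟩

theorem eq_zero_of_aenonneg_neg {F : X →ₘ[m] ℂ} (h₁ : AENonneg F) (h₂ : AENonneg (-F)) :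
    F = 0 := by
  refine AEEqFun.ext ?_
  filter_upwards [h₁, h₂, AEEqFun.coeFn_neg F, AEEqFun.coeFn_zero (α := X) (μ := m) (β := ℂ)]
    with x h₁ h₂ h₃ h₄
  rw [h₃] at h₂
  rw [h₄]
  simp only [Pi.neg_apply, Complex.neg_re] at h₂
  refine Complex.ext (le_antisymm ?_ h₁.1) h₁.2
  rw [Pi.zero_apply, Complex.zero_re]
  linarith [h₂.1]

/-- The graph of a unital order isomorphism between two star subalgebras of `L^∞`. -/
structure PositiveCorrespondence (B : StarSubalgebra ℂ (X →ₘ[m] ℂ))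
    (B' : StarSubalgebra ℂ (Y →ₘ[m'] ℂ)) (Q : (X →ₘ[m] ℂ) → (Y →ₘ[m'] ℂ) → Prop) : Prop where
  mem_left : ∀ {F F'}, Q F F' → F ∈ B
  mem_right : ∀ {F F'}, Q F F' → F' ∈ B'
  bdd_left : B ≤ Linfty m
  bdd_right : B' ≤ Linfty m'
  add : ∀ {F G F' G'}, Q F F' → Q G G' → Q (F + G) (F' + G')
  smul : ∀ (c : ℂ) {F F'}, Q F F' → Q (c • F) (c • F')
  one : Q 1 1
  left_total : ∀ F ∈ B, ∃ F', Q F F'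
  right_total : ∀ F' ∈ B', ∃ F, Q F F'
  nonneg_iff : ∀ {F F'}, Q F F' → (AENonneg F ↔ AENonneg F')

namespace PositiveCorrespondence

variable {B : StarSubalgebra ℂ (X →ₘ[m] ℂ)} {B' : StarSubalgebra ℂ (Y →ₘ[m'] ℂ)}
  {Q : (X →ₘ[m] ℂ) → (Y →ₘ[m'] ℂ) → Prop}

theorem symm (h : PositiveCorrespondence B B' Q) :
    PositiveCorrespondence B' B (fun F F' => Q F' F) where
  mem_left := h.mem_right
  mem_right := h.mem_left
  bdd_left := h.bdd_right
  bdd_right := h.bdd_left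
  add := h.add
  smul c := fun hF => h.smul c hF
  one := h.one
  left_total := h.right_total
  right_total := h.left_total
  nonneg_iff hF := (h.nonneg_iff hF).symm

theorem neg (h : PositiveCorrespondence B B' Q) {F F'} (hF : Q F F') : Q (-F) (-F') := by
  have := h.smul (-1) hF
  rwa [neg_one_smul, neg_one_smul] at this

theorem sub (h : PositiveCorrespondence B B' Q) {F G F' G'} (hF : Q F F') (hG : Q G G') :
    Q (F - G) (F' - G') := by
  rw [sub_eq_add_neg, sub_eq_add_neg]
  exact h.add hF (h.neg hG)

theorem zero (h : PositiveCorrespondence B B' Q) : Q 0 0 := by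
  have := h.smul 0 h.one
  rwa [zero_smul, zero_smul] at this

/-- Both `F'` and `-F'` correspond to zero, so both are nonnegative. -/
theorem right_zero (h : PositiveCorrespondence B B' Q) {F'} (hF : Q 0 F') : F' = 0 := by
  have h0 : AENonneg (0 : X →ₘ[m] ℂ) := (h.nonneg_iff h.zero).2 <| by
    filter_upwards [AEEqFun.coeFn_zero (α := Y) (μ := m') (β := ℂ)] with x hx
    simp [hx]
  have h1 := h.neg hF
  rw [neg_zero] at h1
  exact eq_zero_of_aenonneg_neg ((h.nonneg_iff hF).1 h0) ((h.nonneg_iff h1).1 h0)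

/-- Reality can be read from the order: a bounded real function becomes nonnegative after a constant
is added, and constants correspond to themselves. -/
theorem im_eq_zero (h : PositiveCorrespondence B B' Q) {F F'} (hF : Q F F')
    (hr : ∀ᵐ x ∂m, (F x).im = 0) : ∀ᵐ y ∂m', (F' y).im = 0 := by
  obtain ⟨C, hC⟩ := h.bdd_left (h.mem_left hF)
  have h1 := h.add hF (h.smul (C : ℂ) h.one)
  have h2 : AENonneg (F + (C : ℂ) • 1) := by
    filter_upwards [hr, hC, AEEqFun.coeFn_add F ((C : ℂ) • 1),
      AEEqFun.coeFn_smul (C : ℂ) (1 : X →ₘ[m] ℂ), AEEqFun.coeFn_one (α := X) (μ := m) (β := ℂ)]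
      with x h1 h2 h3 h4 h5
    rw [h3, Pi.add_apply, h4, Pi.smul_apply, h5]
    have := (abs_le.1 ((Complex.abs_re_le_norm (F x)).trans h2)).1
    simp only [Pi.one_apply, smul_eq_mul, mul_one, Complex.add_re, Complex.add_im,
      Complex.ofReal_re, Complex.ofReal_im, h1, add_zero, and_true]
    linarith
  filter_upwards [(h.nonneg_iff h1).1 h2, AEEqFun.coeFn_add F' ((C : ℂ) • 1),
      AEEqFun.coeFn_smul (C : ℂ) (1 : Y →ₘ[m'] ℂ), AEEqFun.coeFn_one (α := Y) (μ := m') (β := ℂ)]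
      with x h2 h3 h4 h5
  rw [h3, Pi.add_apply, h4, Pi.smul_apply, h5] at h2
  simpa using h2.2

/-- If `G` corresponds to `F*`, then `F' + G` and `I • (F' - G)` are real because `F + F*` and `I •
(F - F*)` are. This forces `G` to be the conjugate of `F'`. -/
theorem star (h : PositiveCorrespondence B B' Q) {F F'} (hF : Q F F') :
    Q (star F) (star F') := by
  obtain ⟨G, hG⟩ := h.left_total _ (star_mem (h.mem_left hF))
  have e1 := h.im_eq_zero (h.add hF hG) <| by
    filter_upwards [AEEqFun.coeFn_add F (Star.star F), AEEqFun.coeFn_star F] with x h1 h2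
    rw [h1, Pi.add_apply, h2]
    simp
  have e2 := h.im_eq_zero (h.smul Complex.I (h.sub hF hG)) <| by
    filter_upwards [AEEqFun.coeFn_smul Complex.I (F - Star.star F),
      AEEqFun.coeFn_sub F (Star.star F), AEEqFun.coeFn_star F] with x h0 h1 h2
    rw [h0, Pi.smul_apply, h1, Pi.sub_apply, h2]
    simp
  have : G = Star.star F' := by
    refine AEEqFun.ext ?_
    filter_upwards [e1, e2, AEEqFun.coeFn_add F' G, AEEqFun.coeFn_smul Complex.I (F' - G),
      AEEqFun.coeFn_sub F' G, AEEqFun.coeFn_star F'] with x h1 h2 h3 h4 h5 h6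
    rw [h3] at h1
    rw [h4, Pi.smul_apply, h5] at h2
    rw [h6]
    simp only [Pi.add_apply, Complex.add_im, Pi.sub_apply, smul_eq_mul, Complex.mul_im,
      Complex.I_re, Complex.I_im, Complex.sub_re, Complex.sub_im, zero_mul, one_mul, zero_add]
      at h1 h2
    refine Complex.ext ?_ ?_ <;> simp <;> linarith
  rwa [← this]

/-- The Kadison-Schwarz inequality. -/
theorem sub_star_mul_self_nonneg (h : PositiveCorrespondence B B' Q) {F F' P}
    (hF : Q F F') (hP : Q (Star.star F * F) P) : AENonneg (P - Star.star F' * F') := by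
  -- This is the positivity of `|F - c|²` for a constant `c`, expanded and transferred to the other
  -- algebra.
  have key : ∀ c : ℂ, AENonneg (P - (Star.star c • F' + c • Star.star F') +
      (Star.star c * c) • (1 : Y →ₘ[m'] ℂ)) := fun c => by
    refine (h.nonneg_iff (h.add (h.sub hP (h.add (h.smul (Star.star c) hF)
      (h.smul c (h.star hF)))) (h.smul (Star.star c * c) h.one))).1 ?_
    have : Star.star F * F - (Star.star c • F + c • Star.star F) + (Star.star c * c) • 1 =
        Star.star (F - c • 1) * (F - c • 1) := by
      simp only [star_sub, star_smul, star_one, sub_mul, mul_sub, smul_mul_assoc, mul_smul_comm,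
        one_mul, mul_one]
      module
    rw [this]
    exact AENonneg.star_mul_self _
  -- Only countably many null sets may be discarded, so `c` runs over a dense sequence here;
  -- closedness of the inequality yields all `c` at once afterwards.
  have key2 : ∀ᵐ y ∂m', ∀ i : ℕ, 0 ≤ (P y - (Star.star (TopologicalSpace.denseSeq ℂ i) * F' y +
      TopologicalSpace.denseSeq ℂ i * Star.star (F' y)) + Star.star (TopologicalSpace.denseSeq ℂ i)
        * TopologicalSpace.denseSeq ℂ i).re := by
    refine ae_all_iff.2 fun i => ?_
    set c := TopologicalSpace.denseSeq ℂ i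
    filter_upwards [key c, AEEqFun.coeFn_add (P - (Star.star c • F' + c • Star.star F'))
      ((Star.star c * c) • (1 : Y →ₘ[m'] ℂ)), AEEqFun.coeFn_sub P
      (Star.star c • F' + c • Star.star F'), AEEqFun.coeFn_add (Star.star c • F')
      (c • Star.star F'), AEEqFun.coeFn_smul (Star.star c) F', AEEqFun.coeFn_smul c (Star.star F'),
      AEEqFun.coeFn_star F', AEEqFun.coeFn_smul (Star.star c * c) (1 : Y →ₘ[m'] ℂ),
      AEEqFun.coeFn_one (α := Y) (μ := m') (β := ℂ)] with y h0 h1 h2 h3 h4 h5 h6 h7 h8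
    rw [h1, Pi.add_apply, h2, Pi.sub_apply, h3, Pi.add_apply, h4, h5, h7, Pi.smul_apply,
      Pi.smul_apply, Pi.smul_apply, h6, h8] at h0
    simpa using h0.1
  filter_upwards [key2, (h.nonneg_iff hP).1 (AENonneg.star_mul_self F),
    AEEqFun.coeFn_sub P (Star.star F' * F'), AEEqFun.coeFn_mul (Star.star F') F',
    AEEqFun.coeFn_star F'] with y h1 h2 h3 h4 h5
  rw [h3, Pi.sub_apply, h4, Pi.mul_apply, h5, Pi.star_apply]
  have hall : ∀ c : ℂ, 0 ≤ (P y - (Star.star c * F' y + c * Star.star (F' y)) +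
      Star.star c * c).re := by
    intro c
    have hcl : IsClosed {c : ℂ | 0 ≤ (P y - (Star.star c * F' y + c * Star.star (F' y)) +
      Star.star c * c).re} := isClosed_le continuous_const (by fun_prop)
    have := (TopologicalSpace.denseRange_denseSeq ℂ).closure_range
    have hsub : closure (Set.range (TopologicalSpace.denseSeq ℂ)) ⊆ {c : ℂ |
      0 ≤ (P y - (Star.star c * F' y + c * Star.star (F' y)) + Star.star c * c).re} :=
      closure_minimal (by rintro _ ⟨i, rfl⟩; exact h1 i) hcl
    exact hsub (this ▸ Set.mem_univ c)
  -- The constant may now depend on the point: `c = F' y` minimizes the expression and leaves `P -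
  -- |F'|²`.
  have h6 := hall (F' y)
  have e : (P y - (Star.star (F' y) * F' y + F' y * Star.star (F' y)) +
      Star.star (F' y) * F' y) = P y - Star.star (F' y) * F' y := by ring
  rw [e] at h6
  refine ⟨h6, ?_⟩
  rw [Complex.sub_im, h2.2]
  simp [mul_comm]

/-- The Kadison-Schwarz inequality is used in both directions. It gives `P ≥ |F'|²`; for the element
`U` that corresponds to `|F'|²` it gives `U ≥ |F|²`, which transfers to `|F'|² ≥ P`. -/
theorem star_mul_self (h : PositiveCorrespondence B B' Q) {F F'} (hF : Q F F') :
    Q (Star.star F * F) (Star.star F' * F') := by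
  obtain ⟨P, hP⟩ := h.left_total _ (mul_mem (star_mem (h.mem_left hF)) (h.mem_left hF))
  obtain ⟨U, hU⟩ := h.right_total _ (mul_mem (star_mem (h.mem_right hF)) (h.mem_right hF))
  have h1 := h.sub_star_mul_self_nonneg hF hP
  have h2 := (h.nonneg_iff (h.sub hU hP)).1 (h.symm.sub_star_mul_self_nonneg hF hU)
  have h3 : P - Star.star F' * F' = 0 := eq_zero_of_aenonneg_neg h1 (by rwa [neg_sub])
  rwa [sub_eq_zero.1 h3] at hP

theorem star_mul (h : PositiveCorrespondence B B' Q) {F G F' G'} (hF : Q F F') (hG : Q G G') :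
    Q (Star.star F * G) (Star.star F' * G') := by
  have h1 := h.sub (h.sub (h.star_mul_self (h.add hF hG)) (h.star_mul_self hF))
    (h.star_mul_self hG)
  have h2 := h.smul (-Complex.I) (h.sub (h.sub
    (h.star_mul_self (h.add hF (h.smul Complex.I hG))) (h.star_mul_self hF)) (h.star_mul_self hG))
  have h3 := h.smul (1 / 2) (h.add h1 h2)
  rwa [polarization_identity, polarization_identity] at h3

theorem mul (h : PositiveCorrespondence B B' Q) {F G F' G'} (hF : Q F F') (hG : Q G G') :
    Q (F * G) (F' * G') := by
  have := h.star_mul (h.star hF) hG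
  rwa [star_star, star_star] at this

/-- A unital order isomorphism between star subalgebras of `L^∞` is a star isomorphism. -/
theorem actionsIsomorphic (h : PositiveCorrespondence B B' Q) {a : ℝ → B → B} {b : ℝ → B' → B'}
    (hab : ∀ s (F : B) (F' : B'), Q F F' → Q (a s F) (b s F')) : ActionsIsomorphic a b := by
  refine actionsIsomorphic_of_correspondence (fun (F : B) (F' : B') => Q F F') h.add
    (fun c => h.smul c) h.mul h.star (fun F => ?_) (fun F' => ?_)
    (fun hF => Subtype.ext (h.symm.right_zero hF)) (fun hF => Subtype.ext (h.right_zero hF))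
    (fun s {F F'} hF => hab s F F' hF)
  · obtain ⟨F', hF'⟩ := h.left_total F F.2
    exact ⟨⟨F', h.mem_right hF'⟩, hF'⟩
  · obtain ⟨F, hF⟩ := h.right_total F' F'.2
    exact ⟨⟨F, h.mem_left hF⟩, hF⟩

end PositiveCorrespondence

end Positive

/-! ### Characteristic functions of compound Poisson distributions -/

open scoped NNReal

instance isFiniteMeasure_convPow (ρ : Measure ℝ) [IsFiniteMeasure ρ] (k : ℕ) :
    IsFiniteMeasure (convPow ρ k) :=
  ⟨by rw [(convPow_univ ρ k).2]; exact ENNReal.pow_lt_top (measure_lt_top _ _)⟩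

theorem charFun_convPow (ρ : Measure ℝ) [IsFiniteMeasure ρ] (k : ℕ) (u : ℝ) :
    charFun (convPow ρ k) u = charFun ρ u ^ k := by
  induction k with
  | zero => simp [convPow]
  | succ k ih => rw [convPow, charFun_conv, ih, pow_succ]

theorem charFun_nnreal_smul (c : ℝ≥0) (ρ : Measure ℝ) (u : ℝ) :
    charFun (c • ρ) u = c * charFun ρ u := by
  simp [charFun_apply, integral_smul_nnreal_measure, NNReal.smul_def]

/-- Convolution powers become powers, so the defining series becomes the exponential series. -/
theorem charFun_compoundPoisson (ρ : Measure ℝ) [IsFiniteMeasure ρ] (u : ℝ) :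
    charFun (compoundPoisson ρ) u = Complex.exp (charFun ρ u - ρ.real Set.univ) := by
  have hprob : IsProbabilityMeasure (compoundPoisson ρ) := inferInstance
  set ν : ℕ → Measure ℝ := fun k => ENNReal.ofReal ((k.factorial : ℝ)⁻¹) • convPow ρ k with hν
  set c := ENNReal.ofReal (Real.exp (-ρ.real Set.univ)) with hc
  have hE : compoundPoisson ρ = c • Measure.sum ν := rfl
  have hc0 : c ≠ 0 := by simp [hc, Real.exp_pos]
  have hct : c ≠ ⊤ := ENNReal.ofReal_ne_top
  -- Finiteness of the unnormalized sum is read back from the total mass one of `compoundPoisson ρ`.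
  have hfin : IsFiniteMeasure (Measure.sum ν) := by
    refine ⟨lt_top_iff_ne_top.2 fun h => ?_⟩
    have h1 : (compoundPoisson ρ) Set.univ = 1 := measure_univ
    rw [hE, Measure.smul_apply, h, smul_eq_mul, ENNReal.mul_top hc0] at h1
    exact ENNReal.top_ne_one h1
  have hint : Integrable (fun x : ℝ => Complex.exp (inner ℝ x u * Complex.I)) (Measure.sum ν) := by
    refine (integrable_const (1 : ℝ)).mono' (by fun_prop) (ae_of_all _ fun x => ?_)
    rw [Complex.norm_exp_ofReal_mul_I]
  have hs := hasSum_integral_measure hint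
  have hterm : ∀ k, ∫ x : ℝ, Complex.exp (inner ℝ x u * Complex.I) ∂ν k =
      charFun ρ u ^ k / k.factorial := fun k => by
    rw [hν, integral_smul_measure, ENNReal.toReal_ofReal (by positivity), ← charFun_apply,
      charFun_convPow, Complex.real_smul, div_eq_inv_mul]
    push_cast
    rfl
  simp only [hterm] at hs
  have hexp := NormedSpace.expSeries_div_hasSum_exp (charFun ρ u)
  rw [← Complex.exp_eq_exp_ℂ] at hexp
  rw [charFun_apply, hE, integral_smul_measure, hs.unique hexp, hc,
    ENNReal.toReal_ofReal (Real.exp_pos _).le, Complex.real_smul, Complex.ofReal_exp,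
    ← Complex.exp_add]
  congr 1
  push_cast
  ring

/-- The exponent of the characteristic function is linear in `ρ`, so dividing `ρ` by `L` extracts an
`L`-th convolution root. -/
theorem convPow_compoundPoisson (ρ : Measure ℝ) [IsFiniteMeasure ρ] {L : ℕ} (hL : 1 ≤ L) :
    convPow (compoundPoisson ((L : ℝ≥0)⁻¹ • ρ)) L = compoundPoisson ρ := by
  refine Measure.ext_of_charFun (funext fun u => ?_)
  rw [charFun_convPow, charFun_compoundPoisson, charFun_compoundPoisson, ← Complex.exp_nat_mul,
    charFun_nnreal_smul]
  congr 1
  have : (L : ℂ) ≠ 0 := by exact_mod_cast (by omega : L ≠ 0)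
  have h2 : (((L : ℝ≥0)⁻¹ • ρ).real Set.univ : ℂ) = (L : ℂ)⁻¹ * ρ.real Set.univ := by
    simp [measureReal_nnreal_smul_apply]
  rw [h2]
  push_cast
  field_simp

/-! ### Approximation of infinitely divisible distributions -/

/-- For `z = exp (iux)` one has `1 - z² = 2(1 - z) - (1 - z)²` and `|1 - z|² = 2 Re (1 - z)`, so the
quadratic term integrates to at most `2 |1 - charFun ν u|`. Repeated doubling carries an estimate
near the origin to every `u`. -/
theorem norm_one_sub_charFun_two_mul_le (ν : Measure ℝ) [IsProbabilityMeasure ν] (u : ℝ) :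
    ‖1 - charFun ν (2 * u)‖ ≤ 4 * ‖1 - charFun ν u‖ := by
  have hi : ∀ v : ℝ, Integrable (fun x : ℝ => Complex.exp (v * x * Complex.I)) ν := fun v => by
    refine (integrable_const (1 : ℝ)).mono' (by fun_prop) (ae_of_all _ fun x => ?_)
    rw [← Complex.ofReal_mul, Complex.norm_exp_ofReal_mul_I]
  have h1 : ∀ v : ℝ, 1 - charFun ν v = ∫ x, (1 - Complex.exp (v * x * Complex.I)) ∂ν := fun v => by
    rw [integral_sub (integrable_const _) (hi v), charFun_apply_real]
    simp
  have hsq : ∀ x : ℝ, 1 - Complex.exp ((2 * u : ℝ) * x * Complex.I) =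
      2 * (1 - Complex.exp (u * x * Complex.I)) - (1 - Complex.exp (u * x * Complex.I)) ^ 2 := by
    intro x
    have : Complex.exp ((2 * u : ℝ) * x * Complex.I) = Complex.exp (u * x * Complex.I) ^ 2 := by
      rw [← Complex.exp_nat_mul]
      congr 1
      push_cast
      ring
    rw [this]
    ring
  have hi1 : Integrable (fun x : ℝ => 1 - Complex.exp (u * x * Complex.I)) ν :=
    (integrable_const _).sub (hi u)
  have hnorm : ∀ x : ℝ, ‖(1 - Complex.exp (u * x * Complex.I)) ^ 2‖ =
      2 * (1 - Complex.exp (u * x * Complex.I)).re := fun x => by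
    have : ‖Complex.exp (u * x * Complex.I)‖ = 1 := by
      rw [← Complex.ofReal_mul, Complex.norm_exp_ofReal_mul_I]
    rw [norm_pow, ← Complex.normSq_eq_norm_sq, Complex.normSq_sub,
      Complex.normSq_eq_norm_sq (Complex.exp _), this]
    simp
    ring
  have hi2 : Integrable (fun x : ℝ => (1 - Complex.exp (u * x * Complex.I)) ^ 2) ν := by
    refine Integrable.mono' (hi1.re.const_mul 2) (by fun_prop) (ae_of_all _ fun x => ?_)
    exact (hnorm x).le
  have h2 : ‖∫ x, (1 - Complex.exp (u * x * Complex.I)) ^ 2 ∂ν‖ ≤ 2 * ‖1 - charFun ν u‖ := by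
    refine (norm_integral_le_integral_norm _).trans ?_
    simp only [hnorm]
    rw [integral_const_mul]
    have : ∫ x, (1 - Complex.exp (u * x * Complex.I)).re ∂ν = (1 - charFun ν u).re := by
      rw [h1]
      exact integral_re hi1
    rw [this]
    gcongr
    exact Complex.re_le_norm _
  rw [h1]
  simp only [hsq]
  rw [integral_sub (hi1.const_mul 2) hi2, integral_const_mul, ← h1]
  refine (norm_sub_le _ _).trans ?_
  rw [norm_mul]
  norm_num
  linarith

theorem norm_one_sub_charFun_pow_two_mul_le (ν : Measure ℝ) [IsProbabilityMeasure ν] (u : ℝ)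
    (j : ℕ) : ‖1 - charFun ν (2 ^ j * u)‖ ≤ 4 ^ j * ‖1 - charFun ν u‖ := by
  induction j with
  | zero => simp
  | succ j ih =>
    rw [pow_succ', mul_assoc, pow_succ', mul_assoc]
    exact (norm_one_sub_charFun_two_mul_le ν _).trans (by gcongr)

/-- Near the origin the characteristic function of a convolution root is the principal root. -/
theorem exists_norm_one_sub_charFun_le_near_zero (μ : Measure ℝ) [IsProbabilityMeasure μ] :
    ∃ δ > 0, ∀ (ν : Measure ℝ) [IsProbabilityMeasure ν] (k : ℕ), 1 ≤ k → convPow ν k = μ →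
      ∀ u, |u| ≤ δ → ‖1 - charFun ν u‖ ≤ 2 / k := by
  have hcont : Continuous (charFun μ) := continuous_charFun
  have hev := hcont.tendsto 0
  rw [charFun_zero, probReal_univ, Complex.ofReal_one] at hev
  obtain ⟨δ, hδ, hδ2⟩ := Metric.eventually_nhds_iff.1
    (hev.eventually (Metric.closedBall_mem_nhds (1 : ℂ) (by norm_num : (0 : ℝ) < 1 / 2)))
  refine ⟨δ / 2, by positivity, fun ν _ k hk hν u hu => ?_⟩
  have hφ : ∀ v ∈ Set.Icc (-(δ / 2)) (δ / 2), ‖charFun μ v - 1‖ ≤ 1 / 2 := fun v hv => by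
    have := hδ2 (y := v) (by rw [Real.dist_eq, sub_zero]; exact (abs_le.2 hv).trans_lt (by linarith))
    rwa [dist_eq_norm] at this
  have hk0 : (k : ℂ) ≠ 0 := by exact_mod_cast (by omega : k ≠ 0)
  have hlog : ∀ v ∈ Set.Icc (-(δ / 2)) (δ / 2), ‖Complex.log (charFun μ v)‖ ≤ 3 / 4 := by
    intro v hv
    have := Complex.norm_log_one_add_half_le_self (hφ v hv)
    rw [add_sub_cancel] at this
    linarith [hφ v hv]
  have hslit : ∀ v ∈ Set.Icc (-(δ / 2)) (δ / 2), charFun μ v ∈ Complex.slitPlane := fun v hv => by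
    left
    have h1 := (Complex.abs_re_le_norm (charFun μ v - 1)).trans (hφ v hv)
    have := (abs_le.1 h1).1
    simp only [Complex.sub_re, Complex.one_re] at this
    linarith
  -- The quotient by the principal `k`-th root of `charFun μ` is continuous on an interval and takes
  -- values in the finite set of `k`-th roots of unity. It is therefore constant, equal to its value
  -- `1` at the origin.
  set r : ℝ → ℂ := fun v => charFun ν v * Complex.exp (-(Complex.log (charFun μ v) / k)) with hr
  have hrc : ContinuousOn r (Set.Icc (-(δ / 2)) (δ / 2)) := by
    refine (continuous_charFun (μ := ν)).continuousOn.mul ?_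
    refine Complex.continuous_exp.comp_continuousOn ?_
    exact ((hcont.continuousOn.clog hslit).div_const _).neg
  have hrk : Set.MapsTo r (Set.Icc (-(δ / 2)) (δ / 2)) {z : ℂ | z ^ k = 1} := fun v hv => by
    rw [Set.mem_ofPred_eq, hr, mul_pow, ← charFun_convPow, hν, ← Complex.exp_nat_mul]
    rw [show (k : ℂ) * -(Complex.log (charFun μ v) / k) = -Complex.log (charFun μ v) by
      field_simp, Complex.exp_neg, Complex.exp_log (Complex.slitPlane_ne_zero (hslit v hv)),
      mul_inv_cancel₀ (Complex.slitPlane_ne_zero (hslit v hv))]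
  have hfin : Set.Finite {z : ℂ | z ^ k = 1} := by
    refine (Polynomial.nthRootsFinset k (1 : ℂ)).finite_toSet.subset fun z hz => ?_
    rw [Finset.mem_coe, Polynomial.mem_nthRootsFinset (by omega)]
    exact hz
  have h0 : (0 : ℝ) ∈ Set.Icc (-(δ / 2)) (δ / 2) := ⟨by linarith, by linarith⟩
  have hum : u ∈ Set.Icc (-(δ / 2)) (δ / 2) := abs_le.1 hu
  have heq : r u = r 0 := isPreconnected_Icc.constant_of_mapsTo hfin.isDiscrete hrc hrk hum h0
  have hr0 : r 0 = 1 := by simp [hr]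
  rw [hr0] at heq
  have hval : charFun ν u = Complex.exp (Complex.log (charFun μ u) / k) := by
    rw [hr] at heq
    simp only [Complex.exp_neg] at heq
    exact eq_of_mul_inv_eq_one heq
  have hk1 : (1 : ℝ) ≤ k := by exact_mod_cast hk
  have hz : ‖Complex.log (charFun μ u) / k‖ ≤ 1 / k := by
    rw [norm_div, Complex.norm_natCast]
    gcongr
    exact (hlog u hum).trans (by norm_num)
  rw [hval, norm_sub_rev]
  refine (Complex.norm_exp_sub_one_le (hz.trans ?_)).trans ?_
  · rw [div_le_one (by positivity)]; exact hk1
  · calc 2 * ‖Complex.log (charFun μ u) / k‖ ≤ 2 * (1 / k) := by gcongr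
      _ = 2 / k := by ring

/-- The number `j` of doublings needed to reach `u` from the neighbourhood of the origin depends on
`μ` and `u` only, so the constant is uniform over all roots `ν` and all `k`. -/
theorem exists_norm_one_sub_charFun_le (μ : Measure ℝ) [IsProbabilityMeasure μ] (u : ℝ) :
    ∃ C, ∀ (ν : Measure ℝ) [IsProbabilityMeasure ν] (k : ℕ), 1 ≤ k → convPow ν k = μ →
      ‖1 - charFun ν u‖ ≤ C / k := by
  obtain ⟨δ, hδ, h⟩ := exists_norm_one_sub_charFun_le_near_zero μ
  obtain ⟨j, hj⟩ := pow_unbounded_of_one_lt (|u| / δ) (by norm_num : (1 : ℝ) < 2)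
  refine ⟨4 ^ j * 2, fun ν _ k hk hν => ?_⟩
  have h1 := norm_one_sub_charFun_pow_two_mul_le ν (u / 2 ^ j) j
  rw [mul_div_cancel₀ _ (by positivity)] at h1
  refine h1.trans ?_
  rw [mul_div_assoc]
  gcongr
  refine h ν k hk hν _ ?_
  rw [abs_div, abs_of_pos (by positivity : (0 : ℝ) < 2 ^ j), div_le_iff₀ (by positivity)]
  rw [div_lt_iff₀ hδ] at hj
  linarith

/-- Both `z` and `exp (z - 1)` lie in the closed unit disc, so telescoping bounds the difference of
their `k`-th powers by `k` times their distance, and that distance is of second order in `1 - z`. -/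
theorem norm_pow_sub_exp_le {z : ℂ} (hz : ‖z‖ ≤ 1) (hz1 : ‖1 - z‖ ≤ 1) (k : ℕ) :
    ‖z ^ k - Complex.exp (k * z - k)‖ ≤ k * ‖1 - z‖ ^ 2 := by
  have h1 : Complex.exp (k * z - k) = Complex.exp (z - 1) ^ k := by
    rw [← Complex.exp_nat_mul]; ring_nf
  have h2 : ‖Complex.exp (z - 1)‖ ≤ 1 := by
    rw [Complex.norm_exp, Real.exp_le_one_iff, Complex.sub_re, Complex.one_re]
    linarith [Complex.re_le_norm z]
  have h3 : ∀ k : ℕ, ‖z ^ k - Complex.exp (z - 1) ^ k‖ ≤ k * ‖z - Complex.exp (z - 1)‖ := by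
    intro k
    induction k with
    | zero => simp
    | succ k ih =>
      have : z ^ (k + 1) - Complex.exp (z - 1) ^ (k + 1) = z * (z ^ k - Complex.exp (z - 1) ^ k) +
        (z - Complex.exp (z - 1)) * Complex.exp (z - 1) ^ k := by ring
      rw [this]
      refine (norm_add_le _ _).trans ?_
      rw [norm_mul, norm_mul, norm_pow]
      have e1 : ‖z‖ * ‖z ^ k - Complex.exp (z - 1) ^ k‖ ≤ 1 * (k * ‖z - Complex.exp (z - 1)‖) := by
        gcongr
      have e2 : ‖z - Complex.exp (z - 1)‖ * ‖Complex.exp (z - 1)‖ ^ k ≤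
        ‖z - Complex.exp (z - 1)‖ * 1 := by
        gcongr
        exact pow_le_one₀ (norm_nonneg _) h2
      push_cast
      linarith
  rw [h1]
  refine (h3 k).trans ?_
  gcongr
  rw [norm_sub_rev] at hz1
  have := Complex.norm_exp_sub_one_sub_id_le hz1
  rw [norm_sub_rev, norm_sub_rev 1 z]
  rwa [sub_sub, add_sub_cancel] at this

/-- The bound `|1 - charFun (ν k) u| = O(1/k)` makes the error, `k + 1` times its square, tend to
zero. -/
theorem tendsto_charFun_compoundPoisson (μ : Measure ℝ) [IsProbabilityMeasure μ]
    (ν : ℕ → Measure ℝ) [∀ k, IsProbabilityMeasure (ν k)] (hν : ∀ k, convPow (ν k) (k + 1) = μ)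
    (u : ℝ) :
    Tendsto (fun k : ℕ => charFun (compoundPoisson (((k + 1 : ℕ) : ℝ≥0) • ν k)) u) atTop
      (𝓝 (charFun μ u)) := by
  obtain ⟨C, hC⟩ := exists_norm_one_sub_charFun_le μ u
  have hC' : ∀ k : ℕ, ‖1 - charFun (ν k) u‖ ≤ C / (k + 1 : ℕ) := fun k =>
    hC (ν k) (k + 1) (by omega) (hν k)
  have hlim : Tendsto (fun k : ℕ => C ^ 2 * (1 / ((k : ℝ) + 1))) atTop (𝓝 0) := by
    simpa using tendsto_one_div_add_atTop_nhds_zero_nat.const_mul (C ^ 2)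
  have hlim2 : Tendsto (fun k : ℕ => C * (1 / ((k : ℝ) + 1))) atTop (𝓝 0) := by
    simpa using tendsto_one_div_add_atTop_nhds_zero_nat.const_mul C
  refine tendsto_iff_norm_sub_tendsto_zero.2 (squeeze_zero' (.of_forall fun _ => norm_nonneg _)
    ?_ hlim)
  filter_upwards [hlim2.eventually (ge_mem_nhds zero_lt_one)] with k hk
  have hk0 : (0 : ℝ) < k + 1 := by positivity
  have hle : ‖1 - charFun (ν k) u‖ ≤ C * (1 / ((k : ℝ) + 1)) := by
    have := hC' k
    push_cast at this
    rwa [mul_one_div]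
  have h1 := norm_pow_sub_exp_le (norm_charFun_le_one (μ := ν k) (t := u)) (hle.trans hk) (k + 1)
  rw [charFun_compoundPoisson, charFun_nnreal_smul, ← hν k, charFun_convPow, norm_sub_rev]
  have h2 : ((((k + 1 : ℕ) : ℝ≥0) • ν k).real Set.univ : ℂ) = (k + 1 : ℕ) := by
    simp [measureReal_nnreal_smul_apply]
  rw [h2]
  refine h1.trans ?_
  have h0 := norm_nonneg (1 - charFun (ν k) u)
  calc ((k + 1 : ℕ) : ℝ) * ‖1 - charFun (ν k) u‖ ^ 2 ≤
      ((k + 1 : ℕ) : ℝ) * (C * (1 / ((k : ℝ) + 1))) ^ 2 := by gcongr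
    _ = C ^ 2 * (1 / ((k : ℝ) + 1)) := by
      push_cast
      field_simp

/-! ### Bounded Lipschitz closeness -/

/-- Layer cake: by the Lipschitz bound, the `ε`-thickening of a level set of `F = f + K` lies in the
level set of `G = F + K * ε` at the same height. The error consists of `K * ε` from this shift and
`ε * ‖F‖ ≤ 2 * K * ε` from the distance of the measures. -/
theorem integral_le_of_levyProkhorovEDist_lt_of_lipschitz (μ ν : Measure ℝ)
    [IsProbabilityMeasure μ] [IsProbabilityMeasure ν] {ε : ℝ} (hε : 0 < ε)
    (h : levyProkhorovEDist μ ν < ENNReal.ofReal ε) {f : ℝ → ℝ} {K : ℝ} (hK : 0 ≤ K)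
    (hb : ∀ x, |f x| ≤ K) (hl : ∀ x y, |f x - f y| ≤ K * |x - y|) :
    ∫ x, f x ∂μ ≤ ∫ x, f x ∂ν + 3 * K * ε := by
  have hcont : Continuous f := by
    have : LipschitzWith ⟨K, hK⟩ f := LipschitzWith.of_dist_le_mul fun x y => by
      rw [Real.dist_eq, Real.dist_eq]; exact hl x y
    exact this.continuous
  have hfi : ∀ ρ : Measure ℝ, IsProbabilityMeasure ρ → Integrable f ρ := fun ρ _ =>
    (integrable_const K).mono' hcont.aestronglyMeasurable (ae_of_all _ fun x => hb x)
  set F : BoundedContinuousFunction ℝ ℝ := BoundedContinuousFunction.ofNormedAddCommGroup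
    (fun x => f x + K) (by fun_prop) (2 * K) (fun x => by
      rw [Real.norm_eq_abs, abs_le]
      have := abs_le.1 (hb x)
      constructor <;> linarith) with hF
  set G : BoundedContinuousFunction ℝ ℝ := BoundedContinuousFunction.ofNormedAddCommGroup
    (fun x => f x + K + K * ε) (by fun_prop) (2 * K + K * ε) (fun x => by
      rw [Real.norm_eq_abs, abs_le]
      have := abs_le.1 (hb x)
      have h2 : 0 ≤ K * ε := by positivity
      constructor <;> linarith) with hG
  have hF0 : ∀ x, 0 ≤ F x := fun x => by
    have := abs_le.1 (hb x)
    change 0 ≤ f x + K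
    linarith
  have hGF : ∀ x, G x = F x + K * ε := fun x => rfl
  have hKε : 0 ≤ K * ε := by positivity
  have hG0 : ∀ x, 0 ≤ G x := fun x => by rw [hGF]; linarith [hF0 x]
  have hFn : ‖F‖ ≤ 2 * K := BoundedContinuousFunction.norm_ofNormedAddCommGroup_le _ (by positivity) _
  have hFG : ‖F‖ ≤ ‖G‖ := by
    refine (BoundedContinuousFunction.norm_le (norm_nonneg _)).2 fun x => ?_
    rw [Real.norm_eq_abs, abs_of_nonneg (hF0 x)]
    refine le_trans ?_ (BoundedContinuousFunction.apply_le_norm G x)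
    rw [hGF]
    linarith
  have h1 := BoundedContinuousFunction.integral_le_of_levyProkhorovEDist_lt μ ν hε h F
    (ae_of_all _ hF0)
  have h2 := BoundedContinuousFunction.integral_eq_integral_meas_le G ν (ae_of_all _ hG0)
  have hanti : Antitone fun t : ℝ => ν.real {a | t ≤ G a} := fun s t hst =>
    measureReal_mono fun a ha => hst.trans ha
  have hanti2 : Antitone fun t : ℝ => ν.real (Metric.thickening ε {a | t ≤ F a}) := fun s t hst =>
    measureReal_mono (Metric.thickening_subset_of_subset _ fun a ha => hst.trans ha)
  have h3 : ∫ t in Set.Ioc 0 ‖F‖, ν.real (Metric.thickening ε {a | t ≤ F a}) ≤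
      ∫ t in Set.Ioc 0 ‖F‖, ν.real {a | t ≤ G a} := by
    refine setIntegral_mono ?_ ?_ fun t => measureReal_mono fun x hx => ?_
    · exact ((hanti2.antitoneOn _).integrableOn_isCompact isCompact_Icc).mono_set Set.Ioc_subset_Icc_self
    · exact ((hanti.antitoneOn _).integrableOn_isCompact isCompact_Icc).mono_set Set.Ioc_subset_Icc_self
    · obtain ⟨z, hz, hxz⟩ := Metric.mem_thickening_iff.1 hx
      have hz' : t ≤ f z + K := hz
      have := (abs_le.1 (hl x z)).1
      rw [Real.dist_eq] at hxz
      have h4 : K * |x - z| ≤ K * ε := by gcongr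
      change t ≤ f x + K + K * ε
      linarith
  have h4 : ∫ t in Set.Ioc 0 ‖F‖, ν.real {a | t ≤ G a} ≤
      ∫ t in Set.Ioc 0 ‖G‖, ν.real {a | t ≤ G a} := by
    refine setIntegral_mono_set ?_ (ae_of_all _ fun t => measureReal_nonneg)
      (Set.Ioc_subset_Ioc_right hFG).eventuallyLE
    exact ((hanti.antitoneOn _).integrableOn_isCompact isCompact_Icc).mono_set Set.Ioc_subset_Icc_self
  have h5 : ∫ x, F x ∂μ = ∫ x, f x ∂μ + K := by
    change ∫ x, (f x + K) ∂μ = _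
    rw [integral_add (hfi μ inferInstance) (integrable_const _)]
    simp
  have h6 : ∫ x, G x ∂ν = ∫ x, f x ∂ν + K + K * ε := by
    change ∫ x, (f x + K + K * ε) ∂ν = _
    simp only [add_assoc]
    rw [integral_add (hfi ν inferInstance) (integrable_const _)]
    simp
  have h7 : ε * ‖F‖ ≤ ε * (2 * K) := by gcongr
  linarith

theorem norm_integral_sub_le_of_levyProkhorovEDist_lt (μ ν : Measure ℝ)
    [IsProbabilityMeasure μ] [IsProbabilityMeasure ν] {ε : ℝ} (hε : 0 < ε)
    (h : levyProkhorovEDist μ ν < ENNReal.ofReal ε) {f : ℝ → ℂ} {K : ℝ}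
    (hb : ∀ x, ‖f x‖ ≤ K) (hl : ∀ x y, ‖f x - f y‖ ≤ K * |x - y|) :
    ‖∫ x, f x ∂μ - ∫ x, f x ∂ν‖ ≤ 6 * K * ε := by
  have hK : 0 ≤ K := (norm_nonneg _).trans (hb 0)
  have hcont : Continuous f := by
    have : LipschitzWith ⟨K, hK⟩ f := LipschitzWith.of_dist_le_mul fun x y => by
      rw [dist_eq_norm, Real.dist_eq]; exact hl x y
    exact this.continuous
  have hfi : ∀ ρ : Measure ℝ, IsProbabilityMeasure ρ → Integrable f ρ := fun ρ _ =>
    (integrable_const K).mono' hcont.aestronglyMeasurable (ae_of_all _ fun x => hb x)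
  have key : ∀ g : ℝ → ℝ, (∀ x, |g x| ≤ K) → (∀ x y, |g x - g y| ≤ K * |x - y|) →
      |∫ x, g x ∂μ - ∫ x, g x ∂ν| ≤ 3 * K * ε := fun g hgb hgl => by
    have h1 := integral_le_of_levyProkhorovEDist_lt_of_lipschitz μ ν hε h hK hgb hgl
    have h2 := integral_le_of_levyProkhorovEDist_lt_of_lipschitz ν μ hε
      (by rwa [levyProkhorovEDist_comm]) hK hgb hgl
    rw [abs_le]
    constructor <;> linarith
  have hre := key (fun x => (f x).re) (fun x => (Complex.abs_re_le_norm _).trans (hb x))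
    fun x y => by
      rw [← Complex.sub_re]
      exact (Complex.abs_re_le_norm _).trans (hl x y)
  have him := key (fun x => (f x).im) (fun x => (Complex.abs_im_le_norm _).trans (hb x))
    fun x y => by
      rw [← Complex.sub_im]
      exact (Complex.abs_im_le_norm _).trans (hl x y)
  refine (Complex.norm_le_abs_re_add_abs_im _).trans ?_
  have e1 : ∀ ρ : Measure ℝ, IsProbabilityMeasure ρ → (∫ x, f x ∂ρ).re = ∫ x, (f x).re ∂ρ :=
    fun ρ hρ => (integral_re (hfi ρ hρ)).symm
  have e2 : ∀ ρ : Measure ℝ, IsProbabilityMeasure ρ → (∫ x, f x ∂ρ).im = ∫ x, (f x).im ∂ρ :=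
    fun ρ hρ => (integral_im (hfi ρ hρ)).symm
  rw [Complex.sub_re, Complex.sub_im, e1 μ inferInstance, e1 ν inferInstance, e2 μ inferInstance,
    e2 ν inferInstance]
  linarith

/-- The bounded Lipschitz distance of `μ` and `ν` is at most `ε`. -/
def BLClose (μ ν : Measure ℝ) (ε : ℝ) : Prop :=
  ∀ (f : ℝ → ℂ) (K : ℝ), (∀ x, ‖f x‖ ≤ K) → (∀ x y, ‖f x - f y‖ ≤ K * |x - y|) →
    ‖∫ x, f x ∂μ - ∫ x, f x ∂ν‖ ≤ K * ε

theorem BLClose.symm {μ ν : Measure ℝ} {ε : ℝ} (h : BLClose μ ν ε) : BLClose ν μ ε :=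
  fun f K hb hl => by rw [norm_sub_rev]; exact h f K hb hl

/-- An infinitely divisible distribution is a limit of compound Poisson distributions. -/
theorem IsInfinitelyDivisibleDistribution.exists_blClose {μ : Measure ℝ} [IsProbabilityMeasure μ]
    (h : IsInfinitelyDivisibleDistribution μ) {ε : ℝ} (hε : 0 < ε) :
    ∃ (ρ : Measure ℝ) (_ : IsFiniteMeasure ρ), BLClose μ (compoundPoisson ρ) ε := by
  choose ν hνp hν using fun k : ℕ => h (k + 1) (by omega)
  obtain ⟨P, hP⟩ : ∃ P : ℕ → ProbabilityMeasure ℝ,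
      ∀ k, (P k : Measure ℝ) = compoundPoisson (((k + 1 : ℕ) : NNReal) • ν k) :=
    ⟨fun k => ⟨_, isProbabilityMeasure_compoundPoisson (((k + 1 : ℕ) : NNReal) • ν k)⟩,
      fun k => rfl⟩
  obtain ⟨P₀, hP₀⟩ : ∃ P₀ : ProbabilityMeasure ℝ, (P₀ : Measure ℝ) = μ := ⟨⟨μ, inferInstance⟩, rfl⟩
  have hlim : Tendsto P atTop (𝓝 P₀) :=
    ProbabilityMeasure.tendsto_of_tendsto_charFun fun u => by
      simp only [hP, hP₀]
      exact tendsto_charFun_compoundPoisson μ ν hν u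
  -- Weak convergence, supplied by Lévy's continuity theorem, is convergence in the Lévy-Prokhorov
  -- metric; the radius `ε / 6` cancels the factor `6` of the integral estimate.
  have hlim2 := (LevyProkhorov.continuous_ofMeasure_probabilityMeasure.tendsto _).comp hlim
  have hε6 : 0 < ε / 6 := by positivity
  obtain ⟨k, hk⟩ := ((EMetric.tendsto_nhds.1 hlim2 _ (ENNReal.ofReal_pos.2 hε6))).exists
  refine ⟨((k + 1 : ℕ) : NNReal) • ν k, inferInstance, fun f K hb hl => ?_⟩
  have hk' : levyProkhorovEDist (compoundPoisson (((k + 1 : ℕ) : NNReal) • ν k)) μ <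
    ENNReal.ofReal (ε / 6) := by rw [← hP, ← hP₀]; exact hk
  rw [levyProkhorovEDist_comm] at hk'
  refine (norm_integral_sub_le_of_levyProkhorovEDist_lt μ _ hε6 hk' hb hl).trans (le_of_eq ?_)
  ring

/-! ### Conditional expectations given truncations -/

section Truncation

variable {Y D : Type*} [mY : MeasurableSpace Y] [MeasurableSpace D]

/-- Think of `φ` as a truncation and of `c` as resampling independently what `φ` forgets. Resampling
does not move the sets `φ ⁻¹' t`, and the average over `d` depends on `y` through `φ y` only; these
two facts characterize the conditional expectation. -/
theorem condExp_comap_ae_eq {P : Measure Y} [IsProbabilityMeasure P] {Q : Measure D}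
    [IsProbabilityMeasure Q] {c : Y × D → Y} (hc : MeasurePreserving c (P.prod Q) P)
    {φ : Y → Y} (hφ : Measurable φ) (hφc : ∀ y d, φ (c (y, d)) = φ y)
    (hcφ : ∀ y d, c (φ y, d) = c (y, d)) {F : Y → ℝ} (hF : Integrable F P)
    (hFm : StronglyMeasurable F) :
    P[F | mY.comap φ] =ᵐ[P] fun y => ∫ d, F (c (y, d)) ∂Q := by
  have hFc : Integrable (fun p => F (c p)) (P.prod Q) := hc.integrable_comp_of_integrable hF
  have hM : StronglyMeasurable fun y => ∫ d, F (c (y, d)) ∂Q :=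
    (hFm.comp_measurable hc.measurable).integral_prod_right'
  have hMφ : (fun y => ∫ d, F (c (y, d)) ∂Q) = (fun y => ∫ d, F (c (y, d)) ∂Q) ∘ φ := by
    funext y
    simp only [Function.comp_apply, hcφ]
  refine (ae_eq_condExp_of_forall_setIntegral_eq hφ.comap_le hF
    (fun s _ _ => (hFc.integral_prod_left).integrableOn) (fun s hs _ => ?_) ?_).symm
  · obtain ⟨t, ht, rfl⟩ := hs
    have h1 : c ⁻¹' (φ ⁻¹' t) = (φ ⁻¹' t) ×ˢ Set.univ := by
      ext ⟨y, d⟩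
      simp [hφc]
    have h2 : ∫ y in φ ⁻¹' t, F y ∂P = ∫ p in c ⁻¹' (φ ⁻¹' t), F (c p) ∂(P.prod Q) := by
      rw [← setIntegral_map (hφ ht) (by rw [hc.map_eq]; exact hFm.aestronglyMeasurable)
        hc.measurable.aemeasurable, hc.map_eq]
    rw [h2, h1, setIntegral_prod _ hFc.integrableOn]
    simp
  · rw [hMφ]
    exact (hM.comp_measurable (comap_measurable φ)).aestronglyMeasurable

variable {P : Measure Y} [IsProbabilityMeasure P] {Q : ℕ → Measure D}
  [∀ n, IsProbabilityMeasure (Q n)] {c : ℕ → Y × D → Y} {φ : ℕ → Y → Y}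

/-- The filtration generated by an increasing sequence of truncations. -/
def truncationFiltration (φ : ℕ → Y → Y) (hφ : ∀ n, Measurable (φ n))
    (hφφ : ∀ n m, n ≤ m → ∀ y, φ n (φ m y) = φ n y) : Filtration ℕ mY where
  seq n := mY.comap (φ n)
  mono' n m hnm := by
    have : φ n = φ n ∘ φ m := funext fun y => (hφφ n m hnm y).symm
    change mY.comap (φ n) ≤ mY.comap (φ m)
    rw [this, ← MeasurableSpace.comap_comp]
    exact MeasurableSpace.comap_mono (hφ n).comap_le
  le' n := (hφ n).comap_le

theorem ae_tendsto_of_re_im {ι : Type*} {l : Filter ι} {P : Measure Y} {M : ι → Y → ℂ} {F : Y → ℂ}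
    (hre : ∀ᵐ y ∂P, Tendsto (fun n => (M n y).re) l (𝓝 (F y).re))
    (him : ∀ᵐ y ∂P, Tendsto (fun n => (M n y).im) l (𝓝 (F y).im)) :
    ∀ᵐ y ∂P, Tendsto (fun n => M n y) l (𝓝 (F y)) := by
  filter_upwards [hre, him] with y h1 h2
  have := ((Complex.continuous_ofReal.tendsto _).comp h1).add
    (((Complex.continuous_ofReal.tendsto _).comp h2).mul_const Complex.I)
  simpa only [Function.comp_def, Complex.re_add_im] using this

/-- **Lévy's upward theorem** for truncations. -/
theorem ae_tendsto_integral_truncation [TopologicalSpace Y] [TopologicalSpace.PseudoMetrizableSpace Y]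
    [BorelSpace Y] (hc : ∀ n, MeasurePreserving (c n) (P.prod (Q n)) P)
    (hφ : ∀ n, Measurable (φ n)) (hφφ : ∀ n m, n ≤ m → ∀ y, φ n (φ m y) = φ n y)
    (hφc : ∀ n y d, φ n (c n (y, d)) = φ n y) (hcφ : ∀ n y d, c n (φ n y, d) = c n (y, d))
    (hlim : ∀ y, Tendsto (fun n => φ n y) atTop (𝓝 y)) {F : Y → ℂ} (hF : Measurable F) {C : ℝ}
    (hFC : ∀ y, ‖F y‖ ≤ C) :
    ∀ᵐ y ∂P, Tendsto (fun n => ∫ d, F (c n (y, d)) ∂Q n) atTop (𝓝 (F y)) := by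
  have hFi : Integrable F P :=
    (integrable_const C).mono' hF.aestronglyMeasurable (ae_of_all _ hFC)
  set 𝓕 := truncationFiltration φ hφ hφφ with h𝓕
  -- The truncations converge pointwise to the identity, which is therefore measurable for the
  -- σ-algebra that they generate.
  have hsup : ⨆ n, 𝓕 n = mY := by
    refine le_antisymm (iSup_le fun n => 𝓕.le n) ?_
    have h1 : ∀ n, Measurable[⨆ n, 𝓕 n] (φ n) := fun n =>
      (comap_measurable (φ n)).mono (le_iSup (fun n => (𝓕 n : MeasurableSpace Y)) n) le_rfl
    have h2 : Measurable[⨆ n, 𝓕 n] (id : Y → Y) :=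
      @measurable_of_tendsto_metrizable Y Y (⨆ n, 𝓕 n) _ _ _ _ _ _ h1
        (tendsto_pi_nhds.2 hlim)
    intro s hs
    exact h2 hs
  have key : ∀ G : Y → ℝ, Measurable G → Integrable G P →
      ∀ᵐ y ∂P, Tendsto (fun n => ∫ d, G (c n (y, d)) ∂Q n) atTop (𝓝 (G y)) := fun G hG hGi => by
    have h1 := hGi.tendsto_ae_condExp (ℱ := 𝓕) (by rw [hsup]; exact hG.stronglyMeasurable)
    have h2 : ∀ᵐ y ∂P, ∀ n, (P[G | 𝓕 n]) y = ∫ d, G (c n (y, d)) ∂Q n := ae_all_iff.2 fun n =>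
      condExp_comap_ae_eq (hc n) (hφ n) (hφc n) (hcφ n) hGi hG.stronglyMeasurable
    filter_upwards [h1, h2] with y h1 h2
    simpa only [h2] using h1
  have hint : ∀ᵐ y ∂P, ∀ n, Integrable (fun d => F (c n (y, d))) (Q n) := ae_of_all _ fun y n =>
    (integrable_const C).mono' ((hF.comp ((hc n).measurable.comp
      measurable_prodMk_left)).aestronglyMeasurable) (ae_of_all _ fun d => hFC _)
  refine ae_tendsto_of_re_im ?_ ?_
  · filter_upwards [key (fun y => (F y).re) (Complex.measurable_re.comp hF) hFi.re, hint]
      with y h1 h2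
    refine h1.congr fun n => ?_
    exact integral_re (h2 n)
  · filter_upwards [key (fun y => (F y).im) (Complex.measurable_im.comp hF) hFi.im, hint]
      with y h1 h2
    refine h1.congr fun n => ?_
    exact integral_im (h2 n)

/-- Almost everywhere convergence of bounded martingales with respect to truncations. -/
theorem exists_ae_tendsto_of_martingale (hc : ∀ n, MeasurePreserving (c n) (P.prod (Q n)) P)
    (hφ : ∀ n, Measurable (φ n)) (hφφ : ∀ n m, n ≤ m → ∀ y, φ n (φ m y) = φ n y)
    (hφc : ∀ n y d, φ n (c n (y, d)) = φ n y) (hcφ : ∀ n y d, c n (φ n y, d) = c n (y, d))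
    {M : ℕ → Y → ℂ} (hM : ∀ n, Measurable (M n)) (hMφ : ∀ n y, M n (φ n y) = M n y) {C : ℝ}
    (hMC : ∀ n y, ‖M n y‖ ≤ C)
    (hmart : ∀ n, M n =ᵐ[P] fun y => ∫ d, M (n + 1) (c n (y, d)) ∂Q n) :
    ∀ᵐ y ∂P, ∃ l, Tendsto (fun n => M n y) atTop (𝓝 l) := by
  set 𝓕 := truncationFiltration φ hφ hφφ with h𝓕
  have key : ∀ N : ℕ → Y → ℝ, (∀ n, Measurable (N n)) → (∀ n y, N n (φ n y) = N n y) →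
      (∀ n y, |N n y| ≤ C) → (∀ n, N n =ᵐ[P] fun y => ∫ d, N (n + 1) (c n (y, d)) ∂Q n) →
      ∀ᵐ y ∂P, ∃ l, Tendsto (fun n => N n y) atTop (𝓝 l) := by
    intro N hN hNφ hNC hNm
    have hNi : ∀ n, Integrable (N n) P := fun n =>
      (integrable_const C).mono' (hN n).aestronglyMeasurable (ae_of_all _ (hNC n))
    have hmar : Martingale N 𝓕 P := by
      refine martingale_nat (fun n => ?_) hNi fun n => (hNm n).trans
        (condExp_comap_ae_eq (hc n) (hφ n) (hφc n) (hcφ n) (hNi _) (hN _).stronglyMeasurable).symm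
      have : N n = N n ∘ φ n := funext fun y => (hNφ n y).symm
      rw [this]
      exact (hN n).stronglyMeasurable.comp_measurable (comap_measurable (φ n))
    refine hmar.submartingale.exists_ae_tendsto_of_bdd (R := C.toNNReal) fun n => ?_
    refine (eLpNorm_le_of_ae_bound (ae_of_all _ (hNC n))).trans ?_
    simp [ENNReal.ofReal]
  have hint : ∀ n y, Integrable (fun d => M (n + 1) (c n (y, d))) (Q n) := fun n y =>
    (integrable_const C).mono' (((hM _).comp ((hc n).measurable.comp
      measurable_prodMk_left)).aestronglyMeasurable) (ae_of_all _ fun d => hMC _ _)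
  have hre := key (fun n y => (M n y).re) (fun n => Complex.measurable_re.comp (hM n))
    (fun n y => by simp only [hMφ]) (fun n y => (Complex.abs_re_le_norm _).trans (hMC n y))
    fun n => by
      filter_upwards [hmart n] with y hy
      rw [hy]
      exact (integral_re (hint n y)).symm
  have him := key (fun n y => (M n y).im) (fun n => Complex.measurable_im.comp (hM n))
    (fun n y => by simp only [hMφ]) (fun n y => (Complex.abs_im_le_norm _).trans (hMC n y))
    fun n => by
      filter_upwards [hmart n] with y hy
      rw [hy]
      exact (integral_im (hint n y)).symm
  filter_upwards [hre, him] with y h1 h2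
  obtain ⟨a, ha⟩ := h1
  obtain ⟨b, hb⟩ := h2
  refine ⟨a + b * Complex.I, ?_⟩
  have := ((Complex.continuous_ofReal.tendsto _).comp ha).add
    (((Complex.continuous_ofReal.tendsto _).comp hb).mul_const Complex.I)
  simpa only [Function.comp_def, Complex.re_add_im] using this

end Truncation

/-! ### The path space -/

section PathSpace

variable (μ : ℕ → Measure ℝ)

/-- The probability measure on `Ωₙ = ∏_{k ≥ n} (ℝ, μ_k)`. -/
def tailProb (n : ℕ) : Measure (ℕ → ℝ) := infinitePi fun k => μ (n + k)

theorem pathMeasure_eq (n : ℕ) : pathMeasure μ n = (volume : Measure ℝ).prod (tailProb μ n) := rfl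

variable [∀ n, IsProbabilityMeasure (μ n)]

instance (n : ℕ) : IsProbabilityMeasure (tailProb μ n) := by
  unfold tailProb
  infer_instance

instance (n : ℕ) : SigmaFinite (pathMeasure μ n) := by
  rw [pathMeasure_eq]
  infer_instance

/-- A probability measure equivalent with `pathMeasure μ n`. -/
def pathProb (n : ℕ) : Measure (ℝ × (ℕ → ℝ)) :=
  (ProbabilityTheory.gaussianReal 0 1).prod (tailProb μ n)

instance (n : ℕ) : IsProbabilityMeasure (pathProb μ n) := by
  unfold pathProb
  infer_instance

theorem pathProb_absolutelyContinuous (n : ℕ) : pathProb μ n ≪ pathMeasure μ n :=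
  (ProbabilityTheory.gaussianReal_absolutelyContinuous 0 one_ne_zero).prod
    AbsolutelyContinuous.rfl

theorem pathMeasure_absolutelyContinuous (n : ℕ) : pathMeasure μ n ≪ pathProb μ n :=
  (ProbabilityTheory.gaussianReal_absolutelyContinuous' 0 one_ne_zero).prod
    AbsolutelyContinuous.rfl

/-- Martingale arguments need the Gaussian weight, translation invariance needs Lebesgue measure;
almost everywhere statements pass freely between them. -/
theorem ae_pathProb (n : ℕ) : ae (pathProb μ n) = ae (pathMeasure μ n) :=
  le_antisymm (pathProb_absolutelyContinuous μ n).ae_le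
    (pathMeasure_absolutelyContinuous μ n).ae_le

theorem measurable_pathMap (n : ℕ) : Measurable (pathMap n) := by
  unfold pathMap
  fun_prop

theorem pathMap_zero (p : ℝ × (ℕ → ℝ)) : pathMap 0 p = p := by
  simp [pathMap]

theorem pathMap_pathMap (n k : ℕ) (p : ℝ × (ℕ → ℝ)) :
    pathMap k (pathMap n p) = pathMap (n + k) p := by
  simp only [pathMap, Finset.sum_range_add, add_assoc]

theorem pathMap_succ_fst (n : ℕ) (p : ℝ × (ℕ → ℝ)) :
    (pathMap (n + 1) p).1 = (pathMap n p).1 + p.2 n := by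
  simp only [pathMap, Finset.sum_range_succ, add_assoc]

theorem measurePreserving_shift_tailProb (n k : ℕ) :
    MeasurePreserving (fun (ω : ℕ → ℝ) j => ω (k + j)) (tailProb μ n) (tailProb μ (n + k)) := by
  have := measurePreserving_shift (fun j => μ (n + j)) k
  simpa only [zero_add, tailProb, add_assoc] using this

theorem measurePreserving_pathMap (n k : ℕ) :
    MeasurePreserving (pathMap k) (pathMeasure μ n) (pathMeasure μ (n + k)) := by
  have hskew : MeasurePreserving
      (fun p : (ℕ → ℝ) × ℝ => ((fun j => p.1 (k + j)), p.2 + ∑ i ∈ Finset.range k, p.1 i))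
      ((tailProb μ n).prod volume) ((tailProb μ (n + k)).prod volume) :=
    (measurePreserving_shift_tailProb μ n k).skew_product
      (g := fun ω t => t + ∑ i ∈ Finset.range k, ω i) (by fun_prop)
      (ae_of_all _ fun ω => (measurePreserving_add_right volume _).map_eq)
  exact (Measure.measurePreserving_swap.comp hskew).comp
    (Measure.measurePreserving_swap (μ := (volume : Measure ℝ)) (ν := tailProb μ n))

theorem measurePreserving_pathMap_zero (k : ℕ) :
    MeasurePreserving (pathMap k) (pathMeasure μ 0) (pathMeasure μ k) := by
  have := measurePreserving_pathMap μ 0 k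
  rwa [zero_add] at this

theorem measurePreserving_pathMap_fst (n k : ℕ) :
    MeasurePreserving (fun x => (pathMap k x).1) (pathMeasure μ n) volume :=
  measurePreserving_fst.comp (measurePreserving_pathMap μ n k)

/-- The sequence that agrees with `a` before `k` and continues with `d` from `k` on. -/
def concat (k : ℕ) (a d : ℕ → ℝ) : ℕ → ℝ := fun j => if j < k then a j else d (j - k)

theorem measurable_concat (k : ℕ) :
    Measurable fun p : (ℕ → ℝ) × (ℕ → ℝ) => concat k p.1 p.2 := by
  refine measurable_pi_iff.2 fun j => ?_
  unfold concat
  by_cases h : j < k <;> simp only [h, if_true, if_false] <;> fun_prop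

/-- A box condition on the concatenation splits into a box for `a` below `k` and a shifted box for
`d`, and the product of their measures is the measure of the original box. -/
theorem measurePreserving_concat (n k : ℕ) :
    MeasurePreserving (fun p : (ℕ → ℝ) × (ℕ → ℝ) => concat k p.1 p.2)
      ((tailProb μ n).prod (tailProb μ (n + k))) (tailProb μ n) := by
  refine ⟨measurable_concat k, eq_infinitePi _ fun s t ht => ?_⟩
  rw [Measure.map_apply (measurable_concat k) (.pi s.countable_toSet fun _ _ => ht _)]
  have : (fun p : (ℕ → ℝ) × (ℕ → ℝ) => concat k p.1 p.2) ⁻¹' ((s : Set ℕ).pi t) =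
      (((s.filter (· < k) : Finset ℕ) : Set ℕ).pi t) ×ˢ
        ((((s.filter (¬ · < k)).image (· - k) : Finset ℕ) : Set ℕ).pi fun j => t (j + k)) := by
    ext ⟨a, d⟩
    simp only [Set.mem_preimage, Set.mem_pi, Set.mem_prod, Finset.coe_filter, Finset.coe_image,
      Set.mem_image, concat, Finset.mem_coe, Set.mem_ofPred_eq, not_lt]
    constructor
    · intro h
      refine ⟨fun j hj => ?_, ?_⟩
      · have := h j hj.1
        rwa [if_pos hj.2] at this
      · rintro _ ⟨j, ⟨hj, hjk⟩, rfl⟩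
        have := h j hj
        rwa [if_neg (by omega), ← Nat.sub_add_cancel hjk, Nat.add_sub_cancel] at this
    · rintro ⟨h1, h2⟩ j hj
      split_ifs with hjk
      · exact h1 j ⟨hj, hjk⟩
      · have := h2 (j - k) ⟨j, ⟨hj, by omega⟩, rfl⟩
        rwa [Nat.sub_add_cancel (by omega)] at this
  rw [this, Measure.prod_prod, tailProb, infinitePi_pi _ (fun i _ => ht _), tailProb,
    infinitePi_pi _ (fun i _ => ht _), Finset.prod_image, ← Finset.prod_filter_mul_prod_filter_not s
    (· < k)]
  · congr 1
    refine Finset.prod_congr rfl fun j hj => ?_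
    have : k ≤ j := not_lt.1 (Finset.mem_filter.1 hj).2
    rw [Nat.sub_add_cancel this, add_assoc, Nat.add_sub_cancel' this]
  · intro i hi j hj hij
    have h1 := (Finset.mem_filter.1 hi).2
    have h2 := (Finset.mem_filter.1 hj).2
    simp only at hij
    omega

theorem measurePreserving_eval_tailProb (n k : ℕ) :
    MeasurePreserving (fun ω : ℕ → ℝ => ω k) (tailProb μ n) (μ (n + k)) :=
  measurePreserving_eval_infinitePi (fun k => μ (n + k)) k

theorem measurePreserving_head_tail (n : ℕ) :
    MeasurePreserving (fun ω : ℕ → ℝ => (ω 0, fun k => ω (1 + k))) (tailProb μ n)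
      ((μ n).prod (tailProb μ (n + 1))) := by
  have hm : Measurable (fun ω : ℕ → ℝ => (ω 0, fun k => ω (1 + k))) := by fun_prop
  refine ⟨hm, ?_⟩
  have h1 := (measurePreserving_eval_tailProb μ n 0).prod
    (MeasurePreserving.id (tailProb μ (n + 1)))
  rw [← (measurePreserving_concat μ n 1).map_eq, Measure.map_map hm (measurable_concat 1)]
  refine Eq.trans ?_ h1.map_eq
  congr 1
  funext p
  simp [concat, Prod.map]

/-- Replacement of the steps from `k` on. -/
def pathConcat (k : ℕ) (p : (ℝ × (ℕ → ℝ)) × (ℕ → ℝ)) : ℝ × (ℕ → ℝ) :=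
  (p.1.1, concat k p.1.2 p.2)

/-- Replacement of the steps from `k` on by zero. -/
def pathTrunc (k : ℕ) (p : ℝ × (ℕ → ℝ)) : ℝ × (ℕ → ℝ) := (p.1, concat k p.2 0)

theorem measurePreserving_pathConcat (n k : ℕ) :
    MeasurePreserving (pathConcat k) ((pathProb μ n).prod (tailProb μ (n + k))) (pathProb μ n) := by
  have h := ((MeasurePreserving.id (ProbabilityTheory.gaussianReal 0 1)).prod
    (measurePreserving_concat μ n k)).comp (measurePreserving_prodAssoc
      (ProbabilityTheory.gaussianReal 0 1) (tailProb μ n) (tailProb μ (n + k)))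
  exact h

theorem measurable_pathTrunc (k : ℕ) : Measurable (pathTrunc k) :=
  measurable_fst.prodMk ((measurable_concat k).comp (measurable_snd.prodMk measurable_const))

theorem pathTrunc_pathTrunc (n m : ℕ) (h : n ≤ m) (y : ℝ × (ℕ → ℝ)) :
    pathTrunc n (pathTrunc m y) = pathTrunc n y := by
  refine Prod.ext rfl (funext fun j => ?_)
  simp only [pathTrunc, concat]
  split_ifs <;> first | rfl | omega

theorem pathTrunc_pathConcat (n : ℕ) (y : ℝ × (ℕ → ℝ)) (d : ℕ → ℝ) :
    pathTrunc n (pathConcat n (y, d)) = pathTrunc n y := by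
  refine Prod.ext rfl (funext fun j => ?_)
  simp only [pathTrunc, pathConcat, concat]
  split_ifs <;> rfl

theorem pathConcat_pathTrunc (n : ℕ) (y : ℝ × (ℕ → ℝ)) (d : ℕ → ℝ) :
    pathConcat n (pathTrunc n y, d) = pathConcat n (y, d) := by
  refine Prod.ext rfl (funext fun j => ?_)
  simp only [pathTrunc, pathConcat, concat]
  split_ifs <;> rfl

theorem tendsto_pathTrunc (y : ℝ × (ℕ → ℝ)) :
    Tendsto (fun n => pathTrunc n y) atTop (𝓝 y) := by
  refine Prod.tendsto_iff _ _ |>.2 ⟨tendsto_const_nhds, tendsto_pi_nhds.2 fun j => ?_⟩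
  refine tendsto_const_nhds.congr' ?_
  filter_upwards [eventually_gt_atTop j] with n hn
  simp [pathTrunc, concat, hn]

/-- Resampling after time `n` keeps the position at time `n` and makes `d` the sequence of later
steps. Hence the conditional expectation of a tail function given the first `n` steps depends on the
position at time `n` only. -/
theorem pathMap_pathConcat (n : ℕ) (y : ℝ × (ℕ → ℝ)) (d : ℕ → ℝ) :
    pathMap n (pathConcat n (y, d)) = ((pathMap n y).1, d) := by
  refine Prod.ext ?_ (funext fun j => ?_)
  · simp only [pathMap, pathConcat, concat]
    congr 1
    exact Finset.sum_congr rfl fun i hi => if_pos (Finset.mem_range.1 hi)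
  · simp [pathMap, pathConcat, concat]

theorem pathMap_pathTrunc_fst (n : ℕ) (y : ℝ × (ℕ → ℝ)) :
    (pathMap n (pathTrunc n y)).1 = (pathMap n y).1 := by
  have h : pathTrunc n y = pathConcat n (y, 0) := rfl
  rw [h, pathMap_pathConcat]

end PathSpace

/-! ### Pointwise limits -/

open Classical in
/-- The limit of a sequence, or `0` if there is none. -/
def limOrZero (s : ℕ → ℂ) : ℂ := if h : ∃ l, Tendsto s atTop (𝓝 l) then h.choose else 0

theorem limOrZero_eq {s : ℕ → ℂ} {l : ℂ} (h : Tendsto s atTop (𝓝 l)) : limOrZero s = l := by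
  have h' : ∃ l, Tendsto s atTop (𝓝 l) := ⟨l, h⟩
  rw [limOrZero, dif_pos h']
  exact tendsto_nhds_unique h'.choose_spec h

theorem limOrZero_of_not {s : ℕ → ℂ} (h : ¬ ∃ l, Tendsto s atTop (𝓝 l)) : limOrZero s = 0 := by
  rw [limOrZero, dif_neg h]

/-- Divergent sequences are included, since the default value is the same on both sides. Boundary
limits at different times are therefore related at every path, without exceptional null sets. -/
theorem limOrZero_add (s : ℕ → ℂ) (n : ℕ) : limOrZero (fun k => s (n + k)) = limOrZero s := by
  have hiff : ∀ l, Tendsto (fun k => s (n + k)) atTop (𝓝 l) ↔ Tendsto s atTop (𝓝 l) := fun l => by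
    simp only [add_comm n]
    exact tendsto_add_atTop_iff_nat n
  by_cases h : ∃ l, Tendsto s atTop (𝓝 l)
  · obtain ⟨l, hl⟩ := h
    rw [limOrZero_eq hl, limOrZero_eq ((hiff l).2 hl)]
  · rw [limOrZero_of_not h, limOrZero_of_not fun ⟨l, hl⟩ => h ⟨l, (hiff l).1 hl⟩]

theorem norm_limOrZero_le {s : ℕ → ℂ} {C : ℝ} (h : ∀ n, ‖s n‖ ≤ C) : ‖limOrZero s‖ ≤ C := by
  by_cases hs : ∃ l, Tendsto s atTop (𝓝 l)
  · obtain ⟨l, hl⟩ := hs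
    rw [limOrZero_eq hl]
    exact le_of_tendsto hl.norm (.of_forall h)
  · rw [limOrZero_of_not hs, norm_zero]
    exact (norm_nonneg _).trans (h 0)

theorem measurable_limOrZero {Y : Type*} [MeasurableSpace Y] {f : ℕ → Y → ℂ}
    (hf : ∀ n, Measurable (f n)) : Measurable fun y => limOrZero fun n => f n y := by
  set S : Set Y := {y | ∃ l, Tendsto (fun n => f n y) atTop (𝓝 l)} with hS
  have hSm : MeasurableSet S := measurableSet_exists_tendsto hf
  refine measurable_of_tendsto_metrizable (f := fun n => S.indicator (f n))
    (fun n => (hf n).indicator hSm) (tendsto_pi_nhds.2 fun y => ?_)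
  by_cases hy : y ∈ S
  · obtain ⟨l, hl⟩ := id hy
    simp only [Set.indicator_of_mem hy]
    rwa [limOrZero_eq hl]
  · simp only [Set.indicator_of_notMem hy]
    rw [limOrZero_of_not hy]
    exact tendsto_const_nhds

/-! ### Bounded representatives -/

section Representatives

variable {X : Type u} [MeasurableSpace X] {m : Measure X}

theorem exists_bounded_of_ae_le {f : X → ℂ} (hf : Measurable f) {C : ℝ} (hC0 : 0 ≤ C)
    (hC : ∀ᵐ x ∂m, ‖f x‖ ≤ C) :
    ∃ g : X → ℂ, Measurable g ∧ (∀ x, ‖g x‖ ≤ C) ∧ f =ᵐ[m] g := by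
  have hS : MeasurableSet {x | ‖f x‖ ≤ C} := measurableSet_le hf.norm measurable_const
  refine ⟨{x | ‖f x‖ ≤ C}.indicator f, hf.indicator hS, fun x => ?_, ?_⟩
  · by_cases hx : x ∈ {x | ‖f x‖ ≤ C}
    · rw [Set.indicator_of_mem hx]
      exact hx
    · rw [Set.indicator_of_notMem hx, norm_zero]
      exact hC0
  · filter_upwards [hC] with x hx
    exact (Set.indicator_of_mem (s := {x | ‖f x‖ ≤ C}) hx f).symm

theorem exists_nonneg_bound {F : X →ₘ[m] ℂ} (hF : F ∈ Linfty m) :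
    ∃ C : ℝ, 0 ≤ C ∧ ∀ᵐ x ∂m, ‖F x‖ ≤ C := by
  obtain ⟨C, hC⟩ := hF
  exact ⟨|C|, abs_nonneg C, hC.mono fun x hx => hx.trans (le_abs_self C)⟩

theorem mk_mem_Linfty {f : X → ℂ} (hf : Measurable f) {C : ℝ} (hC : ∀ᵐ x ∂m, ‖f x‖ ≤ C) :
    AEEqFun.mk f hf.aestronglyMeasurable ∈ Linfty m := by
  refine ⟨C, ?_⟩
  filter_upwards [AEEqFun.coeFn_mk f hf.aestronglyMeasurable, hC] with x h1 h2
  rwa [h1]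

end Representatives

/-! ### The tail boundary through representatives and harmonic sequences. -/

section Transform

variable (μ : ℕ → Measure ℝ) [∀ n, IsProbabilityMeasure (μ n)]

theorem mem_tailBoundary {F : (ℝ × (ℕ → ℝ)) →ₘ[pathMeasure μ 0] ℂ} :
    F ∈ tailBoundary μ ↔ ∀ n, ∃ G ∈ Linfty (pathMeasure μ n),
      pullback (pathMap n) (quasiMeasurePreserving_pathMap μ n) G = F := by
  simp only [tailBoundary, StarSubalgebra.mem_iInf, StarSubalgebra.mem_map]

theorem tailBoundary_le_Linfty : tailBoundary μ ≤ Linfty (pathMeasure μ 0) := fun F hF => by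
  obtain ⟨G, hG, rfl⟩ := (mem_tailBoundary μ).1 hF 0
  exact pullback_mem_Linfty _ _ hG

theorem ae_pathMap_iff (n k : ℕ) {p : ℝ × (ℕ → ℝ) → Prop} (hp : MeasurableSet {x | p x}) :
    (∀ᵐ x ∂pathMeasure μ n, p (pathMap k x)) ↔ ∀ᵐ y ∂pathMeasure μ (n + k), p y := by
  rw [← (measurePreserving_pathMap μ n k).map_eq]
  exact (ae_map_iff (measurable_pathMap k).aemeasurable hp).symm

theorem ae_pathMap_zero_iff (k : ℕ) {p : ℝ × (ℕ → ℝ) → Prop} (hp : MeasurableSet {x | p x}) :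
    (∀ᵐ x ∂pathMeasure μ 0, p (pathMap k x)) ↔ ∀ᵐ y ∂pathMeasure μ k, p y := by
  have := ae_pathMap_iff μ 0 k hp
  rwa [zero_add] at this

theorem integral_eq_integral_head (n : ℕ) {f : ℝ → ℂ} (hf : Measurable f) :
    ∫ y, f y ∂μ n = ∫ ω, f (ω 0) ∂tailProb μ n := by
  have h : MeasurePreserving (fun ω : ℕ → ℝ => ω 0) (tailProb μ n) (μ n) :=
    measurePreserving_eval_tailProb μ n 0
  rw [← h.map_eq, integral_map h.measurable.aemeasurable hf.aestronglyMeasurable]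

theorem integral_eq_integral_head_tail (n : ℕ) {f : ℝ × (ℕ → ℝ) → ℂ} (hf : Measurable f) :
    ∫ p, f p ∂(μ n).prod (tailProb μ (n + 1)) =
      ∫ ω, f (ω 0, fun k => ω (1 + k)) ∂tailProb μ n := by
  have h := measurePreserving_head_tail μ n
  rw [← h.map_eq, integral_map h.measurable.aemeasurable hf.aestronglyMeasurable]

theorem ae_ae_of_ae_pathMeasure {n : ℕ} {p : ℝ × (ℕ → ℝ) → Prop}
    (h : ∀ᵐ x ∂pathMeasure μ n, p x) : ∀ᵐ t, ∀ᵐ d ∂tailProb μ n, p (t, d) :=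
  ae_ae_of_ae_prod h

/-- A single bound serves all times: the bound of `F` descends along the measure preserving `pathMap
n`, and each representative is cut off where it fails. -/
theorem exists_of_mem_tailBoundary {F : (ℝ × (ℕ → ℝ)) →ₘ[pathMeasure μ 0] ℂ}
    (hF : F ∈ tailBoundary μ) : ∃ (C : ℝ) (g : ℕ → ℝ × (ℕ → ℝ) → ℂ), 0 ≤ C ∧
      (∀ n, Measurable (g n)) ∧ (∀ n x, ‖g n x‖ ≤ C) ∧
      ∀ n, F =ᵐ[pathMeasure μ 0] g n ∘ pathMap n := by
  obtain ⟨C, hC0, hC⟩ := exists_nonneg_bound (tailBoundary_le_Linfty μ hF)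
  have : ∀ n, ∃ g : ℝ × (ℕ → ℝ) → ℂ, Measurable g ∧ (∀ x, ‖g x‖ ≤ C) ∧
      F =ᵐ[pathMeasure μ 0] g ∘ pathMap n := fun n => by
    obtain ⟨G, hG, rfl⟩ := (mem_tailBoundary μ).1 hF n
    have hGm : Measurable G := G.stronglyMeasurable.measurable
    have h1 := coeFn_pullback (pathMap n) (quasiMeasurePreserving_pathMap μ n) G
    have h2 : ∀ᵐ x ∂pathMeasure μ n, ‖G x‖ ≤ C := by
      refine (ae_pathMap_zero_iff μ n (measurableSet_le hGm.norm measurable_const)).1 ?_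
      filter_upwards [hC, h1] with x h2 h3
      rwa [h3] at h2
    obtain ⟨g, hg, hgC, hGg⟩ := exists_bounded_of_ae_le hGm hC0 h2
    refine ⟨g, hg, hgC, ?_⟩
    filter_upwards [h1, (quasiMeasurePreserving_pathMap μ n).ae hGg] with x h3 h4
    rw [h3]
    exact h4
  choose g hg hgC hFg using this
  exact ⟨C, g, hC0, hg, hgC, hFg⟩

theorem mem_tailBoundary_of_ae_eq {F : (ℝ × (ℕ → ℝ)) →ₘ[pathMeasure μ 0] ℂ}
    (hF : F ∈ Linfty (pathMeasure μ 0)) (h : ∀ n, ∃ g : ℝ × (ℕ → ℝ) → ℂ, Measurable g ∧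
      F =ᵐ[pathMeasure μ 0] g ∘ pathMap n) : F ∈ tailBoundary μ := by
  refine (mem_tailBoundary μ).2 fun n => ?_
  obtain ⟨C, hC⟩ := hF
  obtain ⟨g, hg, hFg⟩ := h n
  have h2 : ∀ᵐ x ∂pathMeasure μ n, ‖g x‖ ≤ C := by
    refine (ae_pathMap_zero_iff μ n (measurableSet_le hg.norm measurable_const)).1 ?_
    filter_upwards [hC, hFg] with x h2 h3
    rwa [h3] at h2
  refine ⟨AEEqFun.mk g hg.aestronglyMeasurable, mk_mem_Linfty hg h2, ?_⟩
  refine AEEqFun.ext ?_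
  filter_upwards [hFg, coeFn_pullback (pathMap n) (quasiMeasurePreserving_pathMap μ n)
    (AEEqFun.mk g hg.aestronglyMeasurable), (quasiMeasurePreserving_pathMap μ n).ae
    (AEEqFun.coeFn_mk g hg.aestronglyMeasurable)] with x h3 h4 h5
  rw [h3, h4]
  exact h5

/-! ### Harmonic sequences -/

/-- Uniformly bounded sequences of measurable functions with `H n = μ n * H (n + 1)`. -/
structure IsHarmonic (H : ℕ → ℝ → ℂ) : Prop where
  measurable : ∀ n, Measurable (H n)
  bounded : ∃ C : ℝ, ∀ n t, ‖H n t‖ ≤ C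
  ae_eq : ∀ n, H n =ᵐ[volume] fun t => ∫ y, H (n + 1) (t + y) ∂μ n

/-- The almost everywhere limit of `H n` along the paths is `F`. -/
def HasBoundaryLimit (H : ℕ → ℝ → ℂ) (F : ℝ × (ℕ → ℝ) → ℂ) : Prop :=
  ∀ᵐ x ∂pathMeasure μ 0, Tendsto (fun n => H n (pathMap n x).1) atTop (𝓝 (F x))

/-- The pointwise limit of `H` along the paths that start at time `n`. -/
def boundaryLimit (H : ℕ → ℝ → ℂ) (n : ℕ) (x : ℝ × (ℕ → ℝ)) : ℂ :=
  limOrZero fun k => H (n + k) (pathMap k x).1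

theorem measurable_boundaryLimit {H : ℕ → ℝ → ℂ} (hH : ∀ n, Measurable (H n)) (n : ℕ) :
    Measurable (boundaryLimit H n) :=
  measurable_limOrZero fun k => (hH _).comp (measurable_pathMap k).fst

theorem norm_boundaryLimit_le {H : ℕ → ℝ → ℂ} {C : ℝ} (hC : ∀ n t, ‖H n t‖ ≤ C) (n : ℕ)
    (x : ℝ × (ℕ → ℝ)) : ‖boundaryLimit H n x‖ ≤ C :=
  norm_limOrZero_le fun _ => hC _ _

theorem boundaryLimit_zero (H : ℕ → ℝ → ℂ) (n : ℕ) (x : ℝ × (ℕ → ℝ)) :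
    boundaryLimit H 0 x = boundaryLimit H n (pathMap n x) := by
  simp only [boundaryLimit, pathMap_pathMap, zero_add]
  exact (limOrZero_add (fun k => H k (pathMap k x).1) n).symm

theorem HasBoundaryLimit.ae_eq {μ : ℕ → Measure ℝ} {H : ℕ → ℝ → ℂ} {F : ℝ × (ℕ → ℝ) → ℂ}
    (h : HasBoundaryLimit μ H F) : F =ᵐ[pathMeasure μ 0] boundaryLimit H 0 := by
  filter_upwards [h] with x hx
  simp only [boundaryLimit, zero_add]
  exact (limOrZero_eq hx).symm

/-- Every pointwise limit along the paths belongs to the tail boundary. -/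
theorem mk_boundaryLimit_mem {H : ℕ → ℝ → ℂ} (hH : ∀ n, Measurable (H n)) {C : ℝ}
    (hC : ∀ n t, ‖H n t‖ ≤ C) : AEEqFun.mk (boundaryLimit H 0)
      (measurable_boundaryLimit hH 0).aestronglyMeasurable ∈ tailBoundary μ := by
  refine mem_tailBoundary_of_ae_eq μ
    (mk_mem_Linfty (measurable_boundaryLimit hH 0) (ae_of_all _ (norm_boundaryLimit_le hC 0)))
    fun n => ⟨boundaryLimit H n, measurable_boundaryLimit hH n, ?_⟩
  filter_upwards [AEEqFun.coeFn_mk (μ := pathMeasure μ 0) (boundaryLimit H 0)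
    (measurable_boundaryLimit hH 0).aestronglyMeasurable] with x hx
  rw [hx, boundaryLimit_zero H n]
  rfl

theorem measurePreserving_pathConcat_zero (n : ℕ) :
    MeasurePreserving (pathConcat n) ((pathProb μ 0).prod (tailProb μ n)) (pathProb μ 0) := by
  have := measurePreserving_pathConcat μ 0 n
  rwa [zero_add] at this

variable {μ}

/-- Harmonicity says precisely that `H n`, evaluated at the position at time `n`, is a bounded
martingale for the filtration of the starting point and the first `n` steps. -/
theorem IsHarmonic.ae_exists_tendsto {H : ℕ → ℝ → ℂ} (hH : IsHarmonic μ H) :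
    ∀ᵐ x ∂pathMeasure μ 0, ∃ l, Tendsto (fun n => H n (pathMap n x).1) atTop (𝓝 l) := by
  obtain ⟨C, hC⟩ := hH.bounded
  rw [← ae_pathProb]
  refine exists_ae_tendsto_of_martingale (measurePreserving_pathConcat_zero μ)
    measurable_pathTrunc pathTrunc_pathTrunc pathTrunc_pathConcat pathConcat_pathTrunc
    (fun n => (hH.measurable n).comp (measurable_pathMap n).fst) (fun n y => ?_)
    (fun n y => hC n _) fun n => ?_
  · rw [pathMap_pathTrunc_fst]
  · rw [EventuallyEq, ae_pathProb]
    filter_upwards [(measurePreserving_pathMap_fst μ 0 n).quasiMeasurePreserving.ae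
      (hH.ae_eq n)] with x hx
    rw [hx, integral_eq_integral_head μ n (f := fun y => H (n + 1) ((pathMap n x).1 + y))
      ((hH.measurable _).comp (measurable_const_add _))]
    refine integral_congr_ae (ae_of_all _ fun d => ?_)
    simp only [pathMap_succ_fst, pathMap_pathConcat]
    simp [pathConcat, concat]

theorem IsHarmonic.hasBoundaryLimit {H : ℕ → ℝ → ℂ} (hH : IsHarmonic μ H) :
    HasBoundaryLimit μ H (boundaryLimit H 0) := by
  filter_upwards [hH.ae_exists_tendsto] with x hx
  obtain ⟨l, hl⟩ := hx
  have : boundaryLimit H 0 x = l := by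
    simp only [boundaryLimit, zero_add]
    exact limOrZero_eq hl
  rwa [this]

/-- The existence of a boundary value. -/
theorem IsHarmonic.exists_boundary {H : ℕ → ℝ → ℂ} (hH : IsHarmonic μ H) :
    ∃ F ∈ tailBoundary μ, HasBoundaryLimit μ H F := by
  obtain ⟨C, hC⟩ := hH.bounded
  refine ⟨_, mk_boundaryLimit_mem μ hH.measurable hC, ?_⟩
  filter_upwards [hH.hasBoundaryLimit, AEEqFun.coeFn_mk (μ := pathMeasure μ 0) (boundaryLimit H 0)
    (measurable_boundaryLimit hH.measurable 0).aestronglyMeasurable] with x h1 h2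
  rwa [h2]

/-- The existence of a harmonic extension. -/
theorem exists_isHarmonic {F : (ℝ × (ℕ → ℝ)) →ₘ[pathMeasure μ 0] ℂ} (hF : F ∈ tailBoundary μ) :
    ∃ H, IsHarmonic μ H ∧ HasBoundaryLimit μ H F := by
  obtain ⟨C, g, hC0, hg, hgC, hFg⟩ := exists_of_mem_tailBoundary μ hF
  -- Averaging the time-`n` representative over all later steps gives the conditional expectation of
  -- `F` as a function of the position at time `n`.
  refine ⟨fun n t => ∫ d, g n (t, d) ∂tailProb μ n, ⟨fun n => ?_, ⟨C, fun n t => ?_⟩,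
    fun n => ?_⟩, ?_⟩
  · exact (hg n).stronglyMeasurable.integral_prod_right'.measurable
  · refine (norm_integral_le_of_norm_le_const (ae_of_all _ fun d => hgC n _)).trans ?_
    simp
  · have h1 : ∀ᵐ x ∂pathMeasure μ n, g n x = g (n + 1) (pathMap 1 x) := by
      refine (ae_pathMap_zero_iff μ n (measurableSet_eq_fun (hg n)
        ((hg (n + 1)).comp (measurable_pathMap 1)))).1 ?_
      filter_upwards [hFg n, hFg (n + 1)] with x h1 h2
      rw [Function.comp_apply] at h1 h2
      rw [← h1, h2, Function.comp_apply, pathMap_pathMap]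
    filter_upwards [ae_ae_of_ae_pathMeasure μ h1] with t ht
    rw [integral_congr_ae ht]
    have hint : Integrable (fun p : ℝ × (ℕ → ℝ) => g (n + 1) (t + p.1, p.2))
        ((μ n).prod (tailProb μ (n + 1))) :=
      (integrable_const C).mono' ((hg _).comp (by fun_prop)).aestronglyMeasurable
        (ae_of_all _ fun p => hgC _ _)
    rw [← integral_prod _ hint, integral_eq_integral_head_tail μ n
      (f := fun p : ℝ × (ℕ → ℝ) => g (n + 1) (t + p.1, p.2)) ((hg _).comp (by fun_prop))]
    simp [pathMap]
  -- Lévy's theorem is applied to `g 0`; the almost everywhere identity of `g 0` with `g n ∘ pathMap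
  -- n` identifies its conditional expectations with the harmonic sequence.
  · have h1 := ae_tendsto_integral_truncation (P := pathProb μ 0)
      (measurePreserving_pathConcat_zero μ) measurable_pathTrunc
      pathTrunc_pathTrunc pathTrunc_pathConcat pathConcat_pathTrunc tendsto_pathTrunc (hg 0) (hgC 0)
    have h2 : ∀ n, ∀ᵐ x ∂pathProb μ 0, ∫ d, g 0 (pathConcat n (x, d)) ∂tailProb μ n =
        ∫ d, g n ((pathMap n x).1, d) ∂tailProb μ n := fun n => by
      have e : ∀ᵐ x ∂pathProb μ 0, g 0 x = g n (pathMap n x) := by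
        rw [ae_pathProb]
        filter_upwards [hFg 0, hFg n] with x h1 h2
        rw [← Function.comp_apply (f := g n), ← h2, h1, Function.comp_apply, pathMap_zero]
      have e2 := (measurePreserving_pathConcat_zero μ n).quasiMeasurePreserving.ae e
      filter_upwards [ae_ae_of_ae_prod e2] with x hx
      refine integral_congr_ae ?_
      filter_upwards [hx] with d hd
      rw [hd, pathMap_pathConcat]
    unfold HasBoundaryLimit
    rw [ae_pathProb] at h1
    simp only [ae_pathProb] at h2
    filter_upwards [h1, ae_all_iff.2 h2, hFg 0] with x h1 h2 h3
    rw [h3, Function.comp_apply, pathMap_zero]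
    exact h1.congr h2

variable (μ) in
-- The last of the `k + 1` steps is split off, by resampling the path from time `k` on.
theorem integral_pathMap_succ (n k : ℕ) {f : ℝ → ℂ} (hf : Measurable f) {C : ℝ}
    (hC : ∀ t, ‖f t‖ ≤ C) (t : ℝ) :
    ∫ d, f (pathMap (k + 1) (t, d)).1 ∂tailProb μ n =
      ∫ d, ∫ y, f ((pathMap k (t, d)).1 + y) ∂μ (n + k) ∂tailProb μ n := by
  have hm : Measurable fun d => f (pathMap (k + 1) (t, d)).1 :=
    hf.comp ((measurable_pathMap _).fst.comp measurable_prodMk_left)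
  have hi : Integrable (fun p : (ℕ → ℝ) × (ℕ → ℝ) => f (pathMap (k + 1) (t, concat k p.1 p.2)).1)
      ((tailProb μ n).prod (tailProb μ (n + k))) :=
    (integrable_const C).mono' (hm.comp (measurable_concat k)).aestronglyMeasurable
      (ae_of_all _ fun p => hC _)
  conv_lhs => rw [← (measurePreserving_concat μ n k).map_eq]
  rw [integral_map (measurable_concat k).aemeasurable hm.aestronglyMeasurable, integral_prod _ hi]
  refine integral_congr_ae (ae_of_all _ fun d => ?_)
  dsimp only
  rw [integral_eq_integral_head μ (n + k) (f := fun y => f ((pathMap k (t, d)).1 + y))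
    (hf.comp (measurable_const_add _))]
  refine integral_congr_ae (ae_of_all _ fun d' => ?_)
  have := pathMap_pathConcat k (t, d) d'
  simp only [pathConcat] at this
  simp only [pathMap_succ_fst, this]
  simp [concat]

variable (μ) in
-- The first step is split off instead; in the perturbation argument this is the form that survives
-- the limit and yields harmonicity.
theorem integral_pathMap_succ' (n k : ℕ) {f : ℝ → ℂ} (hf : Measurable f) {C : ℝ}
    (hC : ∀ t, ‖f t‖ ≤ C) (t : ℝ) :
    ∫ d, f (pathMap (k + 1) (t, d)).1 ∂tailProb μ n =
      ∫ y, ∫ d, f (pathMap k (t + y, d)).1 ∂tailProb μ (n + 1) ∂μ n := by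
  have hm : Measurable fun p : ℝ × (ℕ → ℝ) => f (pathMap k (t + p.1, p.2)).1 :=
    hf.comp ((measurable_pathMap _).fst.comp (by fun_prop))
  have hi : Integrable (fun p : ℝ × (ℕ → ℝ) => f (pathMap k (t + p.1, p.2)).1)
      ((μ n).prod (tailProb μ (n + 1))) :=
    (integrable_const C).mono' hm.aestronglyMeasurable (ae_of_all _ fun p => hC _)
  rw [← integral_prod _ hi, integral_eq_integral_head_tail μ n hm]
  refine integral_congr_ae (ae_of_all _ fun ω => ?_)
  dsimp only
  rw [add_comm k 1, ← pathMap_pathMap]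
  simp [pathMap]

theorem IsHarmonic.ae_eq_integral_pathMap {H : ℕ → ℝ → ℂ} (hH : IsHarmonic μ H) (n k : ℕ) :
    H n =ᵐ[volume] fun t => ∫ d, H (n + k) (pathMap k (t, d)).1 ∂tailProb μ n := by
  obtain ⟨C, hC⟩ := hH.bounded
  induction k with
  | zero => simp [pathMap_zero]
  | succ k ih =>
    have h1 : ∀ᵐ x ∂pathMeasure μ n, H (n + k) (pathMap k x).1 =
        ∫ y, H (n + k + 1) ((pathMap k x).1 + y) ∂μ (n + k) :=
      (measurePreserving_pathMap_fst μ n k).quasiMeasurePreserving.ae (hH.ae_eq (n + k))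
    filter_upwards [ih, ae_ae_of_ae_pathMeasure μ h1] with t h2 h3
    rw [h2, integral_congr_ae h3, integral_pathMap_succ μ n k (hH.measurable _) (hC _), ← add_assoc]

/-- The Poisson formula. -/
theorem IsHarmonic.ae_eq_integral_boundaryLimit {H : ℕ → ℝ → ℂ} (hH : IsHarmonic μ H) (n : ℕ) :
    H n =ᵐ[volume] fun t => ∫ d, boundaryLimit H n (t, d) ∂tailProb μ n := by
  obtain ⟨C, hC⟩ := hH.bounded
  have hconv : ∀ᵐ x ∂pathMeasure μ n,
      Tendsto (fun k => H (n + k) (pathMap k x).1) atTop (𝓝 (boundaryLimit H n x)) := by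
    have hm : ∀ k, Measurable fun x => H (n + k) (pathMap k x).1 := fun k =>
      (hH.measurable _).comp (measurable_pathMap k).fst
    have : ∀ᵐ x ∂pathMeasure μ n, ∃ l, Tendsto (fun k => H (n + k) (pathMap k x).1) atTop (𝓝 l) := by
      refine (ae_pathMap_zero_iff μ n (measurableSet_exists_tendsto hm)).1 ?_
      filter_upwards [hH.ae_exists_tendsto] with x hx
      obtain ⟨l, hl⟩ := hx
      refine ⟨l, ?_⟩
      simp only [pathMap_pathMap, add_comm n]
      exact (tendsto_add_atTop_iff_nat (f := fun k => H k (pathMap k x).1) n).2 hl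
    filter_upwards [this] with x hx
    obtain ⟨l, hl⟩ := hx
    have : boundaryLimit H n x = l := limOrZero_eq hl
    rwa [this]
  filter_upwards [ae_ae_of_ae_pathMeasure μ hconv, ae_all_iff.2 (hH.ae_eq_integral_pathMap n)] with t h1 h2
  have h3 : Tendsto (fun k => ∫ d, H (n + k) (pathMap k (t, d)).1 ∂tailProb μ n) atTop
      (𝓝 (∫ d, boundaryLimit H n (t, d) ∂tailProb μ n)) := by
    refine tendsto_integral_of_dominated_convergence (fun _ => C) (fun k => ?_)
      (integrable_const C) (fun k => ae_of_all _ fun d => hC _ _) h1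
    exact ((hH.measurable _).comp ((measurable_pathMap _).fst.comp
      measurable_prodMk_left)).aestronglyMeasurable
  refine tendsto_nhds_unique ?_ h3
  exact tendsto_const_nhds.congr fun k => h2 k

/-- The Poisson formula writes `H n` as an average of the boundary function, and the boundary
function is a limit of values of `H n`; nonnegativity passes both ways. -/
theorem HasBoundaryLimit.aenonneg_iff {H : ℕ → ℝ → ℂ} (hH : IsHarmonic μ H)
    {F : (ℝ × (ℕ → ℝ)) →ₘ[pathMeasure μ 0] ℂ} (h : HasBoundaryLimit μ H F) :
    AENonneg F ↔ ∀ n, ∀ᵐ t, 0 ≤ (H n t).re ∧ (H n t).im = 0 := by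
  obtain ⟨C, hC⟩ := hH.bounded
  constructor
  · intro hF n
    have hbm := measurable_boundaryLimit hH.measurable n
    have h1 : ∀ᵐ x ∂pathMeasure μ n, 0 ≤ (boundaryLimit H n x).re ∧
        (boundaryLimit H n x).im = 0 := by
      refine (ae_pathMap_zero_iff μ n ?_).1 ?_
      · exact (measurableSet_le measurable_const (Complex.measurable_re.comp hbm)).inter
          (measurableSet_eq_fun (Complex.measurable_im.comp hbm) measurable_const)
      · filter_upwards [hF, h.ae_eq] with x h1 h2
        rwa [← boundaryLimit_zero, ← h2]
    filter_upwards [ae_ae_of_ae_pathMeasure μ h1, hH.ae_eq_integral_boundaryLimit n] with t h2 h3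
    have hi : Integrable (fun d => boundaryLimit H n (t, d)) (tailProb μ n) :=
      (integrable_const C).mono' (hbm.comp measurable_prodMk_left).aestronglyMeasurable
        (ae_of_all _ fun d => norm_boundaryLimit_le hC n _)
    have hre : (∫ d, boundaryLimit H n (t, d) ∂tailProb μ n).re =
        ∫ d, (boundaryLimit H n (t, d)).re ∂tailProb μ n := (integral_re hi).symm
    have him : (∫ d, boundaryLimit H n (t, d) ∂tailProb μ n).im =
        ∫ d, (boundaryLimit H n (t, d)).im ∂tailProb μ n := (integral_im hi).symm
    rw [h3, hre, him]
    refine ⟨integral_nonneg_of_ae (h2.mono fun d hd => hd.1), ?_⟩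
    exact integral_eq_zero_of_ae (h2.mono fun d hd => hd.2)
  · intro hn
    have h1 : ∀ᵐ x ∂pathMeasure μ 0, ∀ n, 0 ≤ (H n (pathMap n x).1).re ∧
        (H n (pathMap n x).1).im = 0 := ae_all_iff.2 fun n =>
      (measurePreserving_pathMap_fst μ 0 n).quasiMeasurePreserving.ae (hn n)
    filter_upwards [h, h1] with x h2 h3
    have hre := (Complex.continuous_re.tendsto _).comp h2
    have him := (Complex.continuous_im.tendsto _).comp h2
    refine ⟨ge_of_tendsto hre (.of_forall fun n => (h3 n).1), ?_⟩
    refine tendsto_nhds_unique him ?_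
    simp only [Function.comp_def, h3]
    exact tendsto_const_nhds

end Transform

/-! ### Integrals over intervals -/

section Increments

/-- The integral of `h` over the interval of length `ℓ` that starts at `x`. -/
def incr (h : ℝ → ℂ) (ℓ x : ℝ) : ℂ := ∫ t in x..x + ℓ, h t

variable {h : ℝ → ℂ} {C : ℝ}

theorem intervalIntegrable_of_bounded (hm : Measurable h) (hC : ∀ t, ‖h t‖ ≤ C) (a b : ℝ) :
    IntervalIntegrable h volume a b :=
  (intervalIntegrable_const (c := C)).mono_fun' hm.aestronglyMeasurable (ae_of_all _ hC)

theorem norm_incr_le (hC : ∀ t, ‖h t‖ ≤ C) (ℓ x : ℝ) : ‖incr h ℓ x‖ ≤ C * |ℓ| := by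
  have := intervalIntegral.norm_integral_le_of_norm_le_const (a := x) (b := x + ℓ)
    (fun t _ => hC t)
  rwa [add_sub_cancel_left] at this

theorem incr_add (hm : Measurable h) (hC : ∀ t, ‖h t‖ ≤ C) (ℓ ℓ' x : ℝ) :
    incr h (ℓ + ℓ') x = incr h ℓ x + incr h ℓ' (x + ℓ) := by
  simp only [incr]
  rw [intervalIntegral.integral_add_adjacent_intervals (intervalIntegrable_of_bounded hm hC _ _)
    (intervalIntegrable_of_bounded hm hC _ _), add_assoc]

/-- Moving an interval trades one piece of length `|x - y|` for another. Interval integrals of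
merely bounded functions are thus admissible test functions for `BLClose`. -/
theorem norm_incr_sub_le (hm : Measurable h) (hC : ∀ t, ‖h t‖ ≤ C) (ℓ x y : ℝ) :
    ‖incr h ℓ x - incr h ℓ y‖ ≤ 2 * C * |x - y| := by
  have h1 := incr_add hm hC (y - x) ℓ x
  have h2 := incr_add hm hC ℓ (y - x) x
  rw [add_comm ℓ, h1] at h2
  have h3 : incr h ℓ x - incr h ℓ y = incr h (y - x) x - incr h (y - x) (x + ℓ) := by
    rw [add_sub_cancel] at h2
    linear_combination -h2
  rw [h3, abs_sub_comm]
  refine (norm_sub_le _ _).trans ?_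
  linarith [norm_incr_le hC (y - x) x, norm_incr_le hC (y - x) (x + ℓ)]

theorem continuous_incr (hm : Measurable h) (hC : ∀ t, ‖h t‖ ≤ C) (ℓ : ℝ) :
    Continuous (incr h ℓ) := by
  have : LipschitzWith (2 * C).toNNReal (incr h ℓ) := LipschitzWith.of_dist_le_mul fun x y => by
    have hC0 : 0 ≤ C := (norm_nonneg _).trans (hC 0)
    rw [dist_eq_norm, Real.dist_eq, Real.coe_toNNReal _ (by positivity)]
    exact norm_incr_sub_le hm hC ℓ x y
  exact this.continuous

theorem incr_integral {Ω : Type*} [MeasurableSpace Ω] {P : Measure Ω} [IsProbabilityMeasure P]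
    (hm : Measurable h) (hC : ∀ t, ‖h t‖ ≤ C) {S : Ω → ℝ} (hS : Measurable S) (ℓ x : ℝ) :
    incr (fun t => ∫ ω, h (t + S ω) ∂P) ℓ x = ∫ ω, incr h ℓ (x + S ω) ∂P := by
  have h1 : ∀ ω, incr h ℓ (x + S ω) = ∫ t in x..x + ℓ, h (t + S ω) := fun ω => by
    rw [intervalIntegral.integral_comp_add_right, incr, add_right_comm]
  simp only [h1]
  have hi : Integrable (fun p : ℝ × Ω => h (p.1 + S p.2))
      ((volume.restrict (Set.uIoc x (x + ℓ))).prod P) := by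
    have : IsFiniteMeasure (volume.restrict (Set.uIoc x (x + ℓ))) :=
      ⟨by rw [Measure.restrict_apply_univ, Set.uIoc]; exact measure_Ioc_lt_top⟩
    exact (integrable_const C).mono' (hm.comp (by fun_prop)).aestronglyMeasurable
      (ae_of_all _ fun p => hC _)
  simp only [incr, intervalIntegral.intervalIntegral_eq_integral_uIoc]
  rw [integral_smul, integral_integral_swap hi]

/-- Lebesgue differentiation recovers a function from its integrals over intervals. -/
theorem ae_eq_of_incr_eq {h' : ℝ → ℂ} {C' : ℝ} (hm : Measurable h) (hC : ∀ t, ‖h t‖ ≤ C)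
    (hm' : Measurable h') (hC' : ∀ t, ‖h' t‖ ≤ C') (heq : ∀ ℓ x, incr h ℓ x = incr h' ℓ x) :
    h =ᵐ[volume] h' := by
  have hl : ∀ {g : ℝ → ℂ} {C : ℝ}, Measurable g → (∀ t, ‖g t‖ ≤ C) → LocallyIntegrable g volume :=
    fun {_ C} hg hgC => (locallyIntegrable_const (C : ℝ)).mono hg.aestronglyMeasurable
      (ae_of_all _ fun t => (hgC t).trans (le_abs_self C))
  filter_upwards [LocallyIntegrable.ae_hasDerivAt_integral (hl hm hC),
    LocallyIntegrable.ae_hasDerivAt_integral (hl hm' hC')] with x h1 h2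
  have : (fun t => ∫ s in (0 : ℝ)..t, h s) = fun t => ∫ s in (0 : ℝ)..t, h' s := by
    funext t
    have := heq t 0
    simpa only [incr, zero_add] using this
  have h3 := h1 0
  rw [this] at h3
  exact h3.unique (h2 0)

theorem ae_nonneg_of_incr_nonneg (hm : Measurable h) (hC : ∀ t, ‖h t‖ ≤ C)
    (hpos : ∀ ℓ, 0 ≤ ℓ → ∀ x, 0 ≤ (incr h ℓ x).re ∧ (incr h ℓ x).im = 0) :
    ∀ᵐ t, 0 ≤ (h t).re ∧ (h t).im = 0 := by
  have hl : LocallyIntegrable h volume :=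
    (locallyIntegrable_const (C : ℝ)).mono hm.aestronglyMeasurable
      (ae_of_all _ fun t => (hC t).trans (le_abs_self C))
  filter_upwards [LocallyIntegrable.ae_hasDerivAt_integral hl] with x hx
  have hx := hx x
  have hlim : Tendsto (fun t : ℝ => t⁻¹ • incr h t x) (𝓝[>] 0) (𝓝 (h x)) := by
    have := hx.tendsto_slope_zero_right
    simpa only [intervalIntegral.integral_same, sub_zero, incr] using this
  have hre := (Complex.continuous_re.tendsto _).comp hlim
  have him := (Complex.continuous_im.tendsto _).comp hlim
  refine ⟨ge_of_tendsto hre ?_, tendsto_nhds_unique (him.congr' ?_) tendsto_const_nhds⟩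
  · filter_upwards [self_mem_nhdsWithin] with t ht
    have ht : 0 < t := ht
    simp only [Function.comp_apply, Complex.real_smul, Complex.re_ofReal_mul]
    exact mul_nonneg (inv_pos.2 ht).le (hpos t ht.le x).1
  · filter_upwards [self_mem_nhdsWithin] with t ht
    have ht : 0 < t := ht
    simp [(hpos t ht.le x).2]

/-- Lipschitz functions are integrals of bounded functions. -/
theorem exists_density_of_lipschitz {f : ℝ → ℂ} (hf : ∀ x y, ‖f x - f y‖ ≤ C * |x - y|) :
    ∃ g : ℝ → ℂ, Measurable g ∧ (∀ x, ‖g x‖ ≤ 2 * C) ∧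
      ∀ x y, ∫ t in x..y, g t = f y - f x := by
  have hC0 : 0 ≤ C := by simpa using (norm_nonneg _).trans (hf 1 0)
  have key : ∀ r : ℝ → ℝ, (∀ x y, |r x - r y| ≤ C * |x - y|) →
      Measurable (deriv r) ∧ (∀ x, |deriv r x| ≤ C) ∧
        ∀ x y, IntervalIntegrable (deriv r) volume x y ∧ ∫ t in x..y, deriv r t = r y - r x := by
    intro r hr
    have hL : LipschitzWith ⟨C, hC0⟩ r := LipschitzWith.of_dist_le_mul fun x y => by
      rw [Real.dist_eq, Real.dist_eq]
      exact hr x y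
    refine ⟨measurable_deriv r, fun x => norm_deriv_le_of_lipschitz hL, fun x y => ?_⟩
    have hac := (hL.lipschitzOnWith (s := Set.uIcc x y)).absolutelyContinuousOnInterval
    exact ⟨hac.intervalIntegrable_deriv, hac.integral_deriv_eq_sub⟩
  obtain ⟨hm1, hb1, hi1⟩ := key (fun x => (f x).re) fun x y => by
    rw [← Complex.sub_re]
    exact (Complex.abs_re_le_norm _).trans (hf x y)
  obtain ⟨hm2, hb2, hi2⟩ := key (fun x => (f x).im) fun x y => by
    rw [← Complex.sub_im]
    exact (Complex.abs_im_le_norm _).trans (hf x y)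
  -- The real and imaginary parts each have derivative bounded by `C`, whence `2 * C`.
  refine ⟨fun t => deriv (fun x => (f x).re) t + deriv (fun x => (f x).im) t * Complex.I,
    by fun_prop, fun x => ?_, fun x y => ?_⟩
  · refine (norm_add_le _ _).trans ?_
    rw [norm_mul, Complex.norm_I, mul_one, Complex.norm_real, Complex.norm_real, two_mul]
    exact add_le_add (hb1 x) (hb2 x)
  · have ofReal : ∀ {r : ℝ → ℝ}, IntervalIntegrable r volume x y →
        IntervalIntegrable (fun t => (r t : ℂ)) volume x y := fun h =>
      ⟨Integrable.ofReal h.1, Integrable.ofReal h.2⟩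
    rw [intervalIntegral.integral_add (ofReal (hi1 x y).1) ((ofReal (hi2 x y).1).mul_const _),
      intervalIntegral.integral_mul_const, intervalIntegral.integral_ofReal,
      intervalIntegral.integral_ofReal, (hi1 x y).2, (hi2 x y).2]
    apply Complex.ext <;> simp

end Increments

/-! ### Perturbation of harmonic sequences -/

section Perturbation

/-- The integrals of `H m` and `H' m` over intervals of a fixed length are asymptotically equal,
uniformly in the position of the interval. -/
def IntervalClose (H H' : ℕ → ℝ → ℂ) : Prop :=
  ∀ ℓ : ℝ, ∀ ε > 0, ∀ᶠ m in atTop, ∀ x, ‖incr (H m) ℓ x - incr (H' m) ℓ x‖ ≤ ε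

theorem IntervalClose.symm {H H' : ℕ → ℝ → ℂ} (h : IntervalClose H H') : IntervalClose H' H :=
  fun ℓ ε hε => (h ℓ ε hε).mono fun m hm x => by
    rw [norm_sub_rev]
    exact hm x

variable {μ μ' : ℕ → Measure ℝ} [∀ n, IsProbabilityMeasure (μ n)]
  [∀ n, IsProbabilityMeasure (μ' n)] {H H' : ℕ → ℝ → ℂ}

theorem incr_congr_ae {h h' : ℝ → ℂ} (heq : h =ᵐ[volume] h') (ℓ x : ℝ) :
    incr h ℓ x = incr h' ℓ x :=
  intervalIntegral.integral_congr_ae (heq.mono fun _ ht _ => ht)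

theorem IsHarmonic.incr_eq (hH : IsHarmonic μ H) (n : ℕ) (ℓ x : ℝ) :
    incr (H n) ℓ x = ∫ y, incr (H (n + 1)) ℓ (x + y) ∂μ n := by
  obtain ⟨C, hC⟩ := hH.bounded
  rw [incr_congr_ae (hH.ae_eq n)]
  exact incr_integral (hH.measurable _) (hC _) measurable_id ℓ x

theorem measurable_pathMap_mk_fst (k : ℕ) (x : ℝ) :
    Measurable fun d : ℕ → ℝ => (pathMap k (x, d)).1 :=
  (measurable_pathMap k).fst.comp measurable_prodMk_left

theorem IsHarmonic.incr_eq_integral_pathMap (hH : IsHarmonic μ H) (n k : ℕ) (ℓ x : ℝ) :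
    incr (H n) ℓ x = ∫ d, incr (H (n + k)) ℓ (pathMap k (x, d)).1 ∂tailProb μ n := by
  obtain ⟨C, hC⟩ := hH.bounded
  rw [incr_congr_ae (hH.ae_eq_integral_pathMap n k)]
  exact incr_integral (S := fun d : ℕ → ℝ => ∑ i ∈ Finset.range k, d i) (hH.measurable _) (hC _)
    (by fun_prop) ℓ x

/-- Along the walk of `μ'`, the interval integral of `H' n` is the average of those of `H' (n + k)`.
For large `k` these are uniformly close to the interval integrals of `H (n + k)`, which are
nonnegative. -/
theorem IntervalClose.ae_nonneg (h : IntervalClose H H') (hH : IsHarmonic μ H)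
    (hH' : IsHarmonic μ' H') (hpos : ∀ n, ∀ᵐ t, 0 ≤ (H n t).re ∧ (H n t).im = 0) (n : ℕ) :
    ∀ᵐ t, 0 ≤ (H' n t).re ∧ (H' n t).im = 0 := by
  obtain ⟨C, hC⟩ := hH.bounded
  obtain ⟨C', hC'⟩ := hH'.bounded
  refine ae_nonneg_of_incr_nonneg (hH'.measurable n) (hC' n) fun ℓ hℓ x => ?_
  have hincr : ∀ m y, 0 ≤ (incr (H m) ℓ y).re ∧ (incr (H m) ℓ y).im = 0 := fun m y => by
    have hi : Integrable (H m) (volume.restrict (Set.Ioc y (y + ℓ))) :=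
      (intervalIntegrable_of_bounded (hH.measurable m) (hC m) y (y + ℓ)).1
    rw [incr, intervalIntegral.integral_of_le (by linarith)]
    have hre : (∫ t in Set.Ioc y (y + ℓ), H m t).re = ∫ t in Set.Ioc y (y + ℓ), (H m t).re :=
      (integral_re hi).symm
    have him : (∫ t in Set.Ioc y (y + ℓ), H m t).im = ∫ t in Set.Ioc y (y + ℓ), (H m t).im :=
      (integral_im hi).symm
    rw [hre, him]
    have := ae_restrict_of_ae (s := Set.Ioc y (y + ℓ)) (hpos m)
    exact ⟨integral_nonneg_of_ae (this.mono fun t ht => ht.1),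
      integral_eq_zero_of_ae (this.mono fun t ht => ht.2)⟩
  set v : ℕ → ℂ := fun k => ∫ d, incr (H (n + k)) ℓ (pathMap k (x, d)).1 ∂tailProb μ' n
  have hint : ∀ {G : ℕ → ℝ → ℂ} {D : ℝ}, (∀ n, Measurable (G n)) → (∀ n t, ‖G n t‖ ≤ D) →
      ∀ k, Integrable (fun d => incr (G (n + k)) ℓ (pathMap k (x, d)).1) (tailProb μ' n) :=
    fun {G D} hG hD k => (integrable_const (D * |ℓ|)).mono'
      (((continuous_incr (hG _) (hD _) ℓ).measurable.comp
        (measurable_pathMap_mk_fst k x)).aestronglyMeasurable)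
      (ae_of_all _ fun d => norm_incr_le (hD _) ℓ _)
  have hlim : Tendsto v atTop (𝓝 (incr (H' n) ℓ x)) := by
    rw [Metric.tendsto_atTop']
    intro ε hε
    obtain ⟨N, hN⟩ := eventually_atTop.1 (h ℓ (ε / 2) (half_pos hε))
    refine ⟨N, fun k hk => ?_⟩
    rw [hH'.incr_eq_integral_pathMap n k, dist_eq_norm,
      ← integral_sub (hint hH.measurable hC k) (hint hH'.measurable hC' k)]
    refine lt_of_le_of_lt (norm_integral_le_of_norm_le_const
      (ae_of_all _ fun d => hN (n + k) (by omega) _)) ?_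
    simp [hε]
  have hv : ∀ k, 0 ≤ (v k).re ∧ (v k).im = 0 := fun k => by
    have hre : (v k).re = ∫ d, (incr (H (n + k)) ℓ (pathMap k (x, d)).1).re ∂tailProb μ' n :=
      (integral_re (hint hH.measurable hC k)).symm
    have him : (v k).im = ∫ d, (incr (H (n + k)) ℓ (pathMap k (x, d)).1).im ∂tailProb μ' n :=
      (integral_im (hint hH.measurable hC k)).symm
    rw [hre, him]
    exact ⟨integral_nonneg fun d => (hincr _ _).1,
      integral_eq_zero_of_ae (ae_of_all _ fun d => (hincr _ _).2)⟩
  refine ⟨ge_of_tendsto ((Complex.continuous_re.tendsto _).comp hlim)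
    (.of_forall fun k => (hv k).1),
    tendsto_nhds_unique ((Complex.continuous_im.tendsto _).comp hlim) ?_⟩
  simp only [Function.comp_def, hv]
  exact tendsto_const_nhds

/-- Harmonic sequences survive summable perturbations of the increments. -/
theorem IsHarmonic.exists_intervalClose (hH : IsHarmonic μ H) {ε : ℕ → ℝ} (hε : Summable ε)
    (hμ : ∀ n, BLClose (μ n) (μ' n) (ε n)) : ∃ H', IsHarmonic μ' H' ∧ IntervalClose H H' := by
  obtain ⟨C, hC⟩ := hH.bounded
  have hC0 : 0 ≤ C := (norm_nonneg _).trans (hC 0 0)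
  have hcont : ∀ n ℓ, Measurable (incr (H n) ℓ) := fun n ℓ =>
    (continuous_incr (hH.measurable n) (hC n) ℓ).measurable
  -- `H` at time `n + k` is averaged over the walk driven by `μ'`. Passing from `k` to `k + 1`
  -- exchanges `μ (n + k)` for `μ' (n + k)` in a single step, because `H` is harmonic for `μ`.
  set u : ℕ → ℝ → ℝ → ℕ → ℂ := fun n ℓ x k =>
    ∫ d, incr (H (n + k)) ℓ (pathMap k (x, d)).1 ∂tailProb μ' n
  -- This dominates both the sup norm `C * |ℓ|` and the Lipschitz constant `2 * C` of the interval
  -- integrals.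
  set K : ℝ → ℝ := fun ℓ => 2 * C * (|ℓ| + 1)
  have hint : ∀ n ℓ x k, Integrable (fun d => incr (H (n + k)) ℓ (pathMap k (x, d)).1)
      (tailProb μ' n) := fun n ℓ x k => (integrable_const (C * |ℓ|)).mono'
    ((hcont _ ℓ).comp (measurable_pathMap_mk_fst k x)).aestronglyMeasurable
    (ae_of_all _ fun d => norm_incr_le (hC _) ℓ _)
  have hK : ∀ n ℓ x, ‖∫ y, incr (H (n + 1)) ℓ (x + y) ∂μ n - ∫ y, incr (H (n + 1)) ℓ (x + y) ∂μ' n‖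
      ≤ K ℓ * ε n := fun n ℓ x => by
    have hm := hH.measurable (n + 1)
    refine hμ n _ (K ℓ) (fun y => (norm_incr_le (hC _) ℓ _).trans ?_) fun y z =>
      (norm_incr_sub_le hm (hC _) ℓ _ _).trans ?_
    · have := abs_nonneg ℓ
      simp only [K]
      nlinarith
    · rw [add_sub_add_left_eq_sub]
      refine mul_le_mul_of_nonneg_right ?_ (abs_nonneg _)
      have := abs_nonneg ℓ
      simp only [K]
      nlinarith
  have hstep : ∀ n ℓ x k, dist (u n ℓ x k) (u n ℓ x (k + 1)) ≤ K ℓ * ε (n + k) := fun n ℓ x k => by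
    have h1 : u n ℓ x (k + 1) = ∫ d, ∫ y, incr (H (n + k + 1)) ℓ ((pathMap k (x, d)).1 + y)
        ∂μ' (n + k) ∂tailProb μ' n :=
      integral_pathMap_succ μ' n k (hcont (n + k + 1) ℓ) (norm_incr_le (hC _) ℓ) x
    have hm : Measurable fun t => ∫ y, incr (H (n + k + 1)) ℓ (t + y) ∂μ' (n + k) :=
      (((hcont (n + k + 1) ℓ).comp measurable_add).stronglyMeasurable.integral_prod_right').measurable
    have hi : Integrable (fun d => ∫ y, incr (H (n + k + 1)) ℓ ((pathMap k (x, d)).1 + y)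
        ∂μ' (n + k)) (tailProb μ' n) := (integrable_const (C * |ℓ|)).mono'
      (hm.comp (measurable_pathMap_mk_fst k x)).aestronglyMeasurable
      (ae_of_all _ fun d => by
        refine (norm_integral_le_of_norm_le_const
          (ae_of_all _ fun y => norm_incr_le (hC _) ℓ _)).trans ?_
        simp)
    rw [dist_eq_norm, h1, ← integral_sub (hint n ℓ x k) hi]
    refine (norm_integral_le_of_norm_le_const (C := K ℓ * ε (n + k))
      (ae_of_all _ fun d => ?_)).trans (by simp)
    rw [hH.incr_eq]
    exact hK _ _ _
  have hsum : ∀ n ℓ, Summable fun k => K ℓ * ε (n + k) := fun n ℓ => by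
    have := (summable_nat_add_iff n).2 hε
    simp only [add_comm n]
    exact this.mul_left _
  have hex : ∀ n ℓ x, ∃ a, Tendsto (u n ℓ x) atTop (𝓝 a) := fun n ℓ x =>
    cauchySeq_tendsto_of_complete (cauchySeq_of_dist_le_of_summable _ (hstep n ℓ x) (hsum n ℓ))
  choose U hU using hex
  have hUadd : ∀ n ℓ ℓ' x, U n (ℓ + ℓ') x = U n ℓ x + U n ℓ' (x + ℓ) := fun n ℓ ℓ' x => by
    refine tendsto_nhds_unique (hU n (ℓ + ℓ') x) (((hU n ℓ x).add (hU n ℓ' (x + ℓ))).congr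
      fun k => ?_)
    rw [← integral_add (hint n ℓ x k) (hint n ℓ' (x + ℓ) k)]
    refine integral_congr_ae (ae_of_all _ fun d => ?_)
    dsimp only
    rw [incr_add (hH.measurable _) (hC _)]
    simp only [pathMap, add_right_comm]
  have hubd : ∀ n ℓ x k, ‖u n ℓ x k‖ ≤ C * |ℓ| := fun n ℓ x k => by
    refine (norm_integral_le_of_norm_le_const
      (ae_of_all _ fun d => norm_incr_le (hC _) ℓ _)).trans ?_
    simp
  have hUbd : ∀ n ℓ x, ‖U n ℓ x‖ ≤ C * |ℓ| := fun n ℓ x =>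
    le_of_tendsto (hU n ℓ x).norm (.of_forall fun k => hubd n ℓ x k)
  have hUsub : ∀ n x y, U n y 0 - U n x 0 = U n (y - x) x := fun n x y => by
    have := hUadd n x (y - x) 0
    rw [add_sub_cancel, zero_add] at this
    rw [this, add_sub_cancel_left]
  -- The limits `U` are additive in the length and bounded by `C * |ℓ|`, so their primitive is
  -- Lipschitz; its density is the new harmonic function.
  have hdens : ∀ n, ∃ g : ℝ → ℂ, Measurable g ∧ (∀ x, ‖g x‖ ≤ 2 * C) ∧
      ∀ x y, ∫ t in x..y, g t = U n y 0 - U n x 0 := fun n =>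
    exists_density_of_lipschitz (f := fun x => U n x 0) fun x y => by
      rw [hUsub n y x]
      exact hUbd _ _ _
  choose g hg hgC hgU using hdens
  have hgincr : ∀ n ℓ x, incr (g n) ℓ x = U n ℓ x := fun n ℓ x => by
    rw [incr, hgU, hUsub, add_sub_cancel_left]
  have hum : ∀ n ℓ k, Measurable fun x => u n ℓ x k := fun n ℓ k =>
    (((hcont (n + k) ℓ).comp (measurable_pathMap k).fst).stronglyMeasurable.integral_prod_right').measurable
  -- Harmonicity for `μ'` comes from splitting off the first step of the average and passing to the
  -- limit by dominated convergence.
  have hUharm : ∀ n ℓ x, U n ℓ x = ∫ y, U (n + 1) ℓ (x + y) ∂μ' n := fun n ℓ x => by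
    refine tendsto_nhds_unique ((tendsto_add_atTop_iff_nat 1).2 (hU n ℓ x)) ?_
    have : ∀ k, u n ℓ x (k + 1) = ∫ y, u (n + 1) ℓ (x + y) k ∂μ' n := fun k => by
      simp only [u]
      rw [integral_pathMap_succ' μ' n k (hcont _ ℓ) (norm_incr_le (hC _) ℓ) x,
        show n + (k + 1) = n + 1 + k by ring]
    simp only [this]
    exact tendsto_integral_of_dominated_convergence (fun _ => C * |ℓ|)
      (fun k => ((hum (n + 1) ℓ k).comp (measurable_const_add x)).aestronglyMeasurable)
      (integrable_const _) (fun k => ae_of_all _ fun y => hubd _ _ _ _)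
      (ae_of_all _ fun y => hU _ _ _)
  refine ⟨g, ⟨hg, ⟨2 * C, hgC⟩, fun n => ?_⟩, fun ℓ δ hδ => ?_⟩
  · refine ae_eq_of_incr_eq (hg n) (hgC n) (C' := 2 * C) ?_ (fun t => ?_) fun ℓ x => ?_
    · exact ((hg (n + 1)).comp measurable_add).stronglyMeasurable.integral_prod_right'.measurable
    · refine (norm_integral_le_of_norm_le_const (ae_of_all _ fun y => hgC _ _)).trans ?_
      simp
    · rw [hgincr, hUharm, incr_integral (S := fun y => y) (hg _) (hgC _) measurable_id]
      simp only [hgincr]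
  -- The distance at time `m` is at most a tail of the convergent error series, uniformly in the
  -- position.
  · have hlim := (tendsto_sum_nat_add fun k => K ℓ * ε k)
    filter_upwards [hlim.eventually (gt_mem_nhds hδ)] with m hm x
    have h1 := dist_le_tsum_of_dist_le_of_tendsto₀ _ (hstep m ℓ x) (hsum m ℓ) (hU m ℓ x)
    have h2 : u m ℓ x 0 = incr (H m) ℓ x := by simp [u, pathMap_zero]
    rw [h2, dist_eq_norm] at h1
    rw [hgincr]
    refine h1.trans (le_of_lt ?_)
    simpa only [add_comm m] using hm

end Perturbation

/-! ### Invariance under translations -/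

section Invariance

/-- A function that is invariant under `a v w` for every `w` in a group can be evaluated almost
everywhere at a point of each orbit that is chosen measurably. -/
theorem exists_ae_eq_of_invariant {V W : Type*} [MeasurableSpace V] [MeasurableSpace W]
    [AddGroup W] [MeasurableAdd₂ W] [MeasurableNeg W] {P : Measure V} [SFinite P] (ν : Measure W)
    [SFinite ν] [ν.IsAddLeftInvariant] [NeZero ν] {f : V → ℂ} (hf : Measurable f)
    {a : V → W → V} (ha : Measurable fun p : V × W => a p.1 p.2) {θ : V → W} (hθ : Measurable θ)
    (h : ∀ w, ∀ᵐ v ∂P, f (a v w) = f v) : ∃ w, ∀ᵐ v ∂P, f (a v (-θ v + w)) = f v := by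
  have h1 : ∀ᵐ v ∂P, ∀ᵐ w ∂ν, f (a v w) = f v := by
    refine (ae_ae_comm (μ := ν) (ν := P) (p := fun w v => f (a v w) = f v) ?_).1 (ae_of_all _ h)
    exact measurableSet_eq_fun (hf.comp (ha.comp measurable_swap)) (hf.comp measurable_snd)
  -- For almost every `v` the good `w` are conull, and so are the `w` that become good after the
  -- translation by `-θ v`. Fubini then selects one `w` that works for almost every `v`.
  have h2 : ∀ᵐ v ∂P, ∀ᵐ w ∂ν, f (a v (-θ v + w)) = f v := by
    filter_upwards [h1] with v hv
    exact (measurePreserving_add_left ν (-θ v)).quasiMeasurePreserving.ae hv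
  have h3 : ∀ᵐ w ∂ν, ∀ᵐ v ∂P, f (a v (-θ v + w)) = f v := by
    refine (ae_ae_comm (μ := P) (ν := ν) (p := fun v w => f (a v (-θ v + w)) = f v) ?_).1 h2
    exact measurableSet_eq_fun (hf.comp (ha.comp (measurable_fst.prodMk
      ((hθ.comp measurable_fst).neg.add measurable_snd)))) (hf.comp measurable_fst)
  have : (ae ν).NeBot := ae_neBot.2 (NeZero.ne ν)
  exact h3.exists

theorem exists_ae_eq_const_of_translation_invariant {f : ℝ → ℂ} (hf : Measurable f)
    (h : ∀ s, ∀ᵐ t, f (t + s) = f t) : ∃ c, ∀ᵐ t, f t = c := by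
  obtain ⟨w, hw⟩ := exists_ae_eq_of_invariant volume hf (a := fun t s => t + s) measurable_add
    measurable_id h
  refine ⟨f w, hw.mono fun t ht => ?_⟩
  simpa using ht.symm

/-- Functions on `ℝ^(l + 1)` that are invariant under the vectors with coordinate sum zero. -/
theorem exists_ae_eq_comp_sum {l : ℕ} {f : (Fin (l + 1) → ℝ) → ℂ} (hf : Measurable f)
    (h : ∀ w : Fin (l + 1) → ℝ, ∑ i, w i = 0 → ∀ᵐ v, f (v + w) = f v) :
    ∃ b : ℝ → Fin (l + 1) → ℝ, Measurable b ∧ ∀ᵐ v, f v = f (b (∑ i, v i)) := by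
  have hm : Measurable fun w : Fin l → ℝ => (Fin.cons (-∑ i, w i) w : Fin (l + 1) → ℝ) := by
    refine measurable_pi_iff.2 fun i => ?_
    refine Fin.cases ?_ (fun j => ?_) i
    · simp only [Fin.cons_zero]
      fun_prop
    · simp only [Fin.cons_succ]
      fun_prop
  -- The last `l` coordinates parametrize the zero-sum vectors, and `θ` reads those coordinates of
  -- `v`. After the translation they equal `w`, so the resulting point depends on `v` only through
  -- its coordinate sum.
  obtain ⟨w, hw⟩ := exists_ae_eq_of_invariant (volume : Measure (Fin l → ℝ)) hf
    (a := fun v w => v + Fin.cons (-∑ i, w i) w) (measurable_fst.add (hm.comp measurable_snd))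
    (θ := Fin.tail) (by unfold Fin.tail; fun_prop) fun w => h _ (by simp [Fin.sum_univ_succ])
  refine ⟨fun s => Fin.cons (s - ∑ i, w i) w, ?_, hw.mono fun v hv => ?_⟩
  · refine measurable_pi_iff.2 fun i => ?_
    refine Fin.cases ?_ (fun j => ?_) i
    · simp only [Fin.cons_zero]
      fun_prop
    · simp only [Fin.cons_succ]
      fun_prop
  · rw [← hv]
    congr 1
    funext i
    refine Fin.cases ?_ (fun j => ?_) i
    · simp [Fin.sum_univ_succ, Fin.tail, Finset.sum_add_distrib]
      ring
    · simp [Fin.tail]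

end Invariance

/-! ### Linear operations on harmonic sequences -/

section Operations

variable {μ : ℕ → Measure ℝ} [∀ n, IsProbabilityMeasure (μ n)] {H G : ℕ → ℝ → ℂ}

theorem integrable_comp_add_of_bounded {P : Measure ℝ} [IsFiniteMeasure P] {f : ℝ → ℂ}
    (hf : Measurable f) {C : ℝ} (hC : ∀ t, ‖f t‖ ≤ C) (t : ℝ) :
    Integrable (fun y => f (t + y)) P :=
  (integrable_const C).mono' (hf.comp (measurable_const_add t)).aestronglyMeasurable
    (ae_of_all _ fun _ => hC _)

theorem IsHarmonic.add (hH : IsHarmonic μ H) (hG : IsHarmonic μ G) :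
    IsHarmonic μ fun n t => H n t + G n t := by
  obtain ⟨C, hC⟩ := hH.bounded
  obtain ⟨D, hD⟩ := hG.bounded
  refine ⟨fun n => (hH.measurable n).add (hG.measurable n),
    ⟨C + D, fun n t => (norm_add_le _ _).trans (add_le_add (hC n t) (hD n t))⟩, fun n => ?_⟩
  filter_upwards [hH.ae_eq n, hG.ae_eq n] with t h1 h2
  rw [h1, h2, integral_add (integrable_comp_add_of_bounded (hH.measurable _) (hC _) t)
    (integrable_comp_add_of_bounded (hG.measurable _) (hD _) t)]

theorem IsHarmonic.const_mul (hH : IsHarmonic μ H) (c : ℂ) :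
    IsHarmonic μ fun n t => c * H n t := by
  obtain ⟨C, hC⟩ := hH.bounded
  refine ⟨fun n => (hH.measurable n).const_mul c, ⟨‖c‖ * C, fun n t => ?_⟩, fun n => ?_⟩
  · rw [norm_mul]
    exact mul_le_mul_of_nonneg_left (hC n t) (norm_nonneg c)
  · filter_upwards [hH.ae_eq n] with t h1
    rw [h1, integral_const_mul]

variable (μ) in
theorem isHarmonic_one : IsHarmonic μ fun _ _ => 1 :=
  ⟨fun _ => measurable_const, ⟨1, fun _ _ => by simp⟩, fun n => ae_of_all _ fun t => by simp⟩

theorem IsHarmonic.translate (hH : IsHarmonic μ H) (s : ℝ) :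
    IsHarmonic μ fun n t => H n (t + s) := by
  obtain ⟨C, hC⟩ := hH.bounded
  refine ⟨fun n => (hH.measurable n).comp (measurable_add_const s), ⟨C, fun n t => hC n _⟩,
    fun n => ?_⟩
  filter_upwards [(measurePreserving_add_right volume s).quasiMeasurePreserving.ae (hH.ae_eq n)]
    with t ht
  rw [ht]
  simp only [add_right_comm]

theorem HasBoundaryLimit.add {F F' : (ℝ × (ℕ → ℝ)) →ₘ[pathMeasure μ 0] ℂ}
    (hH : HasBoundaryLimit μ H F) (hG : HasBoundaryLimit μ G F') :
    HasBoundaryLimit μ (fun n t => H n t + G n t) ↑(F + F') := by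
  filter_upwards [hH, hG, AEEqFun.coeFn_add F F'] with x h1 h2 h3
  rw [h3]
  exact h1.add h2

theorem HasBoundaryLimit.const_mul {F : (ℝ × (ℕ → ℝ)) →ₘ[pathMeasure μ 0] ℂ}
    (hH : HasBoundaryLimit μ H F) (c : ℂ) :
    HasBoundaryLimit μ (fun n t => c * H n t) ↑(c • F) := by
  filter_upwards [hH, AEEqFun.coeFn_smul c F] with x h1 h3
  rw [h3]
  exact h1.const_mul c

variable (μ) in
theorem hasBoundaryLimit_one :
    HasBoundaryLimit μ (fun _ _ => 1) ((1 : (ℝ × (ℕ → ℝ)) →ₘ[pathMeasure μ 0] ℂ) : _ → ℂ) := by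
  filter_upwards [AEEqFun.coeFn_one (α := ℝ × (ℕ → ℝ)) (μ := pathMeasure μ 0) (β := ℂ)] with x h1
  rw [h1]
  exact tendsto_const_nhds

theorem HasBoundaryLimit.translate {F : (ℝ × (ℕ → ℝ)) →ₘ[pathMeasure μ 0] ℂ}
    (hH : HasBoundaryLimit μ H F) (s : ℝ) :
    HasBoundaryLimit μ (fun n t => H n (t + s))
      ↑(pullback _ (quasiMeasurePreserving_translate μ 0 s) F) := by
  filter_upwards [(quasiMeasurePreserving_translate μ 0 s).ae hH,
    coeFn_pullback _ (quasiMeasurePreserving_translate μ 0 s) F] with x h1 h2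
  rw [h2, Function.comp_apply]
  simpa only [pathMap, add_right_comm] using h1

/-- Both differences have boundary value zero, so both are nonnegative. This is the uniqueness of
the harmonic extension. -/
theorem HasBoundaryLimit.ae_eq_of_eq {F : (ℝ × (ℕ → ℝ)) →ₘ[pathMeasure μ 0] ℂ}
    (hH : IsHarmonic μ H) (hG : IsHarmonic μ G) (h₁ : HasBoundaryLimit μ H F)
    (h₂ : HasBoundaryLimit μ G F) (n : ℕ) : H n =ᵐ[volume] G n := by
  have key : ∀ {H G : ℕ → ℝ → ℂ}, IsHarmonic μ H → IsHarmonic μ G → HasBoundaryLimit μ H F →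
      HasBoundaryLimit μ G F → ∀ᵐ t, 0 ≤ (H n t + -1 * G n t).re ∧ (H n t + -1 * G n t).im = 0 := by
    intro H G hH hG h₁ h₂
    refine (HasBoundaryLimit.aenonneg_iff (hH.add (hG.const_mul (-1)))
      (h₁.add (h₂.const_mul (-1)))).1 ?_ n
    rw [neg_one_smul, add_neg_cancel]
    filter_upwards [AEEqFun.coeFn_zero (α := ℝ × (ℕ → ℝ)) (μ := pathMeasure μ 0) (β := ℂ)] with x hx
    simp [hx]
  filter_upwards [key hH hG h₁ h₂, key hG hH h₂ h₁] with t ht ht'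
  simp only [neg_one_mul, Complex.add_re, Complex.neg_re, Complex.add_im, Complex.neg_im]
    at ht ht'
  exact Complex.ext (by linarith [ht.1, ht'.1]) (by linarith [ht.2])

theorem IntervalClose.add {H' G' : ℕ → ℝ → ℂ} (hH : IntervalClose H H') (hG : IntervalClose G G')
    {C : ℝ} (mH : ∀ n, Measurable (H n)) (mH' : ∀ n, Measurable (H' n))
    (mG : ∀ n, Measurable (G n)) (mG' : ∀ n, Measurable (G' n)) (bH : ∀ n t, ‖H n t‖ ≤ C)
    (bH' : ∀ n t, ‖H' n t‖ ≤ C) (bG : ∀ n t, ‖G n t‖ ≤ C) (bG' : ∀ n t, ‖G' n t‖ ≤ C) :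
    IntervalClose (fun n t => H n t + G n t) fun n t => H' n t + G' n t := fun ℓ ε hε => by
  filter_upwards [hH ℓ (ε / 2) (half_pos hε), hG ℓ (ε / 2) (half_pos hε)] with m h1 h2 x
  simp only [incr] at h1 h2 ⊢
  rw [intervalIntegral.integral_add (intervalIntegrable_of_bounded (mH m) (bH m) _ _)
    (intervalIntegrable_of_bounded (mG m) (bG m) _ _),
    intervalIntegral.integral_add (intervalIntegrable_of_bounded (mH' m) (bH' m) _ _)
    (intervalIntegrable_of_bounded (mG' m) (bG' m) _ _), add_sub_add_comm]
  exact (norm_add_le _ _).trans (by linarith [h1 x, h2 x])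

theorem IsHarmonic.intervalClose_add {μ' : ℕ → Measure ℝ} {H' G' : ℕ → ℝ → ℂ}
    (hH : IsHarmonic μ H) (hG : IsHarmonic μ G) (hH' : IsHarmonic μ' H') (hG' : IsHarmonic μ' G')
    (h : IntervalClose H H') (g : IntervalClose G G') :
    IntervalClose (fun n t => H n t + G n t) fun n t => H' n t + G' n t := by
  obtain ⟨C₁, h₁⟩ := hH.bounded
  obtain ⟨C₂, h₂⟩ := hG.bounded
  obtain ⟨C₃, h₃⟩ := hH'.bounded
  obtain ⟨C₄, h₄⟩ := hG'.bounded
  exact h.add g (C := max (max C₁ C₂) (max C₃ C₄)) hH.measurable hH'.measurable hG.measurable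
    hG'.measurable (fun n t => (h₁ n t).trans (by simp)) (fun n t => (h₃ n t).trans (by simp))
    (fun n t => (h₂ n t).trans (by simp)) fun n t => (h₄ n t).trans (by simp)

theorem IntervalClose.const_mul {H' : ℕ → ℝ → ℂ} (h : IntervalClose H H') (c : ℂ) :
    IntervalClose (fun n t => c * H n t) fun n t => c * H' n t := fun ℓ ε hε => by
  filter_upwards [h ℓ (ε / (‖c‖ + 1)) (by positivity)] with m h1 x
  simp only [incr, intervalIntegral.integral_const_mul] at h1 ⊢
  rw [← mul_sub, norm_mul]
  calc _ ≤ (‖c‖ + 1) * (ε / (‖c‖ + 1)) :=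
        mul_le_mul (by linarith) (h1 x) (norm_nonneg _) (by positivity)
    _ = ε := by field_simp

theorem IntervalClose.translate {H' : ℕ → ℝ → ℂ} (h : IntervalClose H H') (s : ℝ) :
    IntervalClose (fun n t => H n (t + s)) fun n t => H' n (t + s) := fun ℓ ε hε => by
  filter_upwards [h ℓ ε hε] with m h1 x
  have := h1 (x + s)
  simpa only [incr, intervalIntegral.integral_comp_add_right, add_right_comm] using this

end Operations

/-! ### Tail boundary flows of nearby sequences -/

section Nearby

variable (μ μ' : ℕ → Measure ℝ) [∀ n, IsProbabilityMeasure (μ n)]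
  [∀ n, IsProbabilityMeasure (μ' n)]

/-- Boundary functions of asymptotically equal harmonic sequences. -/
def BoundaryCorrespondence (F : (ℝ × (ℕ → ℝ)) →ₘ[pathMeasure μ 0] ℂ)
    (F' : (ℝ × (ℕ → ℝ)) →ₘ[pathMeasure μ' 0] ℂ) : Prop :=
  F ∈ tailBoundary μ ∧ F' ∈ tailBoundary μ' ∧ ∃ H H', IsHarmonic μ H ∧ IsHarmonic μ' H' ∧
    HasBoundaryLimit μ H F ∧ HasBoundaryLimit μ' H' F' ∧ IntervalClose H H'

/-- To find a partner, extend harmonically, perturb, and take the boundary value; closeness of the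
laws is symmetric, so this works in both directions. Products are not visible in interval integrals
and are recovered from the order. -/
theorem positiveCorrespondence_of_blClose {ε : ℕ → ℝ} (hε : Summable ε)
    (hμ : ∀ n, BLClose (μ n) (μ' n) (ε n)) :
    PositiveCorrespondence (tailBoundary μ) (tailBoundary μ') (BoundaryCorrespondence μ μ') where
  mem_left h := h.1
  mem_right h := h.2.1
  bdd_left := tailBoundary_le_Linfty μ
  bdd_right := tailBoundary_le_Linfty μ'
  add := by
    rintro F G F' G' ⟨hF, hF', H, H', h1, h2, h3, h4, h5⟩ ⟨hG, hG', K, K', k1, k2, k3, k4, k5⟩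
    exact ⟨add_mem hF hG, add_mem hF' hG', _, _, h1.add k1, h2.add k2, h3.add k3, h4.add k4,
      h1.intervalClose_add k1 h2 k2 h5 k5⟩
  smul := by
    rintro c F F' ⟨hF, hF', H, H', h1, h2, h3, h4, h5⟩
    exact ⟨SMulMemClass.smul_mem c hF, SMulMemClass.smul_mem c hF', _, _, h1.const_mul c,
      h2.const_mul c, h3.const_mul c, h4.const_mul c, h5.const_mul c⟩
  one := ⟨one_mem _, one_mem _, _, _, isHarmonic_one μ, isHarmonic_one μ', hasBoundaryLimit_one μ,
    hasBoundaryLimit_one μ', fun ℓ ε hε => .of_forall fun m x => by simpa using hε.le⟩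
  left_total F hF := by
    obtain ⟨H, hH, hHF⟩ := exists_isHarmonic hF
    obtain ⟨H', hH', hHH'⟩ := hH.exists_intervalClose hε hμ
    obtain ⟨F', hF', hHF'⟩ := hH'.exists_boundary
    exact ⟨F', hF, hF', H, H', hH, hH', hHF, hHF', hHH'⟩
  right_total F' hF' := by
    obtain ⟨H', hH', hHF'⟩ := exists_isHarmonic hF'
    obtain ⟨H, hH, hHH'⟩ := hH'.exists_intervalClose hε fun n => (hμ n).symm
    obtain ⟨F, hF, hHF⟩ := hH.exists_boundary
    exact ⟨F, hF, hF', H, H', hH, hH', hHF, hHF', hHH'.symm⟩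
  nonneg_iff := by
    rintro F F' ⟨hF, hF', H, H', h1, h2, h3, h4, h5⟩
    rw [h3.aenonneg_iff h1, h4.aenonneg_iff h2]
    exact ⟨fun h => h5.ae_nonneg h1 h2 h, fun h => h5.symm.ae_nonneg h2 h1 h⟩

theorem actionsIsomorphic_tailBoundaryAct_of_blClose {ε : ℕ → ℝ} (hε : Summable ε)
    (hμ : ∀ n, BLClose (μ n) (μ' n) (ε n)) :
    ActionsIsomorphic (tailBoundaryAct μ) (tailBoundaryAct μ') := by
  refine (positiveCorrespondence_of_blClose μ μ' hε hμ).actionsIsomorphic ?_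
  rintro s F F' ⟨hF, hF', H, H', h1, h2, h3, h4, h5⟩
  exact ⟨(tailBoundaryAct μ s F).2, (tailBoundaryAct μ' s F').2, _, _, h1.translate (-s),
    h2.translate (-s), h3.translate (-s), h4.translate (-s), h5.translate (-s)⟩

/-- Elements of the tail boundary that are invariant under translations are constant. -/
theorem exists_eq_algebraMap_of_invariant {F : tailBoundary μ}
    (hF : ∀ s, tailBoundaryAct μ s F = F) : ∃ c : ℂ, F = algebraMap ℂ _ c := by
  obtain ⟨H, hH, hHF⟩ := exists_isHarmonic F.2
  have hconst : ∀ n, ∃ c, ∀ᵐ t, H n t = c := fun n =>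
    -- Uniqueness of the harmonic extension transfers the invariance of `F` to every `H n`.
    exists_ae_eq_const_of_translation_invariant (hH.measurable n) fun s => by
      refine HasBoundaryLimit.ae_eq_of_eq (hH.translate s) hH (F := F) ?_ hHF n
      have h1 := hHF.translate s
      have h2 := congrArg Subtype.val (hF (-s))
      simp only [tailBoundaryAct, neg_neg] at h2
      rwa [h2] at h1
  choose c hc using hconst
  refine ⟨limOrZero c, Subtype.ext (AEEqFun.ext ?_)⟩
  have h1 : ∀ᵐ x ∂pathMeasure μ 0, ∀ n, H n (pathMap n x).1 = c n := ae_all_iff.2 fun n =>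
    (measurePreserving_pathMap_fst μ 0 n).quasiMeasurePreserving.ae (hc n)
  filter_upwards [hHF, h1, coeFn_algebraMap (m := pathMeasure μ 0) (limOrZero c)] with x h1 h2 h3
  simp only [h2] at h1
  rw [limOrZero_eq h1] at h3 ⊢
  exact h3.symm

/-- The indicator of an invariant set is an invariant element, which the isomorphism sends to a
scalar; so the indicator is almost everywhere constant. -/
theorem IsTailBoundaryFlow.isErgodic {α : NSFlow.{u}} (h : IsTailBoundaryFlow α μ) :
    α.IsErgodic := by
  obtain ⟨φ, hφ⟩ := h
  intro E hE hinv
  have hm : Measurable (E.indicator fun _ => (1 : ℂ)) := measurable_const.indicator hE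
  have hmem := mk_mem_Linfty (m := α.meas) hm (C := 1) (ae_of_all _ fun x => by
    by_cases hx : x ∈ E <;> simp [hx])
  set F : Linfty α.meas := ⟨_, hmem⟩
  have hFinv : ∀ s, α.LinftyAct s F = F := fun s => by
    refine Subtype.ext (AEEqFun.ext ?_)
    have h1 := AEEqFun.coeFn_mk (μ := α.meas) _ hm.aestronglyMeasurable
    filter_upwards [coeFn_pullback (α.act (-s)) (α.quasiMeasurePreserving (-s)) F.1, h1,
      (α.quasiMeasurePreserving (-s)).ae h1, (hinv (-s)).mem_iff] with x h2 h3 h4 h5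
    refine h2.trans ?_
    simp only [F, Function.comp_apply]
    rw [h3, h4]
    by_cases hx : x ∈ E
    · rw [Set.indicator_of_mem hx, Set.indicator_of_mem (s := E) (h5.2 hx)]
    · rw [Set.indicator_of_notMem hx, Set.indicator_of_notMem (s := E) fun h => hx (h5.1 h)]
  obtain ⟨c, hc⟩ := exists_eq_algebraMap_of_invariant μ (F := φ F) fun s => by
    rw [← hφ, hFinv]
  have hF : F = algebraMap ℂ _ c := by
    refine φ.injective ?_
    change φ F = φ (algebraMap ℂ _ c)
    rw [hc, Algebra.algebraMap_eq_smul_one, Algebra.algebraMap_eq_smul_one, map_smul, map_one]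
  have h1 : ∀ᵐ x ∂α.meas, E.indicator (fun _ => (1 : ℂ)) x = c := by
    have h2 := congrArg Subtype.val hF
    filter_upwards [AEEqFun.coeFn_mk (μ := α.meas) _ hm.aestronglyMeasurable,
      coeFn_algebraMap (m := α.meas) c] with x h3 h4
    rw [← h3, ← h4]
    exact congrFun (congrArg _ h2) x
  by_cases h : c = 1
  · right
    refine measure_mono_null ?_ (ae_iff.1 h1)
    intro x hx
    rw [Set.mem_compl_iff] at hx
    simp [hx, h]
  · left
    refine measure_mono_null ?_ (ae_iff.1 h1)
    intro x hx
    simp [hx, Ne.symm h]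

/-- Tail boundary flows of infinitely divisible distributions are Poisson flows. -/
theorem IsTailBoundaryFlow.isPoisson {α : NSFlow.{u}} (h : IsTailBoundaryFlow α μ)
    (hμ : ∀ n, IsInfinitelyDivisibleDistribution (μ n)) : α.IsPoisson := by
  refine ⟨h.isErgodic μ, ?_⟩
  -- Any summable sequence of errors would do.
  choose ρ hρ hclose using fun n : ℕ =>
    (hμ n).exists_blClose (ε := (1 / 2 : ℝ) ^ n) (by positivity)
  exact ⟨ρ, hρ, ActionsIsomorphic.trans h
    (actionsIsomorphic_tailBoundaryAct_of_blClose μ _ summable_geometric_two hclose)⟩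

end Nearby

/-! ### Sums of independent paths -/

section FinitePowers

theorem pi_absolutelyContinuous : ∀ {n : ℕ} {Z : Type*} [MeasurableSpace Z]
    {η η' : Measure Z} [SigmaFinite η] [SigmaFinite η'] (_ : η ≪ η'),
    (Measure.pi fun _ : Fin n => η) ≪ Measure.pi fun _ : Fin n => η' := by
  intro n
  induction n with
  | zero =>
    intro Z _ η η' _ _ _
    rw [Measure.pi_of_empty, Measure.pi_of_empty]
  | succ n ih =>
    intro Z _ η η' _ _ h
    have e := (measurePreserving_piFinSuccAbove (fun _ : Fin (n + 1) => η) 0).symm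
    have e' := (measurePreserving_piFinSuccAbove (fun _ : Fin (n + 1) => η') 0).symm
    rw [← e.map_eq, ← e'.map_eq]
    exact (h.prod (ih h)).map e.measurable

theorem measurePreserving_sum_pi (ν : Measure ℝ) [IsProbabilityMeasure ν] (L : ℕ) :
    MeasurePreserving (fun x : Fin L → ℝ => ∑ i, x i) (Measure.pi fun _ => ν) (convPow ν L) := by
  induction L with
  | zero =>
    refine ⟨by fun_prop, ?_⟩
    rw [Measure.pi_of_empty]
    exact (Measure.map_dirac' (f := fun x : Fin 0 → ℝ => ∑ i, x i) (by fun_prop) _).trans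
      (by simp [convPow])
  | succ L ih =>
    have e := measurePreserving_piFinSuccAbove (fun _ : Fin (L + 1) => ν) (Fin.last L)
    have h := (MeasurePreserving.id ν).prod ih
    have hadd : MeasurePreserving (fun p : ℝ × ℝ => p.1 + p.2) ((convPow ν L).prod ν)
        (convPow ν (L + 1)) := ⟨by fun_prop, rfl⟩
    have := (hadd.comp measurePreserving_swap).comp (h.comp e)
    convert this using 1
    funext x
    simp [Fin.sum_univ_castSucc, MeasurableEquiv.piFinSuccAbove, Fin.init]

theorem convPow_gaussianReal (L : ℕ) :
    convPow (ProbabilityTheory.gaussianReal 0 1) L = ProbabilityTheory.gaussianReal 0 L := by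
  induction L with
  | zero => simp [convPow]
  | succ L ih =>
    rw [convPow, ih, ProbabilityTheory.gaussianReal_conv_gaussianReal]
    simp

variable {μ μ' : ℕ → Measure ℝ} [∀ n, IsProbabilityMeasure (μ n)]
  [∀ n, IsProbabilityMeasure (μ' n)] {L : ℕ}

/-- View the `L` sequences as a double array and exchange the order of its indices: the entries at
time `k` are `L` independent samples of `μ' (n + k)`, whose sum has the law `μ (n + k)`. -/
theorem measurePreserving_sum_tailProb (h : ∀ n, convPow (μ' n) L = μ n) (n : ℕ) :
    MeasurePreserving (fun w : Fin L → ℕ → ℝ => ∑ i, w i) (Measure.pi fun _ => tailProb μ' n)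
      (tailProb μ n) := by
  refine ⟨by fun_prop, ?_⟩
  have h1 := infinitePi_map_curry_symm fun (_ : Fin L) (k : ℕ) => μ' (n + k)
  have h2 := infinitePi_map_piCongrLeft (X := fun _ : ℕ × Fin L => ℝ)
    (fun p : ℕ × Fin L => μ' (n + p.1)) (Equiv.prodComm (Fin L) ℕ)
  have h3 := infinitePi_map_curry fun (k : ℕ) (_ : Fin L) => μ' (n + k)
  have h4 := infinitePi_map_pi (fun k : ℕ => infinitePi fun _ : Fin L => μ' (n + k))
    (f := fun _ (x : Fin L → ℝ) => ∑ i, x i) fun _ => by fun_prop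
  have h5 : ∀ k, (infinitePi fun _ : Fin L => μ' (n + k)).map (fun x : Fin L → ℝ => ∑ i, x i) =
      μ (n + k) := fun k => by
    rw [infinitePi_eq_pi, (measurePreserving_sum_pi _ L).map_eq, h]
  simp only [h5] at h4
  change Measure.map _ (Measure.pi fun _ => infinitePi fun k => μ' (n + k)) =
    infinitePi fun k => μ (n + k)
  rw [← infinitePi_eq_pi, ← h4, ← h3, ← h2]
  simp only [Equiv.prodComm_apply, Prod.fst_swap]
  rw [← h1, Measure.map_map, Measure.map_map, Measure.map_map]
  · congr 1
    funext w k
    simp [MeasurableEquiv.curry, MeasurableEquiv.piCongrLeft, Equiv.piCongrLeft]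
  all_goals fun_prop

theorem measurePreserving_sum_pathProb (h : ∀ n, convPow (μ' n) L = μ n) (n : ℕ) :
    MeasurePreserving (fun x : Fin L → ℝ × (ℕ → ℝ) => ∑ i, x i)
      (Measure.pi fun _ => pathProb μ' n)
      ((ProbabilityTheory.gaussianReal 0 L).prod (tailProb μ n)) := by
  rw [← convPow_gaussianReal]
  have e := measurePreserving_arrowProdEquivProdArrow ℝ (ℕ → ℝ) (Fin L)
    (fun _ => ProbabilityTheory.gaussianReal 0 1) (fun _ => tailProb μ' n)
  have := ((measurePreserving_sum_pi (ProbabilityTheory.gaussianReal 0 1) L).prod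
    (measurePreserving_sum_tailProb h n)).comp e
  convert this using 1
  swap
  · rfl
  funext x
  refine Prod.ext ?_ ?_
  · simp [MeasurableEquiv.arrowProdEquivProdArrow, Equiv.arrowProdEquivProdArrow, Prod.fst_sum]
  · simp [MeasurableEquiv.arrowProdEquivProdArrow, Equiv.arrowProdEquivProdArrow, Prod.snd_sum]

/-- The starting points add up to a Gaussian of variance `L`, which is equivalent to Lebesgue
measure because `L ≥ 1`. Addition of paths therefore both preserves and reflects null sets. -/
theorem ae_sum_iff (hL : 1 ≤ L) (h : ∀ n, convPow (μ' n) L = μ n) {p : ℝ × (ℕ → ℝ) → Prop}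
    (hp : MeasurableSet {x | p x}) :
    (∀ᵐ x ∂Measure.pi fun _ : Fin L => pathProb μ' 0, p (∑ i, x i)) ↔
      ∀ᵐ y ∂pathMeasure μ 0, p y := by
  have hL0 : (L : NNReal) ≠ 0 := by simpa using Nat.one_le_iff_ne_zero.1 hL
  have hs := measurePreserving_sum_pathProb h 0
  have : ae (pathMeasure μ 0) =
      ae ((ProbabilityTheory.gaussianReal 0 L).prod (tailProb μ 0)) :=
    le_antisymm
      ((ProbabilityTheory.gaussianReal_absolutelyContinuous' 0 hL0).prod AbsolutelyContinuous.rfl).ae_le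
      ((ProbabilityTheory.gaussianReal_absolutelyContinuous 0 hL0).prod AbsolutelyContinuous.rfl).ae_le
  rw [this, ← hs.map_eq]
  exact (ae_map_iff hs.measurable.aemeasurable hp).symm

theorem quasiMeasurePreserving_sum (hL : 1 ≤ L) (h : ∀ n, convPow (μ' n) L = μ n) :
    QuasiMeasurePreserving (fun x : Fin L → ℝ × (ℕ → ℝ) => ∑ i, x i)
      (Measure.pi fun _ : Fin L => pathProb μ' 0) (pathMeasure μ 0) := by
  refine ⟨by fun_prop, AbsolutelyContinuous.mk fun s hs h0 => ?_⟩
  rw [Measure.map_apply (by fun_prop) hs]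
  have := (ae_sum_iff hL h (p := fun x => x ∉ s) hs.compl).2 (measure_eq_zero_iff_ae_notMem.1 h0)
  exact measure_eq_zero_iff_ae_notMem.2 this

theorem pathMap_sum (n : ℕ) (x : Fin L → ℝ × (ℕ → ℝ)) :
    pathMap n (∑ i, x i) = ∑ i, pathMap n (x i) := by
  refine Prod.ext ?_ (funext fun k => ?_)
  · simp only [pathMap, Prod.fst_sum, Prod.snd_sum, Finset.sum_apply, Finset.sum_add_distrib]
    rw [Finset.sum_comm]
  · simp [pathMap, Prod.snd_sum]

variable (μ') in
theorem ae_pi_pathProb (n : ℕ) : ae (Measure.pi fun _ : Fin L => pathProb μ' n) =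
    ae (Measure.pi fun _ : Fin L => pathMeasure μ' n) :=
  le_antisymm (pi_absolutelyContinuous (pathProb_absolutelyContinuous μ' n)).ae_le
    (pi_absolutelyContinuous (pathMeasure_absolutelyContinuous μ' n)).ae_le

variable (μ') in
theorem ae_pi_pathMap_iff (n : ℕ) {p : (Fin L → ℝ × (ℕ → ℝ)) → Prop}
    (hp : MeasurableSet {x | p x}) :
    (∀ᵐ x ∂Measure.pi fun _ : Fin L => pathProb μ' 0, p fun i => pathMap n (x i)) ↔
      ∀ᵐ y ∂Measure.pi fun _ : Fin L => pathProb μ' n, p y := by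
  have h : MeasurePreserving (fun (x : Fin L → ℝ × (ℕ → ℝ)) i => pathMap n (x i))
      (Measure.pi fun _ : Fin L => pathMeasure μ' 0)
      (Measure.pi fun _ : Fin L => pathMeasure μ' n) :=
    measurePreserving_pi _ _ fun _ => measurePreserving_pathMap_zero μ' n
  rw [ae_pi_pathProb, ae_pi_pathProb, ← h.map_eq]
  exact (ae_map_iff h.measurable.aemeasurable hp).symm

end FinitePowers

/-! ### Continuity of translations -/

section Continuity

theorem tendsto_integral_translate_sub {f : ℝ → ℝ} (hf : Integrable f) (s : ℝ) :
    Tendsto (fun t => ∫ r, |f (r + t) - f (r + s)|) (𝓝 s) (𝓝 0) := by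
  have : Fact ((1 : ℝ≥0∞) ≠ ∞) := ⟨ENNReal.one_ne_top⟩
  have hcont : Continuous fun t : ℝ =>
      (DomAddAct.mk t +ᵥ hf.toL1 f : Lp ℝ 1 (volume : Measure ℝ)) :=
    (DomAddAct.continuous_mk (M := ℝ)).vadd continuous_const
  have h1 := (hcont.tendsto s).dist tendsto_const_nhds (b := DomAddAct.mk s +ᵥ hf.toL1 f)
  rw [dist_self] at h1
  refine h1.congr fun t => ?_
  have hae : ∀ t : ℝ, ((DomAddAct.mk t +ᵥ hf.toL1 f : Lp ℝ 1 (volume : Measure ℝ)) : ℝ → ℝ)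
      =ᵐ[volume] fun r => f (r + t) := fun t => by
    filter_upwards [DomAddAct.vadd_Lp_ae_eq (DomAddAct.mk t) (hf.toL1 f),
      (measurePreserving_add_right volume t).quasiMeasurePreserving.ae hf.coeFn_toL1] with r h2 h3
    rw [h2, ← h3]
    simp [add_comm]
  rw [L1.dist_eq_integral_dist]
  refine integral_congr_ae ?_
  filter_upwards [hae t, hae s] with r h2 h3
  rw [h2, h3, Real.dist_eq]

/-- The translations of the first coordinate act continuously on absolutely continuous finite
measures. -/
theorem eventually_measureReal_translate_sub_le {Ω : Type*} [MeasurableSpace Ω] {Q : Measure Ω}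
    [IsProbabilityMeasure Q] {κ : Measure (ℝ × Ω)} [IsFiniteMeasure κ]
    (hκ : κ ≪ (volume : Measure ℝ).prod Q) (s : ℝ) {ε : ℝ} (hε : 0 < ε) :
    ∀ᶠ t in 𝓝 s, ∀ B : Set (ℝ × Ω), MeasurableSet B →
      |κ.real ((fun x => (x.1 + t, x.2)) ⁻¹' B) - κ.real ((fun x => (x.1 + s, x.2)) ⁻¹' B)| ≤ ε := by
  set m := (volume : Measure ℝ).prod Q
  set g : ℝ × Ω → ℝ := fun x => (κ.rnDeriv m x).toReal
  have hg : Measurable g := (measurable_rnDeriv κ m).ennreal_toReal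
  have hgi : Integrable g m := integrable_toReal_rnDeriv
  have hτ : ∀ t : ℝ, MeasurePreserving (fun x : ℝ × Ω => (x.1 + t, x.2)) m m := fun t =>
    (measurePreserving_add_right volume t).prod (MeasurePreserving.id Q)
  have hgt : ∀ t : ℝ, Integrable (fun x : ℝ × Ω => g (x.1 + t, x.2)) m := fun t =>
    (hτ t).integrable_comp_of_integrable hgi
  -- The translation is moved from the set to the density, so the difference is bounded by the `L¹`
  -- distance of two translated densities, uniformly in `B`.
  have hreal : ∀ (t : ℝ) (B : Set (ℝ × Ω)), MeasurableSet B →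
      κ.real ((fun x => (x.1 + t, x.2)) ⁻¹' B) = ∫ x in B, g (x.1 + -t, x.2) ∂m := by
    intro t B hB
    rw [← setIntegral_toReal_rnDeriv hκ, ← integral_indicator ((hτ t).measurable hB),
      ← integral_indicator hB]
    conv_rhs => rw [← (hτ t).map_eq]
    have hm : Measurable (B.indicator fun x : ℝ × Ω => g (x.1 + -t, x.2)) :=
      Measurable.indicator (by fun_prop) hB
    rw [integral_map (hτ t).measurable.aemeasurable hm.aestronglyMeasurable]
    refine integral_congr_ae (ae_of_all _ fun x => ?_)
    by_cases hx : (x.1 + t, x.2) ∈ B <;> simp [Set.indicator, hx, g]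
  -- For almost every `ω` the slice converges by continuity of translations in `L¹(ℝ)`, with twice
  -- the norm of the slice as dominating function.
  have hlim : Tendsto (fun t => ∫ x, |g (x.1 + t, x.2) - g (x.1 + -s, x.2)| ∂m) (𝓝 (-s))
      (𝓝 0) := by
    have h1 : ∀ t, ∫ x, |g (x.1 + t, x.2) - g (x.1 + -s, x.2)| ∂m =
        ∫ ω, (∫ r, |g (r + t, ω) - g (r + -s, ω)|) ∂Q := fun t =>
      integral_prod_symm _ ((hgt t).sub (hgt (-s))).abs
    simp only [h1]
    rw [← integral_zero Ω ℝ (μ := Q)]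
    have hslice : ∀ᵐ ω ∂Q, Integrable fun r => g (r, ω) := hgi.prod_left_ae
    refine tendsto_integral_filter_of_dominated_convergence
      (fun ω => 2 * ∫ r, |g (r, ω)|) (.of_forall fun t => ?_) (.of_forall fun t => ?_)
      (hgi.abs.integral_prod_right.const_mul 2) ?_
    · exact StronglyMeasurable.aestronglyMeasurable (StronglyMeasurable.integral_prod_left'
        (f := fun x : ℝ × Ω => |g (x.1 + t, x.2) - g (x.1 + -s, x.2)|)
        (Measurable.stronglyMeasurable (by fun_prop)))
    · filter_upwards [hslice] with ω hω
      rw [Real.norm_of_nonneg (integral_nonneg fun r => abs_nonneg _)]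
      have e : ∀ t : ℝ, ∫ r, |g (r + t, ω)| = ∫ r, |g (r, ω)| := fun t =>
        integral_add_right_eq_self (fun r => |g (r, ω)|) t
      have i : ∀ t : ℝ, Integrable fun r => |g (r + t, ω)| := fun t =>
        (hω.comp_add_right t).abs
      calc _ ≤ ∫ r, (|g (r + t, ω)| + |g (r + -s, ω)|) :=
            integral_mono (((hω.comp_add_right t).sub (hω.comp_add_right (-s))).abs)
              ((i t).add (i (-s))) fun r => abs_sub _ _
        _ = _ := by rw [integral_add (i t) (i (-s)), e, e, two_mul]
    · filter_upwards [hslice] with ω hω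
      exact tendsto_integral_translate_sub hω (-s)
  have hneg : Tendsto (fun t : ℝ => -t) (𝓝 s) (𝓝 (-s)) := continuous_neg.tendsto s
  filter_upwards [(hlim.comp hneg).eventually (gt_mem_nhds hε)] with t ht B hB
  rw [hreal t B hB, hreal s B hB, ← integral_sub (hgt _).integrableOn (hgt _).integrableOn]
  refine (abs_integral_le_integral_abs).trans (le_trans ?_ ht.le)
  exact setIntegral_le_integral ((hgt _).sub (hgt _)).abs (ae_of_all _ fun x => abs_nonneg _)

end Continuity

/-! ### Point realizations of tail boundaries -/

section Realization

/-- `L¹` of a finite measure on a countably generated space is separable, so the image of `S` has a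
dense sequence, and `L¹` convergent sequences have almost everywhere convergent subsequences. -/
theorem exists_ae_dense_seq {X : Type*} [MeasurableSpace X] [MeasurableSpace.CountablyGenerated X]
    {P : Measure X} [IsFiniteMeasure P] {S : Set (X → ℂ)} (hne : S.Nonempty)
    (hS : ∀ f ∈ S, Integrable f P) : ∃ G : ℕ → X → ℂ, (∀ i, G i ∈ S) ∧ ∀ f ∈ S, ∃ φ : ℕ → ℕ,
      ∀ᵐ x ∂P, Tendsto (fun k => G (φ k) x) atTop (𝓝 (f x)) := by
  have : Fact ((1 : ℝ≥0∞) ≠ ∞) := ⟨ENNReal.one_ne_top⟩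
  set T : S → Lp ℂ 1 P := fun f => (hS f f.2).toL1
  have : Nonempty S := hne.to_subtype
  have : Nonempty (Set.range T) := (Set.range_nonempty T).to_subtype
  have hG : ∀ i, ∃ f : S, T f = (TopologicalSpace.denseSeq (Set.range T) i : Lp ℂ 1 P) := fun i =>
    (TopologicalSpace.denseSeq (Set.range T) i).2
  choose G hG using hG
  refine ⟨fun i => G i, fun i => (G i).2, fun f hf => ?_⟩
  have h1 : ∀ n : ℕ, ∃ i, dist (T ⟨f, hf⟩) (T (G i)) < 1 / (n + 1 : ℝ) := fun n => by
    obtain ⟨i, hi⟩ := (TopologicalSpace.denseRange_denseSeq (Set.range T)).exists_dist_lt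
      (⟨T ⟨f, hf⟩, Set.mem_range_self _⟩ : Set.range T) (ε := 1 / (n + 1 : ℝ)) (by positivity)
    exact ⟨i, by rwa [hG]⟩
  choose φ hφ using h1
  have h2 : Tendsto (fun n => T (G (φ n))) atTop (𝓝 (T ⟨f, hf⟩)) := by
    rw [tendsto_iff_dist_tendsto_zero]
    refine squeeze_zero (fun _ => dist_nonneg) (fun n => ?_) tendsto_one_div_add_atTop_nhds_zero_nat
    rw [dist_comm]
    exact (hφ n).le
  obtain ⟨ns, -, hns⟩ := (tendstoInMeasure_of_tendsto_Lp h2).exists_seq_tendsto_ae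
  refine ⟨fun k => φ (ns k), ?_⟩
  filter_upwards [hns, (hS f hf).coeFn_toL1, ae_all_iff.2 fun i => (hS _ (G i).2).coeFn_toL1]
    with x h3 h4 h5
  rw [← h4]
  exact h3.congr fun k => h5 _

variable (μ : ℕ → Measure ℝ) [∀ n, IsProbabilityMeasure (μ n)]

/-- Bounded functions that represent elements of the tail boundary. -/
structure IsTailFunction (g : ℝ × (ℕ → ℝ) → ℂ) : Prop where
  measurable : Measurable g
  bounded : ∃ C : ℝ, ∀ x, ‖g x‖ ≤ C
  factor : ∀ n, ∃ g' : ℝ × (ℕ → ℝ) → ℂ, Measurable g' ∧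
    ∀ᵐ x ∂pathProb μ 0, g x = g' (pathMap n x)

theorem quasiMeasurePreserving_translate_pathProb (n : ℕ) (t : ℝ) :
    QuasiMeasurePreserving (fun p : ℝ × (ℕ → ℝ) => (p.1 + t, p.2)) (pathProb μ n)
      (pathProb μ n) :=
  (quasiMeasurePreserving_translate μ n t).mono (pathProb_absolutelyContinuous μ n)
    (pathMeasure_absolutelyContinuous μ n)

theorem exists_isTailFunction {F : (ℝ × (ℕ → ℝ)) →ₘ[pathMeasure μ 0] ℂ}
    (hF : F ∈ tailBoundary μ) : ∃ g, IsTailFunction μ g ∧ F =ᵐ[pathMeasure μ 0] g := by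
  obtain ⟨C, g, hC0, hg, hgC, hFg⟩ := exists_of_mem_tailBoundary μ hF
  have h0 : F =ᵐ[pathMeasure μ 0] g 0 := by
    filter_upwards [hFg 0] with x hx
    rw [hx, Function.comp_apply, pathMap_zero]
  refine ⟨g 0, ⟨hg 0, ⟨C, hgC 0⟩, fun n => ⟨g n, hg n, ?_⟩⟩, h0⟩
  rw [ae_pathProb]
  filter_upwards [h0, hFg n] with x h1 h2
  rw [← h1, h2, Function.comp_apply]

variable {μ} in
theorem IsTailFunction.translate {g : ℝ × (ℕ → ℝ) → ℂ} (hg : IsTailFunction μ g) (t : ℝ) :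
    IsTailFunction μ fun x => g (x.1 + t, x.2) := by
  obtain ⟨C, hC⟩ := hg.bounded
  refine ⟨hg.measurable.comp (by fun_prop), ⟨C, fun x => hC _⟩, fun n => ?_⟩
  obtain ⟨g', hg', h⟩ := hg.factor n
  refine ⟨fun x => g' (x.1 + t, x.2), hg'.comp (by fun_prop), ?_⟩
  filter_upwards [(quasiMeasurePreserving_translate_pathProb μ 0 t).ae h] with x hx
  rw [hx]
  simp only [pathMap, add_right_comm]

/-- The flow `β` together with the map `q` realizes the tail boundary flow of `μ` on points. -/
structure IsBoundaryRealization (β : NSFlow.{0}) (q : ℝ × (ℕ → ℝ) → β.Space) : Prop where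
  measurePreserving : MeasurePreserving q (pathProb μ 0) β.meas
  equivariant : ∀ t : ℝ, ∀ᵐ x ∂pathProb μ 0, q (x.1 + t, x.2) = β.act t (q x)
  factor : ∀ n, ∃ q' : ℝ × (ℕ → ℝ) → β.Space, Measurable q' ∧
    ∀ᵐ x ∂pathProb μ 0, q x = q' (pathMap n x)
  exists_comp : ∀ g, IsTailFunction μ g → ∃ f : β.Space → ℂ, Measurable f ∧
    ∀ᵐ x ∂pathProb μ 0, g x = f (q x)

/-- The map `q` lists a countable `L¹`-dense family of tail functions, and `β` lives on the image
measure. Every tail function is an almost everywhere limit of coordinates of `q`, hence a function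
of `q`. -/
theorem exists_isBoundaryRealization : ∃ β q, IsBoundaryRealization μ β q := by
  obtain ⟨G, hGS, hG⟩ := exists_ae_dense_seq (P := pathProb μ 0) (S := {g | IsTailFunction μ g})
    ⟨fun _ => 0, measurable_const, ⟨0, fun _ => by simp⟩,
      fun n => ⟨fun _ => 0, measurable_const, ae_of_all _ fun _ => rfl⟩⟩ fun g hg => by
    obtain ⟨C, hC⟩ := hg.bounded
    exact (integrable_const C).mono' hg.measurable.aestronglyMeasurable (ae_of_all _ hC)
  have hGS : ∀ i, IsTailFunction μ (G i) := hGS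
  set q : ℝ × (ℕ → ℝ) → ℕ → ℂ := fun x i => G i x
  have hq : Measurable q := measurable_pi_iff.2 fun i => (hGS i).measurable
  have hcomp : ∀ g, IsTailFunction μ g → ∃ f : (ℕ → ℂ) → ℂ, Measurable f ∧
      ∀ᵐ x ∂pathProb μ 0, g x = f (q x) := fun g hg => by
    obtain ⟨φ, hφ⟩ := hG g hg
    refine ⟨fun z => limOrZero fun k => z (φ k), measurable_limOrZero fun k => by fun_prop, ?_⟩
    filter_upwards [hφ] with x hx
    exact (limOrZero_eq hx).symm
  -- Translates of tail functions are tail functions, so each translated coordinate is again a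
  -- function of `q`; these functions define the action.
  choose a ha haq using fun (t : ℝ) (i : ℕ) => hcomp _ ((hGS i).translate t)
  set act : ℝ → (ℕ → ℂ) → ℕ → ℂ := fun t z i => a t i z
  have hact : ∀ t, Measurable (act t) := fun t => measurable_pi_iff.2 fun i => ha t i
  have hequiv : ∀ t : ℝ, ∀ᵐ x ∂pathProb μ 0, q (x.1 + t, x.2) = act t (q x) := fun t => by
    filter_upwards [ae_all_iff.2 (haq t)] with x hx
    exact funext hx
  have hmp : MeasurePreserving q (pathProb μ 0) ((pathProb μ 0).map q) := ⟨hq, rfl⟩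
  have := isProbabilityMeasure_map (μ := pathProb μ 0) hq.aemeasurable
  have hτ := quasiMeasurePreserving_translate_pathProb μ 0
  have hae : ∀ {p : (ℕ → ℂ) → Prop}, MeasurableSet {z | p z} →
      (∀ᵐ x ∂pathProb μ 0, p (q x)) → ∀ᵐ z ∂(pathProb μ 0).map q, p z := fun hp h =>
    (ae_map_iff hq.aemeasurable hp).2 h
  refine ⟨{ Space := ℕ → ℂ
            meas := (pathProb μ 0).map q
            act := act
            quasiMeasurePreserving := fun t => ⟨hact t, AbsolutelyContinuous.mk fun E hE h0 => ?_⟩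
            act_zero := ?_
            act_add := fun s t => ?_
            continuous_act := fun ν _ hν s ε hε => ?_ }, q, hmp, hequiv, fun n => ?_, hcomp⟩
  · rw [Measure.map_apply (hact t) hE, Measure.map_apply hq (hact t hE)]
    rw [Measure.map_apply hq hE] at h0
    have h1 := (hτ t).preimage_null h0
    rw [← h1]
    refine measure_congr (eventuallyEq_set.2 ?_)
    filter_upwards [hequiv t] with x hx
    simp only [Set.mem_preimage, hx]
  · refine hae (measurableSet_eq_fun (hact 0) measurable_id) ?_
    filter_upwards [hequiv 0] with x hx
    rw [← hx]
    simp
  · refine hae (measurableSet_eq_fun (hact _) ((hact s).comp (hact t))) ?_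
    filter_upwards [hequiv (s + t), hequiv t, (hτ t).ae (hequiv s)] with x h1 h2 h3
    rw [← h1, Function.comp_apply, ← h2, ← h3]
    simp [add_assoc, add_comm t]
  -- The measure `ν` is lifted to path space with density `dν / d(q_* P) ∘ q`, where the action is a
  -- translation and acts continuously.
  · set κ : Measure (ℝ × (ℕ → ℝ)) := (pathProb μ 0).withDensity
      fun x => ν.rnDeriv ((pathProb μ 0).map q) (q x)
    have hκν : κ.map q = ν := by
      refine Measure.ext fun E hE => ?_
      rw [Measure.map_apply hq hE, withDensity_apply _ (hq hE),
        ← setLIntegral_map hE (measurable_rnDeriv ν _) hq, setLIntegral_rnDeriv hν]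
    have hκ : κ ≪ pathMeasure μ 0 :=
      (withDensity_absolutelyContinuous _ _).trans (pathProb_absolutelyContinuous μ 0)
    have : IsFiniteMeasure κ := by
      refine ⟨?_⟩
      rw [← Set.preimage_univ (f := q), ← Measure.map_apply hq .univ, hκν]
      exact measure_lt_top ν _
    have hval : ∀ (t : ℝ) (E : Set (ℕ → ℂ)), MeasurableSet E → ν.real (act t ⁻¹' E) =
        κ.real ((fun x => (x.1 + t, x.2)) ⁻¹' (q ⁻¹' E)) := fun t E hE => by
      rw [← hκν, map_measureReal_apply hq (hact t hE)]
      refine measureReal_congr (eventuallyEq_set.2 ?_)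
      filter_upwards [(withDensity_absolutelyContinuous (pathProb μ 0) _).ae_le (hequiv t)]
        with x hx
      simp only [Set.mem_preimage, hx]
    filter_upwards [eventually_measureReal_translate_sub_le hκ s hε] with t ht E hE
    rw [hval t E hE, hval s E hE]
    exact ht _ (hq hE)
  · choose g' hg' h using fun i => (hGS i).factor n
    refine ⟨fun x i => g' i x, measurable_pi_iff.2 hg', ?_⟩
    filter_upwards [ae_all_iff.2 h] with x hx
    exact funext hx

end Realization

/-! ### Tail functions of several paths -/

section Slices

variable {μ : ℕ → Measure ℝ} [∀ n, IsProbabilityMeasure (μ n)] {β : NSFlow.{0}}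
  {q : ℝ × (ℕ → ℝ) → β.Space}

/-- A tail function is a function of `q`, hence equal to its conditional expectation given `q`. The
kernel gives one formula for all tail functions, jointly measurable when parameters are present;
choosing a factor separately for each function would not give this. -/
theorem IsBoundaryRealization.ae_eq_integral_condDistrib (h : IsBoundaryRealization μ β q)
    {g : ℝ × (ℕ → ℝ) → ℂ} (hg : IsTailFunction μ g) : ∀ᵐ x ∂pathProb μ 0,
      g x = ∫ x', g x' ∂ProbabilityTheory.condDistrib id q (pathProb μ 0) (q x) := by
  obtain ⟨f, hf, hfg⟩ := h.exists_comp g hg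
  obtain ⟨C, hC⟩ := hg.bounded
  have hq := h.measurePreserving.measurable
  have hi : Integrable g (pathProb μ 0) :=
    (integrable_const C).mono' hg.measurable.aestronglyMeasurable (ae_of_all _ hC)
  have h1 := ProbabilityTheory.condExp_ae_eq_integral_condDistrib_id hq hi
  have h2 := condExp_congr_ae (m := MeasurableSpace.comap q β.measurableSpace) hfg
  have h3 : (pathProb μ 0)[fun x => f (q x) | MeasurableSpace.comap q β.measurableSpace] =
      fun x => f (q x) :=
    condExp_of_stronglyMeasurable hq.comap_le
      (hf.comp (comap_measurable q)).stronglyMeasurable (hi.congr hfg)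
  rw [h3] at h2
  filter_upwards [h1, h2, hfg] with x e1 e2 e3
  rw [e3, ← e2, e1]

theorem IsBoundaryRealization.ae_prod_eq_integral_condDistrib (h : IsBoundaryRealization μ β q)
    {Y : Type*} [MeasurableSpace Y] {R : Measure Y} [SFinite R] {Ψ : (ℝ × (ℕ → ℝ)) × Y → ℂ}
    (hΨ : Measurable Ψ) (hR : ∀ᵐ y ∂(R : Measure Y), IsTailFunction μ fun x => Ψ (x, y)) :
    ∀ᵐ p ∂(pathProb μ 0).prod R,
      Ψ p = ∫ x', Ψ (x', p.2) ∂ProbabilityTheory.condDistrib id q (pathProb μ 0) (q p.1) := by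
  set K := ProbabilityTheory.condDistrib id q (pathProb μ 0)
  have hq := h.measurePreserving.measurable
  have hk : Measurable fun p : (ℝ × (ℕ → ℝ)) × Y => ∫ x', Ψ (x', p.2) ∂K (q p.1) :=
    (StronglyMeasurable.integral_kernel_prod_right
      (κ := K.comap (fun p : (ℝ × (ℕ → ℝ)) × Y => q p.1) (hq.comp measurable_fst))
      (f := fun p x' => Ψ (x', p.2))
      (Measurable.stronglyMeasurable (hΨ.comp (by fun_prop)))).measurable
  have hS : MeasurableSet {p : (ℝ × (ℕ → ℝ)) × Y | Ψ p = ∫ x', Ψ (x', p.2) ∂K (q p.1)} :=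
    measurableSet_eq_fun hΨ hk
  rw [Measure.ae_prod_iff_ae_ae hS]
  refine (ae_ae_comm (μ := R) (ν := pathProb μ 0)
    (p := fun y x => Ψ (x, y) = ∫ x', Ψ (x', y) ∂K (q x)) ?_).1 ?_
  · exact measurable_swap hS
  · filter_upwards [hR] with y hy
    exact h.ae_eq_integral_condDistrib hy

theorem measurePreserving_prod_left_comm {A B C : Type*} [MeasurableSpace A] [MeasurableSpace B]
    [MeasurableSpace C] (P : Measure A) (Q : Measure B) (R : Measure C) [SFinite P] [SFinite Q]
    [SFinite R] : MeasurePreserving (fun p : A × B × C => (p.2.1, p.1, p.2.2)) (P.prod (Q.prod R))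
      (Q.prod (P.prod R)) :=
  (measurePreserving_prodAssoc Q P R).comp ((measurePreserving_swap.prod
    (MeasurePreserving.id R)).comp (measurePreserving_prodAssoc P Q R).symm)

theorem measurePreserving_pi_cons {X : Type*} [MeasurableSpace X] (P : Measure X) [SigmaFinite P]
    (L : ℕ) : MeasurePreserving (fun p : X × (Fin L → X) => (Fin.cons p.1 p.2 : Fin (L + 1) → X))
      (P.prod (Measure.pi fun _ => P)) (Measure.pi fun _ => P) := by
  have := (measurePreserving_piFinSuccAbove (fun _ : Fin (L + 1) => P) 0).symm
  convert this using 1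
  funext p i
  refine Fin.cases ?_ (fun j => ?_) i <;> simp [MeasurableEquiv.piFinSuccAbove]

theorem measurePreserving_pi_head_tail {X : Type*} [MeasurableSpace X] (P : Measure X)
    [SigmaFinite P] (L : ℕ) : MeasurePreserving
      (fun x : Fin (L + 1) → X => (x 0, fun i : Fin L => x i.succ))
      (Measure.pi fun _ => P) (P.prod (Measure.pi fun _ => P)) := by
  have := measurePreserving_piFinSuccAbove (fun _ : Fin (L + 1) => P) 0
  convert this using 1
  funext x
  simp [MeasurableEquiv.piFinSuccAbove, Fin.tail, funext_iff]

/-- Induction on the number of paths, with an arbitrary parameter space `Y` so that a path can be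
moved into it. The induction hypothesis expresses all paths but the first through `q`; the
conditional distribution then does the same for the first. -/
theorem IsBoundaryRealization.exists_comp_pi (h : IsBoundaryRealization μ β q) (L : ℕ) :
    ∀ {Y : Type} [MeasurableSpace Y] (R : Measure Y) [SFinite R]
      {Φ : (Fin L → ℝ × (ℕ → ℝ)) × Y → ℂ} (_ : Measurable Φ) {C : ℝ} (_ : ∀ p, ‖Φ p‖ ≤ C)
      (_ : ∀ n, ∃ G : (Fin L → ℝ × (ℕ → ℝ)) × Y → ℂ, Measurable G ∧
        ∀ᵐ p ∂(Measure.pi fun _ => pathProb μ 0).prod R, Φ p = G (fun i => pathMap n (p.1 i), p.2)),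
      ∃ f : (Fin L → β.Space) × Y → ℂ, Measurable f ∧ (∀ p, ‖f p‖ ≤ C) ∧
        ∀ᵐ p ∂(Measure.pi fun _ => pathProb μ 0).prod R, Φ p = f (fun i => q (p.1 i), p.2) := by
  have hq := h.measurePreserving.measurable
  induction L with
  | zero =>
    intro Y _ R _ Φ hΦ C hC _
    refine ⟨fun p => Φ (fun i => i.elim0, p.2), hΦ.comp (by fun_prop), fun p => hC _,
      ae_of_all _ fun p => ?_⟩
    congr 1
    exact Prod.ext (Subsingleton.elim _ _) rfl
  | succ L ih =>
    intro Y _ R _ Φ hΦ C hC hfac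
    set P := pathProb μ 0
    set K := ProbabilityTheory.condDistrib id q P
    choose G hG hΦG using hfac
    have hcons : MeasurePreserving
        (fun p : (Fin L → ℝ × (ℕ → ℝ)) × (ℝ × (ℕ → ℝ)) × Y =>
          ((Fin.cons p.2.1 p.1 : Fin (L + 1) → ℝ × (ℕ → ℝ)), p.2.2))
        ((Measure.pi fun _ => P).prod (P.prod R)) ((Measure.pi fun _ => P).prod R) :=
      ((measurePreserving_pi_cons P L).prod (MeasurePreserving.id R)).comp
        ((measurePreserving_prodAssoc P (Measure.pi fun _ : Fin L => P) R).symm.comp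
          (measurePreserving_prod_left_comm _ P R))
    have hhead : MeasurePreserving
        (fun p : (Fin (L + 1) → ℝ × (ℕ → ℝ)) × Y => (p.1 0, (fun i : Fin L => p.1 i.succ), p.2))
        ((Measure.pi fun _ => P).prod R) (P.prod ((Measure.pi fun _ => P).prod R)) :=
      (measurePreserving_prodAssoc P (Measure.pi fun _ : Fin L => P) R).comp
        ((measurePreserving_pi_head_tail P L).prod (MeasurePreserving.id R))
    have hmap : ∀ n (x : ℝ × (ℕ → ℝ)) (x' : Fin L → ℝ × (ℕ → ℝ)),
        (fun i => pathMap n ((Fin.cons x x' : Fin (L + 1) → ℝ × (ℕ → ℝ)) i)) =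
          Fin.cons (pathMap n x) fun i => pathMap n (x' i) := fun n x x' => by
      funext i
      refine Fin.cases ?_ (fun j => ?_) i <;> simp
    have hmc : Measurable fun p : (ℝ × (ℕ → ℝ)) × (Fin L → ℝ × (ℕ → ℝ)) =>
        (Fin.cons p.1 p.2 : Fin (L + 1) → ℝ × (ℕ → ℝ)) :=
      (measurePreserving_pi_cons P L).measurable
    obtain ⟨f, hf, hfC, hΦf⟩ := ih (P.prod R)
      (Φ := fun p => Φ ((Fin.cons p.2.1 p.1 : Fin (L + 1) → ℝ × (ℕ → ℝ)), p.2.2))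
      (hΦ.comp hcons.measurable) (fun p => hC _) fun n =>
        ⟨fun p => G n ((Fin.cons (pathMap n p.2.1) p.1 : Fin (L + 1) → ℝ × (ℕ → ℝ)), p.2.2),
          (hG n).comp ((hmc.comp (((measurable_pathMap n).comp measurable_snd.fst).prodMk
            measurable_fst)).prodMk measurable_snd.snd), by
          filter_upwards [hcons.quasiMeasurePreserving.ae (hΦG n)] with p hp
          rw [hp, hmap]⟩
    have hB := measurePreserving_prod_left_comm P (Measure.pi fun _ : Fin L => P) R
    have hfq : Measurable fun p : (ℝ × (ℕ → ℝ)) × (Fin L → ℝ × (ℕ → ℝ)) × Y =>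
        f ((fun i => q (p.2.1 i)), p.1, p.2.2) := hf.comp (by fun_prop)
    -- For almost every choice of the other variables, the remaining function of the first path
    -- still factors through every `pathMap n`.
    have htail : ∀ᵐ y ∂(Measure.pi fun _ : Fin L => P).prod R,
        IsTailFunction μ fun x => f ((fun i => q (y.1 i)), x, y.2) := by
      have h1 : ∀ n, ∀ᵐ y ∂(Measure.pi fun _ : Fin L => P).prod R, ∀ᵐ x ∂P,
          f ((fun i => q (y.1 i)), x, y.2) =
            G n ((Fin.cons (pathMap n x) fun i => pathMap n (y.1 i) :
              Fin (L + 1) → ℝ × (ℕ → ℝ)), y.2) := fun n => by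
        have e : ∀ᵐ p ∂P.prod ((Measure.pi fun _ : Fin L => P).prod R),
            f ((fun i => q (p.2.1 i)), p.1, p.2.2) =
              G n ((Fin.cons (pathMap n p.1) fun i => pathMap n (p.2.1 i) :
                Fin (L + 1) → ℝ × (ℕ → ℝ)), p.2.2) := by
          filter_upwards [hB.quasiMeasurePreserving.ae hΦf,
            (hcons.comp hB).quasiMeasurePreserving.ae (hΦG n)] with p h1 h2
          rw [← h1, ← hmap]
          exact h2
        exact ae_ae_of_ae_prod (measurePreserving_swap.quasiMeasurePreserving.ae e)
      filter_upwards [ae_all_iff.2 h1] with y hy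
      refine ⟨hf.comp (by fun_prop), ⟨C, fun x => hfC _⟩, fun n =>
        ⟨fun x => G n ((Fin.cons x fun i => pathMap n (y.1 i) : Fin (L + 1) → ℝ × (ℕ → ℝ)), y.2),
          (hG n).comp ((hmc.comp measurable_prodMk_right).prodMk measurable_const), hy n⟩⟩
    have hint := h.ae_prod_eq_integral_condDistrib hfq htail
    -- Integrating the first path against its conditional distribution leaves only its `q`-value.
    refine ⟨fun p => ∫ x, f ((fun i => p.1 i.succ), x, p.2) ∂K (p.1 0), ?_, fun p => ?_, ?_⟩
    · exact (StronglyMeasurable.integral_kernel_prod_right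
        (κ := K.comap (fun p : (Fin (L + 1) → β.Space) × Y => p.1 0) (by fun_prop))
        (f := fun p x => f ((fun i => p.1 i.succ), x, p.2))
        (Measurable.stronglyMeasurable (hf.comp (by fun_prop)))).measurable
    · refine (norm_integral_le_of_norm_le_const (ae_of_all _ fun x => hfC _)).trans ?_
      simp
    · filter_upwards [hhead.quasiMeasurePreserving.ae hint,
        (hB.comp hhead).quasiMeasurePreserving.ae hΦf] with p h1 h2
      rw [← h1]
      refine Eq.trans ?_ h2
      refine congrArg Φ (Prod.ext (funext fun i => ?_) rfl)
      refine Fin.cases ?_ (fun j => ?_) i <;> simp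

end Slices

/-! ### Invariant tail functions of several paths -/

section Joint

variable {μ : ℕ → Measure ℝ} [∀ n, IsProbabilityMeasure (μ n)] {L : ℕ}

variable (μ) in
theorem measurePreserving_pi_pathConcat (n : ℕ) : MeasurePreserving
    (fun (p : (Fin L → ℝ × (ℕ → ℝ)) × (Fin L → ℕ → ℝ)) i => pathConcat n (p.1 i, p.2 i))
    ((Measure.pi fun _ => pathProb μ 0).prod (Measure.pi fun _ => tailProb μ n))
    (Measure.pi fun _ => pathProb μ 0) := by
  have h1 : MeasurePreserving
      (fun (x : Fin L → (ℝ × (ℕ → ℝ)) × (ℕ → ℝ)) i => pathConcat n (x i))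
      (Measure.pi fun _ => (pathProb μ 0).prod (tailProb μ n)) (Measure.pi fun _ => pathProb μ 0) :=
    measurePreserving_pi _ _ fun _ => measurePreserving_pathConcat_zero μ n
  exact h1.comp (measurePreserving_arrowProdEquivProdArrow (ℝ × (ℕ → ℝ)) (ℕ → ℝ) (Fin L)
    (fun _ => pathProb μ 0) (fun _ => tailProb μ n)).symm

variable (μ) in
theorem quasiMeasurePreserving_pi_translate (n : ℕ) (t : Fin L → ℝ) : QuasiMeasurePreserving
    (fun (x : Fin L → ℝ × (ℕ → ℝ)) i => ((x i).1 + t i, (x i).2))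
    (Measure.pi fun _ => pathProb μ n) (Measure.pi fun _ => pathProb μ n) :=
  quasiMeasurePreserving_pi _ (fun i (x : ℝ × (ℕ → ℝ)) => (x.1 + t i, x.2)) fun i =>
    quasiMeasurePreserving_translate_pathProb μ n (t i)

theorem ae_ae_of_ae_pi_pathProb {n : ℕ} {p : (Fin L → ℝ × (ℕ → ℝ)) → Prop}
    (h : ∀ᵐ x ∂Measure.pi fun _ => pathProb μ n, p x) :
    ∀ᵐ v : Fin L → ℝ, ∀ᵐ d ∂Measure.pi fun _ => tailProb μ n, p fun i => (v i, d i) := by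
  rw [ae_pi_pathProb] at h
  have e := (measurePreserving_arrowProdEquivProdArrow ℝ (ℕ → ℝ) (Fin L)
    (fun _ => (volume : Measure ℝ)) (fun _ => tailProb μ n)).symm
  rw [volume_pi]
  exact ae_ae_of_ae_prod (e.quasiMeasurePreserving.ae h)

/-- Functions of several paths that are measurable with respect to the tail and invariant under
translations with sum zero are boundary functions of the sum of the paths. -/
theorem exists_eq_boundaryLimit_sum (hL : 1 ≤ L) {Φ : (Fin L → ℝ × (ℕ → ℝ)) → ℂ}
    (hΦ : Measurable Φ) {C : ℝ} (hC : ∀ x, ‖Φ x‖ ≤ C)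
    (hfac : ∀ n, ∃ G : (Fin L → ℝ × (ℕ → ℝ)) → ℂ, Measurable G ∧
      ∀ᵐ x ∂Measure.pi fun _ => pathProb μ 0, Φ x = G fun i => pathMap n (x i))
    (hinv : ∀ t : Fin L → ℝ, ∑ i, t i = 0 → ∀ᵐ x ∂Measure.pi fun _ => pathProb μ 0,
      Φ (fun i => ((x i).1 + t i, (x i).2)) = Φ x) :
    ∃ h : ℕ → ℝ → ℂ, (∀ n, Measurable (h n)) ∧ (∀ n s, ‖h n s‖ ≤ C) ∧
      ∀ᵐ x ∂Measure.pi fun _ => pathProb μ 0, Φ x = boundaryLimit h 0 (∑ i, x i) := by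
  have hC0 : 0 ≤ C := (norm_nonneg _).trans (hC 0)
  have hfac' : ∀ n, ∃ G : (Fin L → ℝ × (ℕ → ℝ)) → ℂ, Measurable G ∧ (∀ x, ‖G x‖ ≤ C) ∧
      ∀ᵐ x ∂Measure.pi fun _ => pathProb μ 0, Φ x = G fun i => pathMap n (x i) := fun n => by
    obtain ⟨G, hG, hΦG⟩ := hfac n
    have h1 : ∀ᵐ y ∂Measure.pi fun _ : Fin L => pathProb μ n, ‖G y‖ ≤ C := by
      refine (ae_pi_pathMap_iff μ n (measurableSet_le hG.norm measurable_const)).1 ?_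
      filter_upwards [hΦG] with x hx
      rw [← hx]
      exact hC x
    obtain ⟨G', hG', hG'C, hGG'⟩ := exists_bounded_of_ae_le hG hC0 h1
    refine ⟨G', hG', hG'C, ?_⟩
    filter_upwards [hΦG, (ae_pi_pathMap_iff μ n (measurableSet_eq_fun hG hG')).2 hGG'] with x h2 h3
    rw [h2, h3]
  choose G hG hGC hΦG using hfac'
  have hGm : ∀ n, Measurable fun p : (Fin L → ℝ) × (Fin L → ℕ → ℝ) => G n fun i => (p.1 i, p.2 i) :=
    fun n => (hG n).comp (by fun_prop)
  -- The conditional expectation given the first `n` steps of all paths, as a function of the `L`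
  -- positions at time `n`.
  set H : ℕ → (Fin L → ℝ) → ℂ := fun n v =>
    ∫ d, G n (fun i => (v i, d i)) ∂Measure.pi fun _ => tailProb μ n
  have hHm : ∀ n, Measurable (H n) := fun n =>
    (hGm n).stronglyMeasurable.integral_prod_right'.measurable
  have hHC : ∀ n v, ‖H n v‖ ≤ C := fun n v => by
    refine (norm_integral_le_of_norm_le_const (ae_of_all _ fun d => hGC n _)).trans ?_
    simp
  have hHinv : ∀ n (t : Fin L → ℝ), ∑ i, t i = 0 → ∀ᵐ v, H n (v + t) = H n v := fun n t ht => by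
    have h1 : ∀ᵐ y ∂Measure.pi fun _ : Fin L => pathProb μ n,
        G n (fun i => ((y i).1 + t i, (y i).2)) = G n y := by
      refine (ae_pi_pathMap_iff μ n (measurableSet_eq_fun ((hG n).comp (by fun_prop)) (hG n))).1 ?_
      filter_upwards [hΦG n, (quasiMeasurePreserving_pi_translate μ 0 t).ae (hΦG n), hinv t ht]
        with x h1 h2 h3
      rw [← h1, ← h3, h2]
      simp only [Function.comp_apply, pathMap, add_right_comm]
    filter_upwards [ae_ae_of_ae_pi_pathProb h1] with v hv
    exact integral_congr_ae hv
  have hb : ∀ n, ∃ b : ℝ → Fin L → ℝ, Measurable b ∧ ∀ᵐ v, H n v = H n (b (∑ i, v i)) := by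
    obtain ⟨l, rfl⟩ := Nat.exists_eq_add_of_le' hL
    exact fun n => exists_ae_eq_comp_sum (hHm n) (hHinv n)
  choose b hb hHb using hb
  -- Invariance reduces `H n` to a function of the sum of the positions, which is the position of
  -- the sum path. Only its limit is needed, so no harmonicity is asked of it.
  refine ⟨fun n s => H n (b n s), fun n => (hHm n).comp (hb n), fun n s => hHC n _, ?_⟩
  have hlim := ae_tendsto_integral_truncation (P := Measure.pi fun _ : Fin L => pathProb μ 0)
    (Q := fun n => Measure.pi fun _ : Fin L => tailProb μ n)
    (c := fun n p i => pathConcat n (p.1 i, p.2 i)) (φ := fun n x i => pathTrunc n (x i))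
    (measurePreserving_pi_pathConcat μ)
    (fun n => measurable_pi_iff.2 fun i => (measurable_pathTrunc n).comp (measurable_pi_apply i))
    (fun n m hnm y => funext fun i => pathTrunc_pathTrunc n m hnm (y i))
    (fun n y d => funext fun i => pathTrunc_pathConcat n (y i) (d i))
    (fun n y d => funext fun i => pathConcat_pathTrunc n (y i) (d i))
    (fun y => tendsto_pi_nhds.2 fun i => tendsto_pathTrunc (y i)) hΦ hC
  have h1 : ∀ n, ∀ᵐ y ∂Measure.pi fun _ : Fin L => pathProb μ 0,
      ∫ d, Φ (fun i => pathConcat n (y i, d i)) ∂(Measure.pi fun _ => tailProb μ n) =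
        H n fun i => (pathMap n (y i)).1 := fun n => by
    have e := (measurePreserving_pi_pathConcat μ n).quasiMeasurePreserving.ae (hΦG n)
    filter_upwards [ae_ae_of_ae_prod e] with y hy
    refine integral_congr_ae ?_
    filter_upwards [hy] with d hd
    rw [hd]
    simp only [pathMap_pathConcat]
  have h2 : ∀ n, ∀ᵐ y ∂Measure.pi fun _ : Fin L => pathProb μ 0,
      H n (fun i => (pathMap n (y i)).1) = H n (b n (∑ i, (pathMap n (y i)).1)) := fun n => by
    have e : MeasurePreserving (fun (x : Fin L → ℝ × (ℕ → ℝ)) i => (pathMap n (x i)).1)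
        (Measure.pi fun _ => pathMeasure μ 0) volume :=
      measurePreserving_pi _ _ fun _ => measurePreserving_pathMap_fst μ 0 n
    rw [ae_pi_pathProb]
    exact e.quasiMeasurePreserving.ae (hHb n)
  filter_upwards [hlim, ae_all_iff.2 h1, ae_all_iff.2 h2] with y e1 e2 e3
  refine (limOrZero_eq (e1.congr fun n => ?_)).symm
  rw [e2, e3, zero_add, pathMap_sum, Prod.fst_sum]

end Joint

/-! ### Tail boundary flows of convolution powers are joint flows -/

section JointFlow

variable {μ μ' : ℕ → Measure ℝ} [∀ n, IsProbabilityMeasure (μ n)]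
  [∀ n, IsProbabilityMeasure (μ' n)] {L : ℕ} {β : NSFlow.{0}} {q : ℝ × (ℕ → ℝ) → β.Space}

theorem IsBoundaryRealization.measurePreserving_pi (hq : IsBoundaryRealization μ' β q) (L : ℕ) :
    MeasurePreserving (fun (x : Fin L → ℝ × (ℕ → ℝ)) (i : Fin L) => q (x i))
      (Measure.pi fun _ => pathProb μ' 0) (Measure.pi fun _ : Fin L => β.meas) :=
  MeasureTheory.measurePreserving_pi _ _ fun _ => hq.measurePreserving

/-- The pullback of functions on the power of the realization to several paths. -/
def pullbackPow (hq : IsBoundaryRealization μ' β q) (L : ℕ) :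
    ((Fin L → β.Space) →ₘ[Measure.pi fun _ : Fin L => β.meas] ℂ) →⋆ₐ[ℂ]
      ((Fin L → ℝ × (ℕ → ℝ)) →ₘ[Measure.pi fun _ => pathProb μ' 0] ℂ) :=
  pullback _ (hq.measurePreserving_pi L).quasiMeasurePreserving

theorem pullbackPow_injective (hq : IsBoundaryRealization μ' β q) (L : ℕ) :
    Function.Injective (pullbackPow hq L) := by
  refine (injective_iff_map_eq_zero _).2 fun F hF => ?_
  have hm := hq.measurePreserving_pi L
  refine AEEqFun.ext ?_
  have h1 : ∀ᵐ x ∂Measure.pi fun _ => pathProb μ' 0, F (fun i => q (x i)) = 0 := by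
    filter_upwards [coeFn_pullback _ hm.quasiMeasurePreserving F, AEEqFun.coeFn_zero
      (α := Fin L → ℝ × (ℕ → ℝ)) (μ := Measure.pi fun _ => pathProb μ' 0) (β := ℂ)] with x h1 h2
    have h3 : pullback _ hm.quasiMeasurePreserving F = 0 := hF
    rw [h3, h2] at h1
    exact h1.symm
  have h2 : ∀ᵐ z ∂Measure.pi fun _ : Fin L => β.meas, F z = 0 := by
    have h3 := (ae_map_iff (p := fun z => F z = 0) hm.measurable.aemeasurable
      (measurableSet_eq_fun F.stronglyMeasurable.measurable measurable_const)).2 h1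
    rwa [hm.map_eq] at h3
  filter_upwards [h2, AEEqFun.coeFn_zero (α := Fin L → β.Space)
    (μ := Measure.pi fun _ : Fin L => β.meas) (β := ℂ)] with z h3 h4
  rw [h3, h4]
  rfl

theorem pullbackPow_prodLift (hq : IsBoundaryRealization μ' β q) (t : Fin L → ℝ)
    (F : (Fin L → β.Space) →ₘ[Measure.pi fun _ : Fin L => β.meas] ℂ) :
    pullbackPow hq L (prodLift (fun _ => β) t F) =
      pullback _ (quasiMeasurePreserving_pi_translate μ' 0 (-t)) (pullbackPow hq L F) := by
  unfold pullbackPow prodLift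
  rw [pullback_pullback, pullback_pullback]
  refine AEEqFun.compQuasiMeasurePreserving_congr F
    ((quasiMeasurePreserving_prodAct (fun _ => β) (-t)).comp
      (hq.measurePreserving_pi L).quasiMeasurePreserving)
    ((hq.measurePreserving_pi L).quasiMeasurePreserving.comp
      (quasiMeasurePreserving_pi_translate μ' 0 (-t))).measurable ?_
  have h1 : ∀ᵐ x ∂Measure.pi fun _ : Fin L => pathProb μ' 0, ∀ i,
      q ((x i).1 + (-t) i, (x i).2) = β.act ((-t) i) (q (x i)) := ae_all_iff.2 fun i =>
    (quasiMeasurePreserving_eval (μ := fun _ : Fin L => pathProb μ' 0) i).ae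
      (hq.equivariant ((-t) i))
  filter_upwards [h1] with x hx
  funext i
  exact (hx i).symm

/-- After addition of the paths only the total translation remains, so zero-sum translations become
trivial. -/
theorem pullback_sum_translate (hL : 1 ≤ L) (h : ∀ n, convPow (μ' n) L = μ n) (t : Fin L → ℝ)
    (F : (ℝ × (ℕ → ℝ)) →ₘ[pathMeasure μ 0] ℂ) :
    pullback _ (quasiMeasurePreserving_pi_translate μ' 0 t)
      (pullback _ (quasiMeasurePreserving_sum hL h) F) =
    pullback _ (quasiMeasurePreserving_sum hL h)
      (pullback _ (quasiMeasurePreserving_translate μ 0 (∑ i, t i)) F) := by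
  rw [pullback_pullback, pullback_pullback]
  refine pullback_congr _ _ (funext fun x => ?_) F
  refine Prod.ext ?_ ?_
  · simp [Prod.fst_sum, Finset.sum_add_distrib]
  · simp [Prod.snd_sum]

theorem pullback_sum_injective (hL : 1 ≤ L) (h : ∀ n, convPow (μ' n) L = μ n) :
    Function.Injective (pullback _ (quasiMeasurePreserving_sum hL h)) := by
  refine (injective_iff_map_eq_zero _).2 fun F hF => ?_
  refine AEEqFun.ext ?_
  have h1 : ∀ᵐ x ∂Measure.pi fun _ : Fin L => pathProb μ' 0, F (∑ i, x i) = 0 := by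
    filter_upwards [coeFn_pullback _ (quasiMeasurePreserving_sum hL h) F, AEEqFun.coeFn_zero
      (α := Fin L → ℝ × (ℕ → ℝ)) (μ := Measure.pi fun _ => pathProb μ' 0) (β := ℂ)] with x h1 h2
    rw [hF, h2] at h1
    exact h1.symm
  filter_upwards [(ae_sum_iff hL h (p := fun y => F y = 0)
    (measurableSet_eq_fun F.stronglyMeasurable.measurable measurable_const)).1 h1,
    AEEqFun.coeFn_zero (α := ℝ × (ℕ → ℝ)) (μ := pathMeasure μ 0) (β := ℂ)] with z h3 h4
  rw [h3, h4]
  rfl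

theorem pullback_translate_zero (F : (ℝ × (ℕ → ℝ)) →ₘ[pathMeasure μ 0] ℂ) :
    pullback _ (quasiMeasurePreserving_translate μ 0 0) F = F := by
  refine AEEqFun.ext ?_
  filter_upwards [coeFn_pullback _ (quasiMeasurePreserving_translate μ 0 0) F] with x hx
  rw [hx]
  simp

/-- Since `pathMap n` is additive, a tail function of the sum factors at every time through the
separate paths, hence through their `q`-values. Its invariance is checked after the injective
pullback to path space. -/
theorem exists_joint_of_tail (hq : IsBoundaryRealization μ' β q) (hL : 1 ≤ L)
    (h : ∀ n, convPow (μ' n) L = μ n) {F₀ : (ℝ × (ℕ → ℝ)) →ₘ[pathMeasure μ 0] ℂ}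
    (hF₀ : F₀ ∈ tailBoundary μ) : ∃ F ∈ jointAlgebra fun _ : Fin L => β,
      pullback _ (quasiMeasurePreserving_sum hL h) F₀ = pullbackPow hq L F := by
  obtain ⟨g, hg, hF₀g⟩ := exists_isTailFunction μ hF₀
  obtain ⟨C, hC⟩ := hg.bounded
  have hσ := quasiMeasurePreserving_sum hL h
  -- No parameter is left at this stage, so the parameter space is a point.
  obtain ⟨f, hf, hfC, hgf⟩ := hq.exists_comp_pi L (dirac ())
    (Φ := fun p : (Fin L → ℝ × (ℕ → ℝ)) × Unit => g (∑ i, p.1 i))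
    (hg.measurable.comp (by fun_prop)) (fun p => hC _) fun n => by
      obtain ⟨g', hg', hgg'⟩ := hg.factor n
      rw [ae_pathProb] at hgg'
      refine ⟨fun p => g' (∑ i, p.1 i), hg'.comp (by fun_prop), ?_⟩
      filter_upwards [measurePreserving_fst.quasiMeasurePreserving.ae (hσ.ae hgg')] with p hp
      rw [hp, pathMap_sum]
  have hgf' : ∀ᵐ x ∂Measure.pi fun _ : Fin L => pathProb μ' 0,
      g (∑ i, x i) = f (fun i => q (x i), ()) := by
    filter_upwards [ae_ae_of_ae_prod hgf] with x hx
    obtain ⟨u, hu⟩ := hx.exists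
    exact hu
  have hfm : Measurable fun z : Fin L → β.Space => f (z, ()) := hf.comp (by fun_prop)
  set F : (Fin L → β.Space) →ₘ[Measure.pi fun _ : Fin L => β.meas] ℂ :=
    AEEqFun.mk _ hfm.aestronglyMeasurable
  have hF : pullback _ hσ F₀ = pullbackPow hq L F := by
    have hm := (hq.measurePreserving_pi L).quasiMeasurePreserving
    refine AEEqFun.ext ?_
    filter_upwards [coeFn_pullback _ hσ F₀, coeFn_pullback _ hm F, hσ.ae hF₀g, hgf',
      hm.ae (AEEqFun.coeFn_mk _ hfm.aestronglyMeasurable)] with x h1 h2 h3 h4 h5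
    rw [h1, Function.comp_apply, h3, h4]
    refine Eq.trans ?_ h2.symm
    exact h5.symm
  refine ⟨F, ⟨mk_mem_Linfty hfm (ae_of_all _ fun z => hfC _), fun t ht => ?_⟩, hF⟩
  apply pullbackPow_injective hq L
  rw [pullbackPow_prodLift, ← hF, pullback_sum_translate hL h]
  have : ∑ i, (-t) i = 0 := by simp [ht]
  rw [this, pullback_translate_zero]

/-- Pulled back along `q`, an element of the joint algebra is tail measurable and invariant under
zero-sum translations, hence a boundary limit along the sum of the paths. Every such bounded limit
lies in the tail boundary of `μ`. -/
theorem exists_tail_of_joint (hq : IsBoundaryRealization μ' β q) (hL : 1 ≤ L)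
    (h : ∀ n, convPow (μ' n) L = μ n)
    {F : (Fin L → β.Space) →ₘ[Measure.pi fun _ : Fin L => β.meas] ℂ}
    (hF : F ∈ jointAlgebra fun _ : Fin L => β) : ∃ F₀ ∈ tailBoundary μ,
      pullback _ (quasiMeasurePreserving_sum hL h) F₀ = pullbackPow hq L F := by
  obtain ⟨C, hC0, hC⟩ := exists_nonneg_bound hF.1
  obtain ⟨f, hf, hfC, hFf⟩ := exists_bounded_of_ae_le F.stronglyMeasurable.measurable hC0 hC
  have hm := hq.measurePreserving_pi L
  have hΦ : pullbackPow hq L F =ᵐ[Measure.pi fun _ => pathProb μ' 0] fun x => f fun i => q (x i) := by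
    filter_upwards [coeFn_pullback _ hm.quasiMeasurePreserving F,
      hm.quasiMeasurePreserving.ae hFf] with x h1 h2
    exact h1.trans h2
  obtain ⟨k, hk, hkC, hfk⟩ := exists_eq_boundaryLimit_sum (μ := μ') hL
    (Φ := fun x => f fun i => q (x i)) (hf.comp hm.measurable) (fun x => hfC _) (fun n => by
      obtain ⟨q', hq', hqq'⟩ := hq.factor n
      refine ⟨fun x => f fun i => q' (x i), hf.comp (by fun_prop), ?_⟩
      have : ∀ᵐ x ∂Measure.pi fun _ : Fin L => pathProb μ' 0, ∀ i,
          q (x i) = q' (pathMap n (x i)) := ae_all_iff.2 fun i =>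
        (quasiMeasurePreserving_eval (μ := fun _ : Fin L => pathProb μ' 0) i).ae hqq'
      filter_upwards [this] with x hx
      simp only [hx]) fun t ht => by
    have h1 := pullbackPow_prodLift hq (-t) F
    have h2 : prodLift (fun _ => β) (-t) F = F := hF.2 (-t) (by simp [ht])
    rw [h2, neg_neg] at h1
    filter_upwards [coeFn_pullback _ (quasiMeasurePreserving_pi_translate μ' 0 t)
      (pullbackPow hq L F), hΦ, (quasiMeasurePreserving_pi_translate μ' 0 t).ae hΦ] with x h3 h4 h5
    rw [← h1, h4] at h3
    rw [h3]
    exact h5.symm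
  refine ⟨_, mk_boundaryLimit_mem μ hk hkC, AEEqFun.ext ?_⟩
  have hσ := quasiMeasurePreserving_sum hL h
  have hbm := (measurable_boundaryLimit hk 0).aestronglyMeasurable (μ := pathMeasure μ 0)
  filter_upwards [coeFn_pullback _ hσ (AEEqFun.mk _ hbm), hσ.ae (AEEqFun.coeFn_mk _ hbm), hΦ, hfk]
    with x h1 h2 h3 h4
  rw [h1, h3, h4]
  exact h2

/-- The tail boundary flow of a sequence of `L`-th convolution powers is the joint flow of `L`
copies of a single flow. -/
theorem actionsIsomorphic_jointAct (hq : IsBoundaryRealization μ' β q) (hL : 1 ≤ L)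
    (h : ∀ n, convPow (μ' n) L = μ n) :
    ActionsIsomorphic (tailBoundaryAct μ) (jointAct (fun _ : Fin L => β) ⟨0, hL⟩) := by
  set T := pullback _ (quasiMeasurePreserving_sum hL h)
  -- The two injective pullbacks have the same image of the algebras in the functions of `L` paths;
  -- corresponding elements are those with equal images.
  refine actionsIsomorphic_of_correspondence (fun F₀ F => T F₀.1 = pullbackPow hq L F.1)
    (fun h1 h2 => ?_) (fun c _ _ h1 => ?_) (fun h1 h2 => ?_) (fun h1 => ?_) (fun F₀ => ?_)
    (fun F => ?_) (fun {F₀} h1 => ?_) (fun {F} h1 => ?_) (fun s F₀ F h1 => ?_)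
  · exact (map_add T _ _).trans ((congrArg₂ _ h1 h2).trans (map_add (pullbackPow hq L) _ _).symm)
  · exact (map_smul T c _).trans ((congrArg _ h1).trans (map_smul (pullbackPow hq L) c _).symm)
  · exact (map_mul T _ _).trans ((congrArg₂ _ h1 h2).trans (map_mul (pullbackPow hq L) _ _).symm)
  · exact (map_star T _).trans ((congrArg _ h1).trans (map_star (pullbackPow hq L) _).symm)
  · obtain ⟨F, hF, e⟩ := exists_joint_of_tail hq hL h F₀.2
    exact ⟨⟨F, hF⟩, e⟩
  · obtain ⟨F₀, hF₀, e⟩ := exists_tail_of_joint hq hL h F.2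
    exact ⟨⟨F₀, hF₀⟩, e⟩
  · refine Subtype.ext (pullback_sum_injective hL h (h1.trans ?_))
    exact (map_zero (pullbackPow hq L)).trans (map_zero T).symm
  · refine Subtype.ext (pullbackPow_injective hq L (h1.symm.trans ?_))
    exact (map_zero T).trans (map_zero (pullbackPow hq L)).symm
  -- Acting by `s` in one coordinate translates the sum of the paths by `-s`, which is the tail
  -- boundary action of `s`.
  · have h2 := pullbackPow_prodLift hq (Pi.single ⟨0, hL⟩ s) F.1
    rw [← h1, pullback_sum_translate hL h] at h2
    have : ∑ i, (-Pi.single ⟨0, hL⟩ s : Fin L → ℝ) i = -s := by simp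
    rw [this] at h2
    exact h2.symm

/-- The flow `β` realizes the tail boundary of the compound Poisson laws of `ρ n / L`, whose `L`-th
convolution powers are the laws of `ρ n`. -/
theorem NSFlow.IsPoisson.isInfinitelyDivisible {α : NSFlow.{u}} (h : α.IsPoisson) :
    α.IsInfinitelyDivisible := by
  obtain ⟨-, ρ, hρ, hα⟩ := h
  intro L hL
  obtain ⟨β, q, hq⟩ := exists_isBoundaryRealization
    fun n => compoundPoisson ((L : NNReal)⁻¹ • ρ n)
  exact ⟨β, ActionsIsomorphic.trans hα
    (actionsIsomorphic_jointAct hq hL fun n => convPow_compoundPoisson (ρ n) hL)⟩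

end JointFlow

end

end BoundaryFlow

theorem mainTheorem12 :
    (∀ α : BoundaryFlow.NSFlow.{u}, α.IsPoisson → α.IsInfinitelyDivisible) ∧
    (∀ (μ : ℕ → MeasureTheory.Measure ℝ) [∀ n, MeasureTheory.IsProbabilityMeasure (μ n)],
      (∀ n, BoundaryFlow.IsInfinitelyDivisibleDistribution (μ n)) →
      ∀ α : BoundaryFlow.NSFlow.{u}, BoundaryFlow.IsTailBoundaryFlow α μ → α.IsPoisson) := by
  exact ⟨fun _ h => h.isInfinitelyDivisible, fun μ _ hμ _ h => h.isPoisson μ hμ⟩
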